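/- Let $A=\bigoplus_{i\ge 0}A_i$ be a non-negatively graded $\mathbb F_2$-algebra (for example with $A_0=\mathbb F_2$), and let $\{A_\alpha\}_{\alpha\in I}$ be a directed system of graded subalgebras of $A$: $I$ is a nonempty directed set, $A_\alpha\subseteq A_\beta$ for $\alpha\le\beta$, and $A=\varinjlim_\alpha A_\alpha=\bigcup_\alpha A_\alpha$. For a graded $\mathbb F_2$-algebra $B$ let $B^e=B\otimes_{\mathbb F_2}B^{op}$ be its enveloping algebra with the total grading (so $B^e=B\otimes_{\mathbb F_2} B$ if $B$ is commutative). For a $\mathbb Z$-graded $B^e$-module $N$ and $s\in\mathbb Z$ let $N[s]$ be the shifted module, $N[s]_i=N_{i+s}$, and let $\mathrm{HH}^{n,s}(B,N)=\mathrm{Ext}^n(B,N[s])$ be the graded Hochschild cohomology, where $\mathrm{Ext}^n(B,-)$ denotes the $n$-th right derived functor of $\mathrm{Hom}(B,-)$ on the category of $\mathbb Z$-graded $B^e$-modules and degree-preserving homomorphisms. Let $M$ be a $\mathbb Z$-graded $A^e$-module, regarded as a graded $A_\alpha^e$-module for each $\alpha$ by restriction; the groups $\mathrm{HH}^{q,s}(A_\alpha,M)$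 form an inverse system over $I$ under the restriction maps. Then for each integer $s$ there is a first quadrant cohomological spectral sequence of abelian groups (automatically of $\mathbb F_2$-vector spaces), with differentials $d_r\colon E_r^{p,q}\to E_r^{p+r,q-r+1}$ for $r\ge 2$, $$E_2^{p,q}={\varprojlim_{\alpha}}^{p}\,\mathrm{HH}^{q,s}(A_\alpha,M)\ \Longrightarrow\ \mathrm{HH}^{p+q,s}(A,M),$$ where ${\varprojlim_\alpha}^p$ is the $p$-th right derived functor of the inverse limit functor. Convergence means that for each $n\ge 0$ the group $H^n=\mathrm{HH}^{n,s}(A,M)$ has a decreasing filtration $H^n=F^0\supseteq F^1\supseteq\dots\supseteq F^{n+1}=0$ with $F^p/F^{p+1}\cong E_\infty^{p,n-p}$ for $0\le p\le n$. -/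

import Mathlib

open CategoryTheory CategoryTheory.Limits TensorProduct

universe u

noncomputable section

/-- Let `R = ⨁ i ≥ 0, 𝓡 i` be a graded algebra. A graded `R`-module is an `R`-module together
with a decomposition `M = ⨁ j : ℤ, M.deg j` into subgroups such that
`𝓡 i • M.deg j ⊆ M.deg (i + j)`. -/
structure GradedModuleCat {k : Type*} [CommRing k] {R : Type u} [Ring R] [Algebra k R]
    (𝓡 : ℕ → Submodule k R) where
  carrier : Type u
  [addCommGroup : AddCommGroup carrier]
  [module : Module R carrier]
  deg : ℤ → AddSubgroup carrier
  isInternal : DirectSum.IsInternal deg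
  smul_mem : ∀ (i : ℕ) (j : ℤ) (r : R) (m : carrier),
    r ∈ 𝓡 i → m ∈ deg j → r • m ∈ deg ((i : ℤ) + j)

attribute [instance] GradedModuleCat.addCommGroup GradedModuleCat.module

theorem isInternal_of_proj_of_surjective {ι M σ : Type*} [DecidableEq ι] [AddCommGroup M]
    [SetLike σ M] [AddSubmonoidClass σ M] (D : ι → σ)
    (π : ι → M →+ M) (hsame : ∀ n x, x ∈ D n → π n x = x)
    (hne : ∀ m n x, m ≠ n → x ∈ D n → π m x = 0)
    (hsurj : Function.Surjective (DirectSum.coeAddMonoidHom D)) :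
    DirectSum.IsInternal D := by
  have key : ∀ (n : ι) (y : DirectSum ι fun i => D i),
      π n (DirectSum.coeAddMonoidHom D y) = y n := by
    intro n y
    induction y using DirectSum.induction_on with
    | zero => simp
    | of i x =>
      rw [DirectSum.coeAddMonoidHom_of]
      by_cases h : n = i
      · subst h; rw [hsame _ _ x.2, DirectSum.of_eq_same]
      · rw [hne _ _ _ h x.2, DirectSum.of_eq_of_ne _ _ _ h]; rfl
    | add x y hx hy => rw [map_add, map_add, hx, hy]; rfl
  refine ⟨fun x y h => ?_, hsurj⟩
  ext n
  rw [← key, ← key, h]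

theorem isInternal_of_proj {M : Type*} [AddCommGroup M] (D : ℤ → AddSubgroup M)
    (π : ℤ → M →+ M) (hsame : ∀ n x, x ∈ D n → π n x = x)
    (hne : ∀ m n x, m ≠ n → x ∈ D n → π m x = 0) (hsup : ∀ x, x ∈ ⨆ n, D n) :
    DirectSum.IsInternal D := by
  refine isInternal_of_proj_of_surjective D π hsame hne fun x => ?_
  have : (⨆ n, D n) ≤ (DirectSum.coeAddMonoidHom D).range :=
    iSup_le fun n z hz => ⟨DirectSum.of (fun i => D i) n ⟨z, hz⟩, by simp⟩
  exact this (hsup x)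

namespace GradedModuleCat

section Basic

variable {k : Type*} [CommRing k] {R : Type u} [Ring R] [Algebra k R] {𝓡 : ℕ → Submodule k R}

/-- The group of homomorphisms of graded modules: the `R`-linear maps `f` such that
`f (M.deg j) ⊆ N.deg j` for all `j`. -/
def homs (M N : GradedModuleCat 𝓡) : AddSubgroup (M.carrier →ₗ[R] N.carrier) where
  carrier := {f | ∀ (j : ℤ) (m : M.carrier), m ∈ M.deg j → f m ∈ N.deg j}
  zero_mem' := fun j _ _ => (N.deg j).zero_mem
  add_mem' := fun hf hg j m hm => (N.deg j).add_mem (hf j m hm) (hg j m hm)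
  neg_mem' := fun hf j m hm => (N.deg j).neg_mem (hf j m hm)

instance : Category (GradedModuleCat 𝓡) where
  Hom M N := homs M N
  id _ := ⟨LinearMap.id, fun _ _ h => h⟩
  comp f g := ⟨g.1.comp f.1, fun j m h => g.2 j _ (f.2 j m h)⟩

/-- The linear map underlying a homomorphism of graded modules. -/
def Hom.lin {M N : GradedModuleCat 𝓡} (f : M ⟶ N) : M.carrier →ₗ[R] N.carrier := f.1

theorem Hom.lin_mem {M N : GradedModuleCat 𝓡} (f : M ⟶ N) {j : ℤ} {m : M.carrier}
    (h : m ∈ M.deg j) : Hom.lin f m ∈ N.deg j := f.2 j m h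

/-- Constructor for homomorphisms of graded modules. -/
def ofLin {M N : GradedModuleCat 𝓡} (f : M.carrier →ₗ[R] N.carrier)
    (h : ∀ (j : ℤ) (m : M.carrier), m ∈ M.deg j → f m ∈ N.deg j) : M ⟶ N := ⟨f, h⟩

@[simp] theorem lin_ofLin {M N : GradedModuleCat 𝓡} (f : M.carrier →ₗ[R] N.carrier)
    (h : ∀ (j : ℤ) (m : M.carrier), m ∈ M.deg j → f m ∈ N.deg j) :
    Hom.lin (ofLin f h) = f := rfl

@[ext] theorem hom_ext {M N : GradedModuleCat 𝓡} {f g : M ⟶ N}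
    (h : Hom.lin f = Hom.lin g) : f = g := Subtype.ext h

instance : Preadditive (GradedModuleCat 𝓡) where
  homGroup M N := inferInstanceAs (AddCommGroup (homs M N))
  add_comp _ _ _ f f' g := Subtype.ext (LinearMap.comp_add f.1 f'.1 g.1)
  comp_add _ _ _ f g g' := Subtype.ext (LinearMap.add_comp f.1 g'.1 g.1)

@[simp] theorem lin_comp {M N P : GradedModuleCat 𝓡} (f : M ⟶ N) (g : N ⟶ P) :
    Hom.lin (f ≫ g) = (Hom.lin g).comp (Hom.lin f) := rfl
@[simp] theorem lin_id (M : GradedModuleCat 𝓡) : Hom.lin (𝟙 M) = LinearMap.id := rfl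
@[simp] theorem lin_zero (M N : GradedModuleCat 𝓡) : Hom.lin (0 : M ⟶ N) = 0 := rfl
@[simp] theorem lin_add {M N : GradedModuleCat 𝓡} (f g : M ⟶ N) :
    Hom.lin (f + g) = Hom.lin f + Hom.lin g := rfl

/-- The homogeneous component of degree `n`. -/
def proj (M : GradedModuleCat 𝓡) (n : ℤ) : M.carrier →+ M.carrier :=
  ((M.deg n).subtype.comp (DFinsupp.evalAddMonoidHom (β := fun i => M.deg i) n)).comp
    (AddEquiv.ofBijective _ M.isInternal).symm.toAddMonoidHom

theorem proj_mem (M : GradedModuleCat 𝓡) (n : ℤ) (x : M.carrier) : M.proj n x ∈ M.deg n :=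
  Subtype.property _

theorem symm_of_mem (M : GradedModuleCat 𝓡) (n : ℤ) (x : M.carrier) (h : x ∈ M.deg n) :
    (AddEquiv.ofBijective _ M.isInternal).symm x = DirectSum.of (fun i => M.deg i) n ⟨x, h⟩ := by
  rw [AddEquiv.symm_apply_eq]
  exact (DirectSum.coeAddMonoidHom_of M.deg n ⟨x, h⟩).symm

theorem proj_same (M : GradedModuleCat 𝓡) (n : ℤ) (x : M.carrier) (h : x ∈ M.deg n) :
    M.proj n x = x := by
  change (((AddEquiv.ofBijective _ M.isInternal).symm x) n : M.carrier) = x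
  rw [symm_of_mem M n x h, DirectSum.of_eq_same]

theorem proj_ne (M : GradedModuleCat 𝓡) (m n : ℤ) (x : M.carrier) (hmn : m ≠ n)
    (h : x ∈ M.deg n) : M.proj m x = 0 := by
  change (((AddEquiv.ofBijective _ M.isInternal).symm x) m : M.carrier) = 0
  rw [symm_of_mem M n x h, DirectSum.of_eq_of_ne _ _ _ hmn]; rfl

theorem exists_sum (M : GradedModuleCat 𝓡) (x : M.carrier) :
    ∃ s : Finset ℤ, x = ∑ n ∈ s, M.proj n x := by
  classical
  refine ⟨((AddEquiv.ofBijective _ M.isInternal).symm x).support, ?_⟩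
  conv_lhs => rw [← (AddEquiv.ofBijective _ M.isInternal).apply_symm_apply x]
  exact DirectSum.coeAddMonoidHom_eq_dfinsuppSum _ _

theorem mem_iSup (M : GradedModuleCat 𝓡) (x : M.carrier) : x ∈ ⨆ n, M.deg n := by
  obtain ⟨s, hs⟩ := M.exists_sum x
  rw [hs]
  exact AddSubgroup.sum_mem _ fun n _ => (le_iSup M.deg n) (M.proj_mem n x)

theorem proj_lin {M N : GradedModuleCat 𝓡} (f : M ⟶ N) (n : ℤ) (x : M.carrier) :
    N.proj n (Hom.lin f x) = Hom.lin f (M.proj n x) := by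
  have h := M.mem_iSup x
  induction h using AddSubgroup.iSup_induction' with
  | hp i x hx =>
    by_cases h : n = i
    · subst h; rw [proj_same _ _ _ hx, proj_same _ _ _ (Hom.lin_mem f hx)]
    · rw [proj_ne _ _ _ _ h hx, proj_ne _ _ _ _ h (Hom.lin_mem f hx), map_zero]
  | h1 => simp
  | hadd x y _ _ hx hy => simp only [map_add, hx, hy]

/-- The kernel of a homomorphism, with the induced grading. -/
def ker {M N : GradedModuleCat 𝓡} (f : M ⟶ N) : GradedModuleCat 𝓡 where
  carrier := LinearMap.ker (Hom.lin f)
  deg n := (M.deg n).comap (LinearMap.ker (Hom.lin f)).subtype.toAddMonoidHom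
  isInternal := by
    have hk : ∀ n, ∀ x : LinearMap.ker (Hom.lin f), M.proj n x ∈ LinearMap.ker (Hom.lin f) := by
      intro n x
      rw [LinearMap.mem_ker, ← proj_lin, x.2, map_zero]
    refine isInternal_of_proj _
      (fun n => ((M.proj n).comp (LinearMap.ker (Hom.lin f)).subtype.toAddMonoidHom).codRestrict
        (LinearMap.ker (Hom.lin f)) (hk n)) ?_ ?_ ?_
    · exact fun n x hx => Subtype.ext (M.proj_same n x.1 hx)
    · exact fun m n x hmn hx => Subtype.ext (M.proj_ne m n x.1 hmn hx)
    · intro x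
      obtain ⟨s, hs⟩ := M.exists_sum x.1
      have : x = ∑ n ∈ s, (⟨M.proj n x.1, hk n x⟩ : LinearMap.ker (Hom.lin f)) := by
        apply Subtype.ext
        rw [AddSubmonoidClass.coe_finsetSum]
        exact hs
      rw [this]
      refine AddSubgroup.sum_mem _ fun n _ => AddSubgroup.mem_iSup_of_mem n ?_
      exact M.proj_mem n x.1
  smul_mem i j r m hr hm := M.smul_mem i j r m.1 hr hm

/-- The cokernel of a homomorphism, with the induced grading. -/
def coker {M N : GradedModuleCat 𝓡} (f : M ⟶ N) : GradedModuleCat 𝓡 where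
  carrier := N.carrier ⧸ LinearMap.range (Hom.lin f)
  deg n := (N.deg n).map (LinearMap.range (Hom.lin f)).mkQ.toAddMonoidHom
  isInternal := by
    have hk : ∀ n, (LinearMap.range (Hom.lin f)).toAddSubgroup ≤
        (LinearMap.range (Hom.lin f)).toAddSubgroup.comap (N.proj n) := by
      rintro n _ ⟨x, rfl⟩
      exact ⟨M.proj n x, (proj_lin f n x).symm⟩
    refine isInternal_of_proj _
      (fun n => (QuotientAddGroup.map _ _ (N.proj n) (hk n) :
        N.carrier ⧸ (LinearMap.range (Hom.lin f)).toAddSubgroup →+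
        N.carrier ⧸ (LinearMap.range (Hom.lin f)).toAddSubgroup)) ?_ ?_ ?_
    · rintro n _ ⟨x, hx, rfl⟩
      exact congrArg (LinearMap.range (Hom.lin f)).mkQ (N.proj_same n x hx)
    · rintro m n _ hmn ⟨x, hx, rfl⟩
      exact congrArg (LinearMap.range (Hom.lin f)).mkQ (N.proj_ne m n x hmn hx)
    · intro x
      obtain ⟨x, rfl⟩ := Submodule.mkQ_surjective _ x
      obtain ⟨s, hs⟩ := N.exists_sum x
      rw [hs, map_sum]
      refine AddSubgroup.sum_mem _ fun n _ => AddSubgroup.mem_iSup_of_mem n ?_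
      exact ⟨_, N.proj_mem n x, rfl⟩
  smul_mem := by
    rintro i j r _ hr ⟨m, hm, rfl⟩
    exact ⟨r • m, N.smul_mem i j r m hr hm, map_smul (LinearMap.range (Hom.lin f)).mkQ r m⟩

/-- The direct sum of two graded modules. -/
def prod (M N : GradedModuleCat 𝓡) : GradedModuleCat 𝓡 where
  carrier := M.carrier × N.carrier
  deg n := (M.deg n).prod (N.deg n)
  isInternal := by
    refine isInternal_of_proj _ (fun n => (M.proj n).prodMap (N.proj n)) ?_ ?_ ?_
    · exact fun n x hx => Prod.ext (M.proj_same n _ hx.1) (N.proj_same n _ hx.2)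
    · exact fun m n x hmn hx => Prod.ext (M.proj_ne m n _ hmn hx.1) (N.proj_ne m n _ hmn hx.2)
    · rintro ⟨x, y⟩
      obtain ⟨s, hs⟩ := M.exists_sum x
      obtain ⟨t, ht⟩ := N.exists_sum y
      have : (x, y) = (AddMonoidHom.inl M.carrier N.carrier) x +
          (AddMonoidHom.inr M.carrier N.carrier) y := by simp
      rw [this, hs, ht, map_sum, map_sum]
      refine AddSubgroup.add_mem _ ?_ ?_ <;>
        refine AddSubgroup.sum_mem _ fun n _ => AddSubgroup.mem_iSup_of_mem n ?_
      · exact ⟨M.proj_mem n x, (N.deg n).zero_mem⟩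
      · exact ⟨(M.deg n).zero_mem, N.proj_mem n y⟩
  smul_mem i j r m hr hm := ⟨M.smul_mem i j r _ hr hm.1, N.smul_mem i j r _ hr hm.2⟩

/-- The zero graded module. -/
def zeroObj : GradedModuleCat 𝓡 where
  carrier := PUnit
  deg _ := ⊥
  isInternal := isInternal_of_proj _ (fun _ => 0) (fun _ _ _ => Subsingleton.elim _ _)
    (fun _ _ _ _ _ => rfl) (fun x => by
      rw [Subsingleton.elim x 0]; exact AddSubgroup.zero_mem _)
  smul_mem _ _ _ _ _ _ := Subsingleton.elim _ _

instance : HasZeroObject (GradedModuleCat 𝓡) :=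
  ⟨zeroObj, ⟨fun Y => ⟨⟨⟨0⟩, fun f => by
      apply hom_ext; apply LinearMap.ext; intro x
      have hx : x = 0 := Subsingleton.elim (α := PUnit) _ _
      rw [hx, map_zero, map_zero]⟩⟩,
    fun Y => ⟨⟨⟨0⟩, fun f => by
      apply hom_ext; apply LinearMap.ext; intro x
      exact Subsingleton.elim (α := PUnit) _ _⟩⟩⟩⟩

instance : HasBinaryBiproducts (GradedModuleCat 𝓡) where
  has_binary_biproduct M N := hasBinaryBiproduct_of_total
    { pt := prod M N
      fst := ofLin (LinearMap.fst R M.carrier N.carrier) fun _ _ h => h.1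
      snd := ofLin (LinearMap.snd R M.carrier N.carrier) fun _ _ h => h.2
      inl := ofLin (LinearMap.inl R M.carrier N.carrier) fun j _ h => ⟨h, (N.deg j).zero_mem⟩
      inr := ofLin (LinearMap.inr R M.carrier N.carrier) fun j _ h => ⟨(M.deg j).zero_mem, h⟩
      inl_fst := rfl
      inl_snd := rfl
      inr_fst := rfl
      inr_snd := rfl } (by
        apply hom_ext
        apply LinearMap.ext
        rintro ⟨x, y⟩
        change ((x, 0) : M.carrier × N.carrier) + (0, y) = (x, y)
        simp)

instance : HasFiniteProducts (GradedModuleCat 𝓡) :=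
  hasFiniteProducts_of_has_binary_and_terminal

/-- The inclusion of the kernel. -/
def kerι {M N : GradedModuleCat 𝓡} (f : M ⟶ N) : ker f ⟶ M :=
  ofLin (LinearMap.ker (Hom.lin f)).subtype fun _ _ h => h

theorem kerι_comp {M N : GradedModuleCat 𝓡} (f : M ⟶ N) : kerι f ≫ f = 0 :=
  hom_ext (LinearMap.ext fun x => x.2)

/-- The kernel fork. -/
def kerFork {M N : GradedModuleCat 𝓡} (f : M ⟶ N) : KernelFork f :=
  KernelFork.ofι (kerι f) (kerι_comp f)

/-- `ker f` is a kernel of `f`. -/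
def kerForkIsLimit {M N : GradedModuleCat 𝓡} (f : M ⟶ N) : IsLimit (kerFork f) :=
  KernelFork.IsLimit.ofι (kerι f) (kerι_comp f)
    (fun g hg => ofLin ((Hom.lin g).codRestrict (LinearMap.ker (Hom.lin f))
      fun x => LinearMap.congr_fun (congrArg Hom.lin hg) x) fun _ _ h => Hom.lin_mem g h)
    (fun _ _ => rfl)
    (fun g hg m hm => by
      apply hom_ext; apply LinearMap.ext; intro x
      exact Subtype.ext (LinearMap.congr_fun (congrArg Hom.lin hm) x))

/-- The projection to the cokernel. -/
def cokerπ {M N : GradedModuleCat 𝓡} (f : M ⟶ N) : N ⟶ coker f :=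
  ofLin (LinearMap.range (Hom.lin f)).mkQ fun _ m h => ⟨m, h, rfl⟩

theorem comp_cokerπ {M N : GradedModuleCat 𝓡} (f : M ⟶ N) : f ≫ cokerπ f = 0 :=
  hom_ext (LinearMap.ext fun x => (Submodule.Quotient.mk_eq_zero _).2 ⟨x, rfl⟩)

/-- The cokernel cofork. -/
def cokerCofork {M N : GradedModuleCat 𝓡} (f : M ⟶ N) : CokernelCofork f :=
  CokernelCofork.ofπ (cokerπ f) (comp_cokerπ f)

/-- `coker f` is a cokernel of `f`. -/
def cokerCoforkIsColimit {M N : GradedModuleCat 𝓡} (f : M ⟶ N) : IsColimit (cokerCofork f) :=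
  CokernelCofork.IsColimit.ofπ (cokerπ f) (comp_cokerπ f)
    (fun g hg => ofLin ((LinearMap.range (Hom.lin f)).liftQ (Hom.lin g) (by
        rintro _ ⟨x, rfl⟩; exact LinearMap.congr_fun (congrArg Hom.lin hg) x))
      (by rintro j _ ⟨m, hm, rfl⟩; exact Hom.lin_mem g hm))
    (fun _ _ => hom_ext (LinearMap.ext fun _ => rfl))
    (fun g hg m hm => by
      apply hom_ext; apply LinearMap.ext; intro x
      obtain ⟨x, rfl⟩ := Submodule.mkQ_surjective _ x
      exact LinearMap.congr_fun (congrArg Hom.lin hm) x)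

instance : HasKernels (GradedModuleCat 𝓡) := ⟨fun f => ⟨⟨⟨kerFork f, kerForkIsLimit f⟩⟩⟩⟩
instance : HasCokernels (GradedModuleCat 𝓡) :=
  ⟨fun f => ⟨⟨⟨cokerCofork f, cokerCoforkIsColimit f⟩⟩⟩⟩

variable (𝓡) in
/-- The functor forgetting the grading. -/
def toModule : GradedModuleCat 𝓡 ⥤ ModuleCat.{u} R where
  obj M := ModuleCat.of R M.carrier
  map f := ModuleCat.ofHom (Hom.lin f)

instance : (toModule 𝓡).Additive where

instance {M N : GradedModuleCat 𝓡} (f : M ⟶ N) :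
    PreservesLimit (parallelPair f 0) (toModule 𝓡) :=
  preservesLimit_of_preserves_limit_cone (kerForkIsLimit f) <|
    (KernelFork.isLimitMapConeEquiv _ _).symm (ModuleCat.kernelIsLimit ((toModule 𝓡).map f))

instance {M N : GradedModuleCat 𝓡} (f : M ⟶ N) :
    PreservesColimit (parallelPair f 0) (toModule 𝓡) :=
  preservesColimit_of_preserves_colimit_cocone (cokerCoforkIsColimit f) <|
    (CokernelCofork.isColimitMapCoconeEquiv _ _).symm
      (ModuleCat.cokernelIsColimit ((toModule 𝓡).map f))

instance : (toModule 𝓡).ReflectsIsomorphisms where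
  reflects {M N} f hf := by
    have hb : Function.Bijective (Hom.lin f) :=
      ConcreteCategory.bijective_of_isIso ((toModule 𝓡).map f)
    let e := LinearEquiv.ofBijective (Hom.lin f) hb
    refine ⟨ofLin e.symm.toLinearMap ?_, ?_, ?_⟩
    · intro j y hy
      obtain ⟨x, rfl⟩ := hb.2 y
      have h1 : e.symm (Hom.lin f x) = x := e.symm_apply_apply x
      change e.symm (Hom.lin f x) ∈ M.deg j
      rw [h1]
      have h2 : M.proj j x = x := hb.1 (by rw [← proj_lin, proj_same _ _ _ hy])
      rw [← h2]; exact M.proj_mem j x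
    · apply hom_ext; apply LinearMap.ext; intro x; exact e.symm_apply_apply x
    · apply hom_ext; apply LinearMap.ext; intro x; exact e.apply_symm_apply x

instance {M N : GradedModuleCat 𝓡} (f : M ⟶ N) :
    IsIso (Abelian.coimageImageComparison f) := by
  have : IsIso ((toModule 𝓡).map (Abelian.coimageImageComparison f)) :=
    ((MorphismProperty.isomorphisms (ModuleCat.{u} R)).arrow_mk_iso_iff
      (Abelian.PreservesCoimageImageComparison.iso (toModule 𝓡) f)).2
        (inferInstanceAs (IsIso (Abelian.coimageImageComparison ((toModule 𝓡).map f))))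
  exact isIso_of_reflects_iso _ (toModule 𝓡)

instance : Abelian (GradedModuleCat 𝓡) := Abelian.ofCoimageImageComparisonIsIso

instance : PreservesFiniteLimits (toModule 𝓡) :=
  Functor.preservesFiniteLimits_of_preservesKernels _

instance : PreservesFiniteColimits (toModule 𝓡) :=
  Functor.preservesFiniteColimits_of_preservesCokernels _

theorem surjective_of_epi {M N : GradedModuleCat 𝓡} (f : M ⟶ N) [Epi f] :
    Function.Surjective (Hom.lin f) :=
  (ModuleCat.epi_iff_surjective ((toModule 𝓡).map f)).1 inferInstance

theorem epi_of_surjective {M N : GradedModuleCat 𝓡} (f : M ⟶ N)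
    (h : Function.Surjective (Hom.lin f)) : Epi f where
  left_cancellation g g' hg := by
    apply hom_ext; apply LinearMap.ext; intro y
    obtain ⟨x, rfl⟩ := h y
    exact LinearMap.congr_fun (congrArg Hom.lin hg) x

/-- The shifted graded module `M[s]`, given by `M[s]_i = M_{i + s}`. -/
def shift (M : GradedModuleCat 𝓡) (s : ℤ) : GradedModuleCat 𝓡 where
  carrier := M.carrier
  deg i := M.deg (i + s)
  isInternal := isInternal_of_proj _ (fun n => M.proj (n + s))
    (fun n x hx => M.proj_same _ x hx)
    (fun m n x hmn hx => M.proj_ne _ _ x (by simpa using hmn) hx)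
    (fun x => by
      have h := (Equiv.addRight s).surjective.iSup_comp (g := fun n => M.deg n)
      exact h.symm ▸ M.mem_iSup x)
  smul_mem i j r m hr hm := by
    rw [add_assoc]; exact M.smul_mem i (j + s) r m hr hm

/-- The homomorphism `M[s] ⟶ N[s]` induced by `M ⟶ N`. -/
def shiftHom {M N : GradedModuleCat 𝓡} (f : M ⟶ N) (s : ℤ) : M.shift s ⟶ N.shift s :=
  ofLin (M := M.shift s) (N := N.shift s) f.1 fun j m h => f.2 (j + s) m h

end Basic

section Free

variable {k : Type*} [CommRing k] {R : Type u} [Ring R] [Algebra k R] (𝓡 : ℕ → Submodule k R)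

/-- The degree `z` part of `R` regarded as a `ℤ`-graded algebra: it is zero for `z < 0`. -/
def degZ (z : ℤ) : AddSubgroup R := if 0 ≤ z then (𝓡 z.toNat).toAddSubgroup else ⊥

theorem mem_degZ {i : ℕ} {r : R} (h : r ∈ 𝓡 i) : r ∈ degZ 𝓡 (i : ℤ) := by
  unfold degZ; rw [if_pos (by positivity)]; exact h

theorem smul_mem_degZ {z : ℤ} (c : k) {r : R} (hr : r ∈ degZ 𝓡 z) : c • r ∈ degZ 𝓡 z := by
  unfold degZ at hr ⊢
  split_ifs at hr ⊢ with hz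
  · exact (𝓡 z.toNat).smul_mem c hr
  · rw [AddSubgroup.mem_bot.1 hr, smul_zero]; exact zero_mem _

theorem smul_mem_of_degZ (M : GradedModuleCat 𝓡) {z n : ℤ} {r : R} {m : M.carrier}
    (hr : r ∈ degZ 𝓡 z) (hm : m ∈ M.deg n) : r • m ∈ M.deg (z + n) := by
  unfold degZ at hr
  split_ifs at hr with hz
  · have := M.smul_mem _ _ _ _ hr hm
    rwa [Int.toNat_of_nonneg hz] at this
  · rw [AddSubgroup.mem_bot.1 hr, zero_smul]; exact zero_mem _

variable [GradedAlgebra 𝓡]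

/-- The homogeneous component of degree `z : ℤ` of an element of `R`. -/
def projZ (z : ℤ) : R →+ R := if 0 ≤ z then GradedRing.proj 𝓡 z.toNat else 0

theorem projZ_same (z : ℤ) (r : R) (h : r ∈ degZ 𝓡 z) : projZ 𝓡 z r = r := by
  unfold degZ at h; unfold projZ
  split_ifs at h ⊢ with hz
  · exact DirectSum.decompose_of_mem_same 𝓡 h
  · exact (AddSubgroup.mem_bot.1 h).symm

theorem projZ_ne (y z : ℤ) (r : R) (hyz : y ≠ z) (h : r ∈ degZ 𝓡 z) : projZ 𝓡 y r = 0 := by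
  unfold degZ at h
  by_cases hz : 0 ≤ z
  · rw [if_pos hz] at h
    unfold projZ
    split_ifs with hy
    · exact DirectSum.decompose_of_mem_ne 𝓡 h (by lia)
    · rfl
  · rw [if_neg hz] at h
    rw [AddSubgroup.mem_bot.1 h, map_zero]

theorem mul_mem_degZ {i : ℕ} {z : ℤ} {r s : R} (hr : r ∈ 𝓡 i) (hs : s ∈ degZ 𝓡 z) :
    r * s ∈ degZ 𝓡 (i + z) := by
  unfold degZ at hs
  by_cases hz : 0 ≤ z
  · rw [if_pos hz] at hs
    have h1 : (i + z).toNat = i + z.toNat := by lia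
    unfold degZ
    rw [if_pos (by lia), h1]; exact SetLike.mul_mem_graded hr hs
  · rw [if_neg hz] at hs
    rw [AddSubgroup.mem_bot.1 hs, mul_zero]; exact zero_mem _

theorem mul_mem_degZ' {i : ℕ} {z : ℤ} {r s : R} (hs : s ∈ degZ 𝓡 z) (hr : r ∈ 𝓡 i) :
    s * r ∈ degZ 𝓡 (z + i) := by
  unfold degZ at hs
  by_cases hz : 0 ≤ z
  · rw [if_pos hz] at hs
    have h1 : (z + i).toNat = z.toNat + i := by lia
    unfold degZ
    rw [if_pos (by lia), h1]
    have hs' : s ∈ 𝓡 z.toNat := hs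
    exact SetLike.mul_mem_graded hs' hr
  · rw [if_neg hz] at hs
    rw [AddSubgroup.mem_bot.1 hs, zero_mul]; exact zero_mem _

theorem mem_iSup_degZ (r : R) : r ∈ ⨆ z, degZ 𝓡 z := by
  classical
  rw [← DirectSum.sum_support_decompose 𝓡 r]
  exact AddSubgroup.sum_mem _ fun n _ => AddSubgroup.mem_iSup_of_mem (n : ℤ)
    (mem_degZ 𝓡 (SetLike.coe_mem _))

/-- The free graded module with basis `X`, the basis element `x` being homogeneous of
degree `d x`. -/
def free (X : Type u) (d : X → ℤ) : GradedModuleCat 𝓡 where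
  carrier := X →₀ R
  deg n :=
    { carrier := {f | ∀ x, f x ∈ degZ 𝓡 (n - d x)}
      zero_mem' := fun _ => zero_mem _
      add_mem' := fun hf hg x => add_mem (hf x) (hg x)
      neg_mem' := fun hf x => neg_mem (hf x) }
  isInternal := by
    classical
    have key : ∀ (n : ℤ) (f : X →₀ R) (x : X), (Finsupp.liftAddHom fun x =>
        (Finsupp.singleAddHom x).comp (projZ 𝓡 (n - d x))) f x = projZ 𝓡 (n - d x) (f x) := by
      intro n f x
      induction f using Finsupp.induction_linear with
      | zero => simp
      | add f g hf hg => rw [map_add, Finsupp.add_apply, hf, hg, Finsupp.add_apply, map_add]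
      | single y r =>
        rw [Finsupp.liftAddHom_apply_single]
        simp only [AddMonoidHom.comp_apply, Finsupp.singleAddHom_apply, Finsupp.single_apply]
        split_ifs with h
        · rw [h]
        · rw [map_zero]
    refine isInternal_of_proj _ (fun n => Finsupp.liftAddHom fun x =>
        (Finsupp.singleAddHom x).comp (projZ 𝓡 (n - d x))) ?_ ?_ ?_
    · intro n f hf; ext x; rw [key]; exact projZ_same 𝓡 _ _ (hf x)
    · intro m n f hmn hf; ext x; rw [key]
      exact projZ_ne 𝓡 _ _ _ (by simpa using hmn) (hf x)
    · intro f
      induction f using Finsupp.induction_linear with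
      | zero => exact zero_mem _
      | add f g hf hg => exact add_mem hf hg
      | single y r =>
        have hr := mem_iSup_degZ 𝓡 r
        induction hr using AddSubgroup.iSup_induction' with
        | h1 => rw [Finsupp.single_zero]; exact zero_mem _
        | hadd a b _ _ ha hb => rw [Finsupp.single_add]; exact add_mem ha hb
        | hp i a ha =>
          refine AddSubgroup.mem_iSup_of_mem (i + d y) fun x => ?_
          rw [Finsupp.single_apply]
          split_ifs with h
          · rw [← h, add_sub_cancel_right]; exact ha
          · exact zero_mem _
  smul_mem i j r m hr hm x := by
    rw [add_sub_assoc]; exact mul_mem_degZ 𝓡 hr (hm x)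

/-- The homomorphism from a free graded module determined by the images of the basis. -/
def freeLift (X : Type u) (d : X → ℤ) (M : GradedModuleCat 𝓡) (v : X → M.carrier)
    (hv : ∀ x, v x ∈ M.deg (d x)) : free 𝓡 X d ⟶ M :=
  ofLin (Finsupp.linearCombination R v) (by
    intro j f hf
    change (f : X →₀ R).sum (fun x r => r • v x) ∈ M.deg j
    refine AddSubgroup.sum_mem _ fun x _ => ?_
    have := smul_mem_of_degZ 𝓡 M (hf x) (hv x)
    rwa [sub_add_cancel] at this)

instance (X : Type u) (d : X → ℤ) : Projective (free 𝓡 X d) where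
  factors {E N} f e he := by
    classical
    have h1 : ∀ x : X, (Finsupp.single x 1 : X →₀ R) ∈ (free 𝓡 X d).deg (d x) := by
      intro x y
      rw [Finsupp.single_apply]
      split_ifs with h
      · rw [h, sub_self]; exact mem_degZ 𝓡 (i := 0) SetLike.GradedOne.one_mem
      · exact zero_mem _
    have h2 : ∀ x : X, ∃ y ∈ E.deg (d x), Hom.lin e y = Hom.lin f (Finsupp.single x 1 : X →₀ R) := by
      intro x
      obtain ⟨y, hy⟩ := surjective_of_epi e (Hom.lin f (Finsupp.single x 1 : X →₀ R))
      refine ⟨E.proj (d x) y, E.proj_mem _ _, ?_⟩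
      rw [← proj_lin, hy, proj_same _ _ _ (Hom.lin_mem f (h1 x))]
    choose v hv hv' using h2
    refine ⟨freeLift 𝓡 X d E v hv, hom_ext ?_⟩
    apply Finsupp.lhom_ext
    intro x r
    change Hom.lin e (Finsupp.linearCombination R v (Finsupp.single x r)) = _
    rw [Finsupp.linearCombination_single, map_smul, hv']
    refine ((Hom.lin f).map_smul r _).symm.trans (congrArg (Hom.lin f) ?_)
    change r • (Finsupp.single x 1 : X →₀ R) = _
    simp

instance : EnoughProjectives (GradedModuleCat 𝓡) where
  presentation M := ⟨
    { p := free 𝓡 (Σ n : ℤ, M.deg n) (fun x => x.1)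
      projective := inferInstance
      f := freeLift 𝓡 _ _ M (fun x => x.2.1) fun x => x.2.2
      epi := by
        apply epi_of_surjective
        intro m
        obtain ⟨s, hs⟩ := M.exists_sum m
        rw [hs]
        refine ⟨(∑ n ∈ s, Finsupp.single ⟨n, ⟨_, M.proj_mem n m⟩⟩ 1 :
          (Σ n : ℤ, M.deg n) →₀ R), ?_⟩
        change Finsupp.linearCombination R _ _ = _
        rw [map_sum]
        refine Finset.sum_congr rfl fun n _ => ?_
        rw [Finsupp.linearCombination_single, one_smul] }⟩

instance : HasExt.{u} (GradedModuleCat 𝓡) := hasExt_of_enoughProjectives _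

end Free

section Restrict

variable {k : Type*} [CommRing k] {R R' : Type u} [Ring R] [Algebra k R] [Ring R'] [Algebra k R']
  {𝓡 : ℕ → Submodule k R} {𝓡' : ℕ → Submodule k R'}
  (φ : R' →ₐ[k] R) (hφ : ∀ (i : ℕ) (r : R'), r ∈ 𝓡' i → φ r ∈ 𝓡 i)

/-- Restriction of scalars along a homomorphism of graded algebras. -/
def restrict : GradedModuleCat 𝓡 ⥤ GradedModuleCat 𝓡' where
  obj M :=
    { carrier := M.carrier
      module := Module.compHom M.carrier (φ : R' →+* R)
      deg := M.deg
      isInternal := M.isInternal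
      smul_mem := fun i j r m hr hm => M.smul_mem i j (φ r) m (hφ i r hr) hm }
  map {M N} f :=
    letI : Module R' M.carrier := Module.compHom M.carrier (φ : R' →+* R)
    letI : Module R' N.carrier := Module.compHom N.carrier (φ : R' →+* R)
    ⟨{ toFun := Hom.lin f
       map_add' := (Hom.lin f).map_add
       map_smul' := fun r m => (Hom.lin f).map_smul (φ r) m }, fun _ _ h => Hom.lin_mem f h⟩

instance : (restrict φ hφ).Additive where

/-- Restriction of scalars commutes with forgetting the grading. -/
def restrictIso : restrict φ hφ ⋙ toModule 𝓡' ≅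
    toModule 𝓡 ⋙ ModuleCat.restrictScalars (φ : R' →+* R) := Iso.refl _

instance : PreservesFiniteLimits (restrict φ hφ) :=
  have : PreservesFiniteLimits (ModuleCat.restrictScalars.{u} (φ : R' →+* R)) :=
    have : PreservesFiniteLimits (ModuleCat.restrictScalars.{u} (φ : R' →+* R) ⋙
        forget₂ (ModuleCat.{u} R') AddCommGrpCat.{u}) :=
      inferInstanceAs (PreservesFiniteLimits (forget₂ (ModuleCat.{u} R) AddCommGrpCat.{u}))
    preservesFiniteLimits_of_reflects_of_preserves _ (forget₂ (ModuleCat.{u} R') AddCommGrpCat.{u})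
  have : PreservesFiniteLimits (restrict φ hφ ⋙ toModule 𝓡') :=
    preservesFiniteLimits_of_natIso (restrictIso φ hφ).symm
  preservesFiniteLimits_of_reflects_of_preserves _ (toModule 𝓡')

instance : PreservesFiniteColimits (restrict φ hφ) :=
  have : PreservesFiniteColimits (restrict φ hφ ⋙ toModule 𝓡') :=
    preservesFiniteColimits_of_natIso (restrictIso φ hφ).symm
  preservesFiniteColimits_of_reflects_of_preserves _ (toModule 𝓡')

end Restrict

end GradedModuleCat

section ExtLemmas

open Abelian

variable {C D E : Type*} [Category C] [Abelian C] [Category D] [Abelian D] [Category E] [Abelian E]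

theorem exists_extClass_comp [EnoughProjectives C] [HasExt.{u} C] {X Y : C} {n : ℕ}
    (e : Ext.{u} X Y (n + 1)) : ∃ (S : ShortComplex C) (hS : S.ShortExact) (h : S.X₃ = X)
      (e' : Ext.{u} S.X₁ Y n), e = h ▸ hS.extClass.comp e' (add_comm 1 n) := by
  let S : ShortComplex C := ShortComplex.mk (kernel.ι (Projective.π X)) (Projective.π X) (by simp)
  have hS : S.ShortExact :=
    { exact := ShortComplex.exact_kernel _
      mono_f := inferInstanceAs (Mono (kernel.ι (Projective.π X)))
      epi_g := inferInstanceAs (Epi (Projective.π X)) }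
  have : Projective S.X₂ := inferInstanceAs (Projective (Projective.over X))
  obtain ⟨e', he'⟩ := Ext.contravariant_sequence_exact₃ hS Y e (Ext.eq_zero_of_projective _)
    (add_comm 1 n)
  exact ⟨S, hS, rfl, e', he'.symm⟩

theorem Ext_square [HasExt.{u} C] {P P' Q Q' Y Y' : C} {n : ℕ} (α : Ext.{u} P Q 1)
    (β : Ext.{u} Q Y n) (y : Ext.{u} Y Y' 0) (α' : Ext.{u} P' Q' 1) (β' : Ext.{u} Q' Y' n)
    (q : Ext.{u} Q Q' 0) (p : Ext.{u} P P' 0)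
    (h₁ : β.comp y (add_zero n) = q.comp β' (zero_add n))
    (h₂ : α.comp q (add_zero 1) = p.comp α' (zero_add 1)) :
    (α.comp β (add_comm 1 n)).comp y (add_zero (n + 1)) =
      p.comp (α'.comp β' (add_comm 1 n)) (zero_add (n + 1)) := by
  rw [Ext.comp_assoc_of_third_deg_zero, h₁, ← Ext.comp_assoc_of_second_deg_zero, h₂,
    Ext.comp_assoc p α' β' (zero_add 1) (add_comm 1 n) (by lia)]

theorem mapExactFunctor_extClass_comp [HasExt.{u} C] [HasExt.{u} D] (F : C ⥤ D) [F.Additive]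
    [PreservesFiniteLimits F] [PreservesFiniteColimits F] {S : ShortComplex C}
    (hS : S.ShortExact) {Y : C} {n : ℕ} (e : Ext.{u} S.X₁ Y n) :
    (hS.extClass.comp e (add_comm 1 n)).mapExactFunctor F =
      Ext.comp (Y := (S.map F).X₁) (hS.map_of_exact F).extClass (e.mapExactFunctor F)
        (add_comm 1 n) := by
  rw [Ext.mapExactFunctor_comp, Ext.mapExactFunctor_extClass]; rfl

theorem mapExactFunctor_comp_natTrans [EnoughProjectives C] [HasExt.{u} C] [HasExt.{u} D]
    [HasExt.{u} E] (F : C ⥤ D) [F.Additive] [PreservesFiniteLimits F] [PreservesFiniteColimits F]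
    (G : D ⥤ E) [G.Additive] [PreservesFiniteLimits G] [PreservesFiniteColimits G]
    (H : C ⥤ E) [H.Additive] [PreservesFiniteLimits H] [PreservesFiniteColimits H]
    (τ : F ⋙ G ⟶ H) {X Y : C} {n : ℕ} (e : Ext.{u} X Y n) :
    ((e.mapExactFunctor F).mapExactFunctor G).comp (Ext.mk₀ (τ.app Y)) (add_zero n) =
      (Ext.mk₀ (τ.app X)).comp (e.mapExactFunctor H) (zero_add n) := by
  induction n generalizing X with
  | zero =>
    obtain ⟨f, rfl⟩ := (Ext.mk₀_bijective X Y).2 e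
    rw [Ext.mapExactFunctor_mk₀, Ext.mapExactFunctor_mk₀, Ext.mapExactFunctor_mk₀,
      Ext.mk₀_comp_mk₀, Ext.mk₀_comp_mk₀]
    exact congrArg Ext.mk₀ (τ.naturality f)
  | succ n ih =>
    obtain ⟨S, hS, rfl, e', rfl⟩ := exists_extClass_comp e
    have h₁ := (congrArg (Ext.mapExactFunctor G) (mapExactFunctor_extClass_comp F hS e')).trans
      (mapExactFunctor_extClass_comp G (hS.map_of_exact F) (e'.mapExactFunctor F))
    have h₂ := mapExactFunctor_extClass_comp H hS e'
    refine (congrArg (fun z => Ext.comp z (Ext.mk₀ (τ.app Y)) (add_zero (n + 1))) h₁).trans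
      (Eq.trans ?_ (congrArg (fun z => Ext.comp (Ext.mk₀ (τ.app S.X₃)) z (zero_add (n + 1)))
        h₂).symm)
    exact Ext_square _ _ _ _ _ _ _ (ih e')
      (((hS.map_of_exact F).map_of_exact G).extClass_naturality (hS.map_of_exact H)
        (S.mapNatTrans τ))

theorem comp_natTrans_of_id [EnoughProjectives C] [HasExt.{u} C]
    (H : C ⥤ C) [H.Additive] [PreservesFiniteLimits H] [PreservesFiniteColimits H]
    (τ : 𝟭 C ⟶ H) {X Y : C} {n : ℕ} (e : Ext.{u} X Y n) :
    Ext.comp e (Ext.mk₀ (τ.app Y)) (add_zero n) =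
      (Ext.mk₀ (τ.app X)).comp (e.mapExactFunctor H) (zero_add n) := by
  induction n generalizing X with
  | zero =>
    obtain ⟨f, rfl⟩ := (Ext.mk₀_bijective X Y).2 e
    rw [Ext.mapExactFunctor_mk₀]
    refine (Ext.mk₀_comp_mk₀ f (τ.app Y)).trans ?_
    exact (congrArg Ext.mk₀ (τ.naturality f)).trans
      (Ext.mk₀_comp_mk₀ (τ.app X) (H.map f)).symm
  | succ n ih =>
    obtain ⟨S, hS, rfl, e', rfl⟩ := exists_extClass_comp e
    have h₂ := mapExactFunctor_extClass_comp H hS e'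
    refine Eq.trans ?_ (congrArg (fun z => Ext.comp (Ext.mk₀ (τ.app S.X₃)) z
      (zero_add (n + 1))) h₂).symm
    exact Ext_square _ _ _ _ _ _ _ (ih e')
      (hS.extClass_naturality (hS.map_of_exact H)
        { τ₁ := τ.app _, τ₂ := τ.app _, τ₃ := τ.app _
          comm₁₂ := (τ.naturality S.f).symm, comm₂₃ := (τ.naturality S.g).symm })

end ExtLemmas

section Enveloping

variable {k : Type*} [CommRing k] {A : Type u} [Ring A] [Algebra k A] (𝒜 : ℕ → Submodule k A)

/-- The grading of the enveloping algebra `Aᵉ = A ⊗ Aᵒᵖ` of a graded algebra `A` (for commutative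
`A` this is `A ⊗ A`): the degree `n` part is `⨁ i + j = n, A_i ⊗ A_j`. -/
def envDeg (n : ℕ) : Submodule k (A ⊗[k] Aᵐᵒᵖ) :=
  Submodule.span k {x | ∃ (i j : ℕ) (a b : A), i + j = n ∧ a ∈ 𝒜 i ∧ b ∈ 𝒜 j ∧
    x = a ⊗ₜ[k] MulOpposite.op b}

theorem tmul_mem_envDeg {i j : ℕ} {a b : A} (ha : a ∈ 𝒜 i) (hb : b ∈ 𝒜 j) :
    a ⊗ₜ[k] MulOpposite.op b ∈ envDeg 𝒜 (i + j) :=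
  Submodule.subset_span ⟨i, j, a, b, rfl, ha, hb, rfl⟩

variable [GradedAlgebra 𝒜]

theorem one_mem_envDeg : (1 : A ⊗[k] Aᵐᵒᵖ) ∈ envDeg 𝒜 0 := by
  have h : (1 : A) ∈ 𝒜 0 := SetLike.one_mem_graded 𝒜
  have h' := tmul_mem_envDeg 𝒜 h h
  rw [add_zero] at h'
  rwa [Algebra.TensorProduct.one_def, ← MulOpposite.op_one]

theorem mul_mem_envDeg {m n : ℕ} {x y : A ⊗[k] Aᵐᵒᵖ} (hx : x ∈ envDeg 𝒜 m)
    (hy : y ∈ envDeg 𝒜 n) : x * y ∈ envDeg 𝒜 (m + n) := by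
  induction hx using Submodule.span_induction with
  | zero => rw [zero_mul]; exact zero_mem _
  | add a b _ _ ha hb => rw [add_mul]; exact add_mem ha hb
  | smul c a _ ha => rw [smul_mul_assoc]; exact Submodule.smul_mem _ _ ha
  | mem x hx =>
    induction hy using Submodule.span_induction with
    | zero => rw [mul_zero]; exact zero_mem _
    | add a b _ _ ha hb => rw [mul_add]; exact add_mem ha hb
    | smul c a _ ha => rw [mul_smul_comm]; exact Submodule.smul_mem _ _ ha
    | mem y hy =>
      obtain ⟨i, j, a, b, rfl, ha, hb, rfl⟩ := hx
      obtain ⟨i', j', a', b', rfl, ha', hb', rfl⟩ := hy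
      rw [Algebra.TensorProduct.tmul_mul_tmul, ← MulOpposite.op_mul,
        show i + j + (i' + j') = (i + i') + (j' + j) by lia]
      exact tmul_mem_envDeg 𝒜 (SetLike.mul_mem_graded ha ha') (SetLike.mul_mem_graded hb' hb)

instance : SetLike.GradedMonoid (envDeg 𝒜) where
  one_mem := one_mem_envDeg 𝒜
  mul_mem _ _ _ _ hx hy := mul_mem_envDeg 𝒜 hx hy

/-- The decomposition of `A ⊗ Aᵒᵖ` into its homogeneous components. -/
def envAux : A ⊗[k] Aᵐᵒᵖ →ₗ[k] DirectSum ℕ fun n => envDeg 𝒜 n :=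
  TensorProduct.lift <| LinearMap.compl₁₂
    (DirectSum.toModule k ℕ _ fun i => LinearMap.flip <| DirectSum.toModule k ℕ _ fun j =>
      LinearMap.flip <| LinearMap.mk₂ k
        (fun (a : 𝒜 i) (b : 𝒜 j) => DirectSum.lof k ℕ (fun n => envDeg 𝒜 n) (i + j)
          ⟨a.1 ⊗ₜ[k] MulOpposite.op b.1, tmul_mem_envDeg 𝒜 a.2 b.2⟩)
        (fun a a' b => by
          rw [← map_add]; congr 1; exact Subtype.ext (TensorProduct.add_tmul _ _ _))
        (fun c a b => by rw [← map_smul]; rfl)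
        (fun a b b' => by
          rw [← map_add]; congr 1; exact Subtype.ext (TensorProduct.tmul_add a.1 (MulOpposite.op b.1) (MulOpposite.op b'.1)))
        (fun c a b => by
          rw [← map_smul]; congr 1; exact Subtype.ext (TensorProduct.tmul_smul c a.1 (MulOpposite.op b.1))))
    (DirectSum.decomposeLinearEquiv 𝒜).toLinearMap
    ((DirectSum.decomposeLinearEquiv 𝒜).toLinearMap.comp
      (MulOpposite.opLinearEquiv k (M := A)).symm.toLinearMap)

theorem envAux_tmul {i j : ℕ} {a b : A} (ha : a ∈ 𝒜 i) (hb : b ∈ 𝒜 j) :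
    envAux 𝒜 (a ⊗ₜ[k] MulOpposite.op b) = DirectSum.lof k ℕ (fun n => envDeg 𝒜 n) (i + j)
      ⟨a ⊗ₜ[k] MulOpposite.op b, tmul_mem_envDeg 𝒜 ha hb⟩ := by
  have h : ∀ {i : ℕ} {a : A} (ha : a ∈ 𝒜 i), DirectSum.decomposeLinearEquiv 𝒜 a =
      DirectSum.lof k ℕ (fun i => 𝒜 i) i ⟨a, ha⟩ := fun ha => DirectSum.decompose_of_mem 𝒜 ha
  simp only [envAux, TensorProduct.lift.tmul, LinearMap.compl₁₂_apply, LinearMap.comp_apply,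
    LinearEquiv.coe_coe, MulOpposite.coe_opLinearEquiv_symm, MulOpposite.unop_op, h ha, h hb,
    DirectSum.toModule_lof, LinearMap.flip_apply, LinearMap.mk₂_apply]

instance : GradedAlgebra (envDeg 𝒜) where
  toGradedMonoid := inferInstance
  toDecomposition := DirectSum.Decomposition.ofLinearMap _ (envAux 𝒜)
    (by
      apply TensorProduct.ext'
      intro a b
      induction b using MulOpposite.rec' with | _ b => ?_
      rw [LinearMap.comp_apply, LinearMap.id_apply]
      induction a using DirectSum.Decomposition.inductionOn 𝒜 with
      | zero => simp
      | add a a' ha ha' => rw [TensorProduct.add_tmul, map_add, map_add, ha, ha']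
      | homogeneous a =>
        induction b using DirectSum.Decomposition.inductionOn 𝒜 with
        | zero => simp
        | add b b' hb hb' =>
          rw [MulOpposite.op_add, TensorProduct.tmul_add, map_add, map_add, hb, hb']
        | homogeneous b =>
          rw [envAux_tmul 𝒜 a.2 b.2, DirectSum.coeLinearMap_lof])
    (by
      apply DirectSum.linearMap_ext
      intro n
      apply LinearMap.ext
      rintro ⟨x, hx⟩
      rw [LinearMap.comp_apply, LinearMap.comp_apply, DirectSum.coeLinearMap_lof,
        LinearMap.comp_apply, LinearMap.id_apply]
      change envAux 𝒜 x = _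
      induction hx using Submodule.span_induction with
      | zero => rw [map_zero]; exact (map_zero _).symm
      | add x y hx hy h1 h2 => rw [map_add, h1, h2, ← map_add]; rfl
      | smul c x hx h => rw [map_smul, h, ← map_smul]; rfl
      | mem x hx =>
        obtain ⟨i, j, a, b, rfl, ha, hb, rfl⟩ := hx
        exact envAux_tmul 𝒜 ha hb)

/-- The graded algebra `A` as a graded `Aᵉ`-module, with `(a ⊗ b) • x = a * x * b`. -/
def selfModule : GradedModuleCat (envDeg 𝒜) where
  carrier := A
  module := Module.compHom A (AlgHom.mulLeftRight k A : A ⊗[k] Aᵐᵒᵖ →+* Module.End k A)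
  deg := GradedModuleCat.degZ 𝒜
  isInternal := isInternal_of_proj _ (GradedModuleCat.projZ 𝒜) (GradedModuleCat.projZ_same 𝒜)
    (GradedModuleCat.projZ_ne 𝒜) (GradedModuleCat.mem_iSup_degZ 𝒜)
  smul_mem n z r m hr hm := by
    change AlgHom.mulLeftRight k A r m ∈ GradedModuleCat.degZ 𝒜 _
    induction hr using Submodule.span_induction with
    | zero => rw [map_zero]; exact zero_mem _
    | add x y _ _ hx hy => rw [map_add]; exact add_mem hx hy
    | smul c x _ hx => rw [map_smul]; exact GradedModuleCat.smul_mem_degZ 𝒜 c hx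
    | mem x hx =>
      obtain ⟨i, j, a, b, rfl, ha, hb, rfl⟩ := hx
      rw [AlgHom.mulLeftRight_apply, MulOpposite.unop_op, Nat.cast_add, add_assoc, add_comm (j : ℤ), ← add_assoc]
      exact GradedModuleCat.mul_mem_degZ' 𝒜 (GradedModuleCat.mul_mem_degZ 𝒜 ha hm) hb

end Enveloping

section Hochschild

open Abelian

variable {k : Type*} [CommRing k]

section

variable {A : Type u} [Ring A] [Algebra k A] (𝒜 : ℕ → Submodule k A) [GradedAlgebra 𝒜]

/-- The graded Hochschild cohomology group `HH^{n,s}(A, M)` of a graded algebra `A` with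
coefficients in a graded `Aᵉ`-module `M`: the value at `M[s]` of the `n`-th right derived functor
of the functor `N ↦ Hom(A, N)` on the category of graded `Aᵉ`-modules. -/
def HH (M : GradedModuleCat (envDeg 𝒜)) (n : ℕ) (s : ℤ) : AddCommGrpCat.{u} :=
  AddCommGrpCat.of (Ext.{u} (selfModule 𝒜) (M.shift s) n)

end

section Functoriality

variable {A B C : Type u} [Ring A] [Algebra k A] [Ring B] [Algebra k B] [Ring C] [Algebra k C]
  {𝒜 : ℕ → Submodule k A} {ℬ : ℕ → Submodule k B} {𝒞 : ℕ → Submodule k C}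

/-- The homomorphism `Aᵉ → Bᵉ` induced by `f : A → B`. -/
def envMap (f : A →ₐ[k] B) : A ⊗[k] Aᵐᵒᵖ →ₐ[k] B ⊗[k] Bᵐᵒᵖ :=
  Algebra.TensorProduct.map f (AlgHom.op f)

theorem envMap_tmul (f : A →ₐ[k] B) (a b : A) :
    envMap f (a ⊗ₜ[k] MulOpposite.op b) = f a ⊗ₜ[k] MulOpposite.op (f b) := rfl

theorem envMap_mem (f : A →ₐ[k] B) (hf : ∀ i a, a ∈ 𝒜 i → f a ∈ ℬ i) (n : ℕ)
    (x : A ⊗[k] Aᵐᵒᵖ) (hx : x ∈ envDeg 𝒜 n) : envMap f x ∈ envDeg ℬ n := by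
  induction hx using Submodule.span_induction with
  | zero => rw [map_zero]; exact zero_mem _
  | add a b _ _ ha hb => rw [map_add]; exact add_mem ha hb
  | smul c a _ ha => rw [map_smul]; exact Submodule.smul_mem _ _ ha
  | mem x hx =>
    obtain ⟨i, j, a, b, rfl, ha, hb, rfl⟩ := hx
    rw [envMap_tmul]
    exact tmul_mem_envDeg ℬ (hf i a ha) (hf j b hb)

/-- For a homomorphism `f : A → B` of graded algebras, restriction of scalars from graded
`Bᵉ`-modules to graded `Aᵉ`-modules. -/
def restrictEnv (f : A →ₐ[k] B) (hf : ∀ i a, a ∈ 𝒜 i → f a ∈ ℬ i) :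
    GradedModuleCat (envDeg ℬ) ⥤ GradedModuleCat (envDeg 𝒜) :=
  GradedModuleCat.restrict (envMap f) (envMap_mem f hf)

instance (f : A →ₐ[k] B) (hf : ∀ i a, a ∈ 𝒜 i → f a ∈ ℬ i) : (restrictEnv f hf).Additive :=
  inferInstanceAs (GradedModuleCat.restrict (envMap f) (envMap_mem f hf)).Additive

instance (f : A →ₐ[k] B) (hf : ∀ i a, a ∈ 𝒜 i → f a ∈ ℬ i) :
    PreservesFiniteLimits (restrictEnv f hf) :=
  inferInstanceAs (PreservesFiniteLimits (GradedModuleCat.restrict (envMap f) (envMap_mem f hf)))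

instance (f : A →ₐ[k] B) (hf : ∀ i a, a ∈ 𝒜 i → f a ∈ ℬ i) :
    PreservesFiniteColimits (restrictEnv f hf) :=
  inferInstanceAs (PreservesFiniteColimits (GradedModuleCat.restrict (envMap f) (envMap_mem f hf)))

theorem map_mulLeftRight (f : A →ₐ[k] B) (r : A ⊗[k] Aᵐᵒᵖ) (a : A) :
    f (AlgHom.mulLeftRight k A r a) = AlgHom.mulLeftRight k B (envMap f r) (f a) := by
  induction r using TensorProduct.induction_on with
  | zero => simp
  | add x y hx hy => simp only [map_add, LinearMap.add_apply, hx, hy]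
  | tmul x y =>
    induction y using MulOpposite.rec' with | _ y => ?_
    rw [envMap_tmul, AlgHom.mulLeftRight_apply, AlgHom.mulLeftRight_apply]
    simp

theorem map_mem_degZ (f : A →ₐ[k] B) (hf : ∀ i a, a ∈ 𝒜 i → f a ∈ ℬ i) (z : ℤ) (a : A)
    (ha : a ∈ GradedModuleCat.degZ 𝒜 z) : f a ∈ GradedModuleCat.degZ ℬ z := by
  unfold GradedModuleCat.degZ at ha ⊢
  split_ifs at ha ⊢ with hz
  · exact hf _ _ ha
  · rw [AddSubgroup.mem_bot.1 ha, map_zero]; exact zero_mem _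

variable [GradedAlgebra 𝒜] [GradedAlgebra ℬ] [GradedAlgebra 𝒞]

/-- A homomorphism `f : A → B` of graded algebras as a homomorphism of graded `Aᵉ`-modules. -/
def selfMap (f : A →ₐ[k] B) (hf : ∀ i a, a ∈ 𝒜 i → f a ∈ ℬ i) :
    selfModule 𝒜 ⟶ (restrictEnv f hf).obj (selfModule ℬ) :=
  GradedModuleCat.ofLin
    { toFun := f
      map_add' := map_add f
      map_smul' := map_mulLeftRight f }
    (map_mem_degZ f hf)

/-- The shift of a homomorphism from a restriction of scalars. -/
def shiftMap (f : A →ₐ[k] B) (hf : ∀ i a, a ∈ 𝒜 i → f a ∈ ℬ i)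
    {M : GradedModuleCat (envDeg ℬ)} {N : GradedModuleCat (envDeg 𝒜)}
    (g : (restrictEnv f hf).obj M ⟶ N) (s : ℤ) :
    (restrictEnv f hf).obj (M.shift s) ⟶ N.shift s :=
  GradedModuleCat.shiftHom g s

/-- The functoriality of Hochschild cohomology. Given a homomorphism `f : A → B` of graded
algebras, a graded `Bᵉ`-module `M`, a graded `Aᵉ`-module `N`, and a homomorphism `g : M ⟶ N` of
graded `Aᵉ`-modules, this is the composite
`Ext_{Bᵉ}(B, M[s]) → Ext_{Aᵉ}(B, M[s]) → Ext_{Aᵉ}(A, N[s])` of restriction of scalars and the map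
induced by `f` and `g`. -/
def HHMap (f : A →ₐ[k] B) (hf : ∀ i a, a ∈ 𝒜 i → f a ∈ ℬ i)
    {M : GradedModuleCat (envDeg ℬ)} {N : GradedModuleCat (envDeg 𝒜)}
    (g : (restrictEnv f hf).obj M ⟶ N) (n : ℕ) (s : ℤ) : HH ℬ M n s ⟶ HH 𝒜 N n s :=
  AddCommGrpCat.ofHom <| AddMonoidHom.mk'
    (fun e : Ext.{u} (selfModule ℬ) (M.shift s) n =>
      (Ext.mk₀ (selfMap f hf)).comp
        ((e.mapExactFunctor (restrictEnv f hf)).comp (Ext.mk₀ (shiftMap f hf g s)) (add_zero n))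
        (zero_add n))
    (fun e e' => by
      rw [Ext.mapExactFunctor_add, Ext.add_comp, Ext.comp_add])

/-- Transitivity of restriction of scalars, given by identity maps. -/
def restrictEnvComp (f : A →ₐ[k] B) (hf : ∀ i a, a ∈ 𝒜 i → f a ∈ ℬ i)
    (f' : B →ₐ[k] C) (hf' : ∀ i a, a ∈ ℬ i → f' a ∈ 𝒞 i)
    (h : A →ₐ[k] C) (hh : ∀ i a, a ∈ 𝒜 i → h a ∈ 𝒞 i) (e : ∀ a, h a = f' (f a)) :
    restrictEnv f' hf' ⋙ restrictEnv f hf ⟶ restrictEnv h hh where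
  app M := GradedModuleCat.ofLin (M := (restrictEnv f hf).obj ((restrictEnv f' hf').obj M))
    (N := (restrictEnv h hh).obj M)
    { toFun := fun m => m
      map_add' := fun _ _ => rfl
      map_smul' := fun r m => by
        have hr : envMap f' (envMap f r) = envMap h r := by
          induction r using TensorProduct.induction_on with
          | zero => simp
          | add x y hx hy => simp only [map_add, hx, hy]
          | tmul x y =>
            induction y using MulOpposite.rec' with | _ y => ?_
            rw [envMap_tmul, envMap_tmul, envMap_tmul, e, e]
        exact congrArg (fun t : C ⊗[k] Cᵐᵒᵖ => t • (show M.carrier from m)) hr }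
    fun _ _ hm => hm
  naturality _ _ _ := rfl

theorem HHMap_comp (f : A →ₐ[k] B) (hf : ∀ i a, a ∈ 𝒜 i → f a ∈ ℬ i)
    (f' : B →ₐ[k] C) (hf' : ∀ i a, a ∈ ℬ i → f' a ∈ 𝒞 i)
    (h : A →ₐ[k] C) (hh : ∀ i a, a ∈ 𝒜 i → h a ∈ 𝒞 i) (e : ∀ a, h a = f' (f a))
    {M : GradedModuleCat (envDeg 𝒞)} {N : GradedModuleCat (envDeg ℬ)}
    {P : GradedModuleCat (envDeg 𝒜)} (g' : (restrictEnv f' hf').obj M ⟶ N)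
    (g : (restrictEnv f hf).obj N ⟶ P) (g'' : (restrictEnv h hh).obj M ⟶ P)
    (hg : (restrictEnv f hf).map g' ≫ g = (restrictEnvComp f hf f' hf' h hh e).app M ≫ g'')
    (n : ℕ) (s : ℤ) :
    HHMap f' hf' g' n s ≫ HHMap f hf g n s = HHMap h hh g'' n s := by
  ext (x : Ext.{u} (selfModule 𝒞) (M.shift s) n)
  let τ := restrictEnvComp f hf f' hf' h hh e
  have h1 : (restrictEnv f hf).map (shiftMap f' hf' g' s) ≫ shiftMap f hf g s =
      τ.app (M.shift s) ≫ shiftMap h hh g'' s := by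
    exact congrArg (fun z => GradedModuleCat.shiftHom z s) hg
  have h2 : selfMap h hh = selfMap f hf ≫ (restrictEnv f hf).map (selfMap f' hf') ≫
      τ.app (selfModule 𝒞) := by
    apply GradedModuleCat.hom_ext
    apply LinearMap.ext
    intro a
    exact e a
  have h3 := mapExactFunctor_comp_natTrans (restrictEnv f' hf') (restrictEnv f hf) (restrictEnv h hh) τ x
  change (Ext.mk₀ (selfMap f hf)).comp ((Ext.mapExactFunctor (restrictEnv f hf)
    ((Ext.mk₀ (selfMap f' hf')).comp ((x.mapExactFunctor (restrictEnv f' hf')).comp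
      (Ext.mk₀ (shiftMap f' hf' g' s)) (add_zero n)) (zero_add n))).comp
      (Ext.mk₀ (shiftMap f hf g s)) (add_zero n)) (zero_add n) =
    (Ext.mk₀ (selfMap h hh)).comp ((x.mapExactFunctor (restrictEnv h hh)).comp
      (Ext.mk₀ (shiftMap h hh g'' s)) (add_zero n)) (zero_add n)
  rw [Ext.mapExactFunctor_comp, Ext.mapExactFunctor_comp, Ext.mapExactFunctor_mk₀,
    Ext.mapExactFunctor_mk₀, h2]
  simp only [Ext.comp_assoc_of_third_deg_zero, Ext.mk₀_comp_mk₀, Ext.mk₀_comp_mk₀_assoc, h1]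
  rw [← Ext.mk₀_comp_mk₀_assoc, ← Ext.mk₀_comp_mk₀_assoc, ← Ext.mk₀_comp_mk₀,
    ← Ext.comp_assoc_of_third_deg_zero _ (Ext.mk₀ (τ.app _)), h3,
    Ext.comp_assoc_of_third_deg_zero]
  exact congrArg (fun z => Ext.comp (Ext.mk₀ (selfMap f hf)) z (zero_add n))
    (Ext.mk₀_comp_mk₀_assoc _ _ _)

/-- Restriction of scalars along the identity, given by identity maps. -/
def restrictEnvId (f : A →ₐ[k] A) (hf : ∀ i a, a ∈ 𝒜 i → f a ∈ 𝒜 i) (e : ∀ a, f a = a) :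
    𝟭 (GradedModuleCat (envDeg 𝒜)) ⟶ restrictEnv f hf where
  app M := GradedModuleCat.ofLin (M := M) (N := (restrictEnv f hf).obj M)
    { toFun := fun m => m
      map_add' := fun _ _ => rfl
      map_smul' := fun r m => by
        have hr : r = envMap f r := by
          induction r using TensorProduct.induction_on with
          | zero => simp
          | add x y hx hy => rw [map_add, ← hx, ← hy]
          | tmul x y =>
            induction y using MulOpposite.rec' with | _ y => ?_
            rw [envMap_tmul, e, e]
        exact congrArg (fun t : A ⊗[k] Aᵐᵒᵖ => t • (show M.carrier from m)) hr }
    fun _ _ hm => hm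
  naturality _ _ _ := rfl

theorem HHMap_id (f : A →ₐ[k] A) (hf : ∀ i a, a ∈ 𝒜 i → f a ∈ 𝒜 i) (e : ∀ a, f a = a)
    {M : GradedModuleCat (envDeg 𝒜)} (g : (restrictEnv f hf).obj M ⟶ M)
    (hg : ∀ m : M.carrier, g.1 m = m) (n : ℕ) (s : ℤ) :
    HHMap f hf g n s = 𝟙 _ := by
  ext (x : Ext.{u} (selfModule 𝒜) (M.shift s) n)
  let τ := restrictEnvId f hf e
  have h1 : τ.app (M.shift s) ≫ shiftMap f hf g s = 𝟙 _ := by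
    apply GradedModuleCat.hom_ext
    apply LinearMap.ext
    intro m
    exact hg m
  have h2 : selfMap f hf = τ.app (selfModule 𝒜) := by
    apply GradedModuleCat.hom_ext
    apply LinearMap.ext
    intro a
    exact e a
  have h3 := comp_natTrans_of_id (restrictEnv f hf) τ x
  change (Ext.mk₀ (selfMap f hf)).comp ((x.mapExactFunctor (restrictEnv f hf)).comp
      (Ext.mk₀ (shiftMap f hf g s)) (add_zero n)) (zero_add n) = x
  rw [← Ext.comp_assoc_of_third_deg_zero, h2]
  refine (congrArg (fun z => Ext.comp z (Ext.mk₀ (shiftMap f hf g s)) (add_zero n)) h3).symm.trans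
    ?_
  refine (Ext.comp_assoc_of_third_deg_zero x (Ext.mk₀ (τ.app (M.shift s))) _ _).trans ?_
  refine (congrArg (fun z => Ext.comp x z (add_zero n))
    ((Ext.mk₀_comp_mk₀ _ _).trans (congrArg Ext.mk₀ h1))).trans ?_
  exact Ext.comp_mk₀_id x

end Functoriality

section Subalgebra

variable {A : Type u} [Ring A] [Algebra k A] (𝒜 : ℕ → Submodule k A) [GradedAlgebra 𝒜]

/-- A graded subalgebra of `A`: a subalgebra that contains the homogeneous components of each of
its elements. -/
structure GradedSubalgebra where
  toSubalgebra : Subalgebra k A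
  homogeneous : ∀ (n : ℕ) (a : A), a ∈ toSubalgebra →
    (DirectSum.decompose 𝒜 a n : A) ∈ toSubalgebra

namespace GradedSubalgebra

variable {𝒜}

/-- The grading of a graded subalgebra: `S_n = S ∩ A_n`. -/
def deg (S : GradedSubalgebra 𝒜) (n : ℕ) : Submodule k S.toSubalgebra :=
  (𝒜 n).comap S.toSubalgebra.val.toLinearMap

theorem isInternal_deg (S : GradedSubalgebra 𝒜) : DirectSum.IsInternal S.deg := by
  classical
  refine isInternal_of_proj_of_surjective _
    (fun n => ((GradedRing.proj 𝒜 n).comp S.toSubalgebra.val.toAddMonoidHom).codRestrict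
      S.toSubalgebra fun a => S.homogeneous n a.1 a.2) ?_ ?_ ?_
  · exact fun n x hx => Subtype.ext (DirectSum.decompose_of_mem_same 𝒜 hx)
  · exact fun m n x hmn hx => Subtype.ext (DirectSum.decompose_of_mem_ne 𝒜 hx hmn.symm)
  · intro x
    refine ⟨∑ n ∈ (DirectSum.decompose 𝒜 x.1).support, DirectSum.of (fun i => S.deg i) n
      ⟨⟨_, S.homogeneous n x.1 x.2⟩, SetLike.coe_mem (DirectSum.decompose 𝒜 x.1 n)⟩, ?_⟩
    rw [map_sum]
    apply Subtype.ext
    rw [AddSubmonoidClass.coe_finsetSum]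
    simp only [DirectSum.coeAddMonoidHom_of]
    exact DirectSum.sum_support_decompose 𝒜 x.1

instance (S : GradedSubalgebra 𝒜) : GradedAlgebra S.deg where
  one_mem := SetLike.GradedOne.one_mem (A := 𝒜)
  mul_mem _ _ _ _ hx hy := SetLike.GradedMul.mul_mem (A := 𝒜) hx hy
  toDecomposition := S.isInternal_deg.chooseDecomposition

/-- A graded `Aᵉ`-module regarded as a graded `Sᵉ`-module. -/
def res (S : GradedSubalgebra 𝒜) (M : GradedModuleCat (envDeg 𝒜)) :
    GradedModuleCat (envDeg S.deg) :=
  (restrictEnv S.toSubalgebra.val fun _ _ h => h).obj M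

/-- For graded subalgebras `S ≤ T` of `A`, the restriction map
`HH^{n,s}(T, M) → HH^{n,s}(S, M)`. -/
def trans {S T : GradedSubalgebra 𝒜} (h : S.toSubalgebra ≤ T.toSubalgebra)
    (M : GradedModuleCat (envDeg 𝒜)) (n : ℕ) (s : ℤ) :
    HH T.deg (T.res M) n s ⟶ HH S.deg (S.res M) n s :=
  HHMap (Subalgebra.inclusion h) (fun _ _ ha => ha)
    ((restrictEnvComp (Subalgebra.inclusion h) (fun _ _ ha => ha) T.toSubalgebra.val
      (fun _ _ ha => ha) S.toSubalgebra.val (fun _ _ ha => ha) (fun _ => rfl)).app M) n s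

theorem trans_self (S : GradedSubalgebra 𝒜) (h : S.toSubalgebra ≤ S.toSubalgebra)
    (M : GradedModuleCat (envDeg 𝒜)) (n : ℕ) (s : ℤ) : trans h M n s = 𝟙 _ :=
  HHMap_id _ _ (fun _ => rfl) _ (fun _ => rfl) n s

theorem trans_comp {S T U : GradedSubalgebra 𝒜} (h : S.toSubalgebra ≤ T.toSubalgebra)
    (h' : T.toSubalgebra ≤ U.toSubalgebra) (M : GradedModuleCat (envDeg 𝒜)) (n : ℕ) (s : ℤ) :
    trans h' M n s ≫ trans h M n s = trans (h.trans h') M n s := by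
  refine HHMap_comp (Subalgebra.inclusion h) (fun _ _ ha => ha) (Subalgebra.inclusion h')
    (fun _ _ ha => ha) (Subalgebra.inclusion (h.trans h')) (fun _ _ ha => ha) (fun _ => rfl)
    _ _ _ ?_ n s
  apply GradedModuleCat.hom_ext
  apply LinearMap.ext
  intro m
  rfl

/-- For a directed system `S` of graded subalgebras of `A`, the inverse system
`α ↦ HH^{n,s}(S α, M)`. -/
def hhSystem {I : Type u} [Preorder I] (S : I → GradedSubalgebra 𝒜)
    (hS : ∀ α β, α ≤ β → (S α).toSubalgebra ≤ (S β).toSubalgebra)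
    (M : GradedModuleCat (envDeg 𝒜)) (n : ℕ) (s : ℤ) : Iᵒᵖ ⥤ AddCommGrpCat.{u} where
  obj α := HH (S α.unop).deg ((S α.unop).res M) n s
  map {β α} h := trans (hS α.unop β.unop (leOfHom h.unop)) M n s
  map_id _ := trans_self _ _ M n s
  map_comp _ _ := (trans_comp _ _ M n s).symm

end GradedSubalgebra

end Subalgebra

end Hochschild

section Limits

instance (I : Type u) [Preorder I] : (lim : (Iᵒᵖ ⥤ AddCommGrpCat.{u}) ⥤ _).Additive where
  map_add {X Y f g} := by
    apply limit.hom_ext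
    intro j
    simp

instance (I : Type u) [Preorder I] : AB5OfSize.{u, u} (Iᵒᵖ ⥤ AddCommGrpCat.{u}) where
  ofShape _ _ _ := inferInstance

instance (I : Type u) [Preorder I] : IsGrothendieckAbelian.{u} (Iᵒᵖ ⥤ AddCommGrpCat.{u}) where

/-- The `p`-th right derived functor of the inverse limit functor, applied to an inverse system
of abelian groups indexed by `I`. -/
def derivedLim {I : Type u} [Preorder I] (p : ℕ) (F : Iᵒᵖ ⥤ AddCommGrpCat.{u}) :
    AddCommGrpCat.{u} :=
  ((lim : (Iᵒᵖ ⥤ AddCommGrpCat.{u}) ⥤ AddCommGrpCat.{u}).rightDerived p).obj F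

/-- Convergence `E_2^{p,q} ⇒ H^{p+q}` of a first quadrant spectral sequence: every `H^n` has a
decreasing filtration `H^n = F^0 ⊇ F^1 ⊇ ⋯ ⊇ F^{n+1} = 0` such that
`F^p H^{p+q} / F^{p+1} H^{p+q} ≅ E_∞^{p,q}`. Here `E_∞^{p,q} = E_r^{p,q}` for all `r > max p (q + 1)`,
as then no nonzero differential enters or leaves the position `(p, q)` on the page `r`. -/
def ConvergesTo (E : E₂CohomologicalSpectralSequenceNat AddCommGrpCat.{u})
    (H : ℕ → AddCommGrpCat.{u}) : Prop :=
  ∀ n : ℕ, ∃ F : ℕ → AddSubgroup (H n), F 0 = ⊤ ∧ F (n + 1) = ⊥ ∧ Antitone F ∧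
    ∀ p q : ℕ, p + q = n → ∀ (r : ℤ) (hr : 2 ≤ r), (p : ℤ) < r → (q : ℤ) + 1 < r →
      Nonempty ((F p ⧸ (F (p + 1)).addSubgroupOf (F p)) ≃+ ((E.page r hr).X (p, q) : Type u))

end Limits

end

/-! The spectral sequence is the hypercohomology spectral sequence of the inverse limit functor, for
a complex of inverse systems built from one free resolution that is adapted to all the subalgebras
at once.

Call a system (`EnvSystem`) a graded `Aᵉ`-module that is the union of compatible graded modules over
the enveloping algebras of the `S β`. The subalgebras themselves form a system with union `A`. A
free system has basis elements `x`, each with a degree `d x` and a level `a x` at which it appears;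
its level `β` is free on the `x` with `a x ≤ β`. Over a field the maps between enveloping algebras
are injective, so these free levels do embed in their union. Every system is covered by a free one,
surjectively at each level, and the kernel is again a system. Iterating gives simultaneously a free
resolution of each `S β` over its enveloping algebra and a free resolution of `A` over `Aᵉ`.

Homomorphisms into `M[s]` turn the free covers into a complex `C` of inverse systems with three
properties. Its cohomology is levelwise the Hochschild cohomology of `S β`, compatibly with
restriction (`toHHSystem`, `exact_kernelHom_toHHSystem`). Its inverse limit is the complex of
homomorphisms over `Aᵉ`, because a homomorphism out of a union is a compatible family
(`topRestrict_bijective`); the cohomology of that limit is the Hochschild cohomology of `A`. Its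
terms have the form `β ↦ ∏_{a x ≤ β} W x`, and such systems have no higher derived limits
(`belowProduct.extAcyclic`).

Since the limit is `Hom(ℤ, -)` for the constant system `ℤ`, its derived functors are `Ext(ℤ, -)`
(`nonempty_derivedLim_iso_ext`). The canonical truncations of `C` in the derived category give a
spectral sequence from `Ext^p(ℤ, H^q C)` to the morphisms from `ℤ` to the shifts of `C`
(`exists_hyperext_spectralSequence`). By acyclicity of the terms, the latter are the cohomology of
`Hom(ℤ, C) = lim C` (`nonempty_homAddEquiv_cohomologyClass`). -/

noncomputable section

/-! ### Convergence of the spectral sequence of a first quadrant spectral object. -/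

section Convergence

open Abelian ComposableArrows

/-- Both groups are quotients of `L`: by `h₁` the image of `β` is the group of cycles, and by `h₂`
an element dies in the homology exactly when it dies in the quotient by `K`. In the application `L`
is the cohomology of a truncation and `ι` its map to the abutment. -/
theorem nonempty_quotient_addEquiv_homology (S : ShortComplex AddCommGrpCat.{u}) {L T : Type u}
    [AddCommGroup L] [AddCommGroup T] (β : L →+ S.X₂) (ι : L →+ T) (K : AddSubgroup T)
    (h₁ : ∀ x : S.X₂, S.g x = 0 ↔ ∃ l, β l = x)
    (h₂ : ∀ l : L, (∃ y, S.f y = β l) ↔ ι l ∈ K) :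
    Nonempty ((ι.range ⧸ K.addSubgroupOf ι.range) ≃+ (S.homology : Type u)) := by
  let e₁ : (S.homology : Type u) ≃+ (AddMonoidHom.ker S.g.hom ⧸ S.abToCycles.range) :=
    (ShortComplex.abHomologyIso S).addCommGroupIsoToAddEquiv
  let φ : L →+ (AddMonoidHom.ker S.g.hom ⧸ S.abToCycles.range) :=
    (QuotientAddGroup.mk' _).comp (β.codRestrict (AddMonoidHom.ker S.g.hom) fun l =>
      (h₁ _).2 ⟨l, rfl⟩)
  let ψ : L →+ (ι.range ⧸ K.addSubgroupOf ι.range) :=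
    (QuotientAddGroup.mk' _).comp ι.rangeRestrict
  have hφ : Function.Surjective φ := by
    intro y
    obtain ⟨⟨x, hx⟩, rfl⟩ := QuotientAddGroup.mk'_surjective _ y
    obtain ⟨l, rfl⟩ := (h₁ x).1 hx
    exact ⟨l, rfl⟩
  have hψ : Function.Surjective ψ :=
    (QuotientAddGroup.mk'_surjective _).comp ι.rangeRestrict_surjective
  have hker : ψ.ker = φ.ker := by
    ext l
    have h3 : l ∈ ψ.ker ↔ ι l ∈ K := by
      refine (QuotientAddGroup.eq_zero_iff (N := K.addSubgroupOf ι.range) _).trans ?_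
      rfl
    have h4 : l ∈ φ.ker ↔ ∃ y, S.f y = β l := by
      refine (QuotientAddGroup.eq_zero_iff (N := S.abToCycles.range) _).trans ?_
      constructor
      · rintro ⟨y, hy⟩
        exact ⟨y, congrArg Subtype.val hy⟩
      · rintro ⟨y, hy⟩
        exact ⟨y, Subtype.ext hy⟩
    rw [h3, h4, h₂]
  exact ⟨((QuotientAddGroup.quotientKerEquivOfSurjective ψ hψ).symm.trans
    (QuotientAddGroup.quotientAddEquivOfEq hker)).trans
    ((QuotientAddGroup.quotientKerEquivOfSurjective φ hφ).trans e₁.symm)⟩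

namespace CategoryTheory.Abelian.SpectralObject

variable (Y : SpectralObject AddCommGrpCat.{u} EInt)

theorem exact_apply₂ {a b c : EInt} (hab : a ≤ b) (hbc : b ≤ c) (n : ℤ)
    (x : (Y.H n).obj (mk₁ (homOfLE (hab.trans hbc))))
    (hx : (Y.H n).map (twoδ₁Toδ₀' a b c hab hbc) x = 0) :
    ∃ y, (Y.H n).map (twoδ₂Toδ₁' a b c hab hbc) y = x :=
  (ShortComplex.ab_exact_iff _).1 (Y.exact₂ (homOfLE hab) (homOfLE hbc) _ rfl n) x hx

theorem exact_apply₃ {a b c : EInt} (hab : a ≤ b) (hbc : b ≤ c) (n n' : ℤ) (h : n + 1 = n')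
    (x : (Y.H n).obj (mk₁ (homOfLE hbc)))
    (hx : Y.δ (homOfLE hab) (homOfLE hbc) n n' h x = 0) :
    ∃ y, (Y.H n).map (twoδ₁Toδ₀' a b c hab hbc) y = x :=
  (ShortComplex.ab_exact_iff _).1 (Y.exact₃ (homOfLE hab) (homOfLE hbc) _ rfl n n' h) x hx

theorem exact_apply₁ {a b c : EInt} (hab : a ≤ b) (hbc : b ≤ c) (n n' : ℤ) (h : n + 1 = n')
    (x : (Y.H n').obj (mk₁ (homOfLE hab)))
    (hx : (Y.H n').map (twoδ₂Toδ₁' a b c hab hbc) x = 0) :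
    ∃ y, Y.δ (homOfLE hab) (homOfLE hbc) n n' h y = x :=
  (ShortComplex.ab_exact_iff _).1 (Y.exact₁ (homOfLE hab) (homOfLE hbc) _ rfl n n' h) x hx

theorem δ_naturality_apply {a b c a' b' c' : EInt} (hab : a ≤ b) (hbc : b ≤ c) (hab' : a' ≤ b')
    (hbc' : b' ≤ c') (ha : a ≤ a') (hb : b ≤ b') (hc : c ≤ c')
    (n n' : ℤ) (h : n + 1 = n') (x : (Y.H n).obj (mk₁ (homOfLE hbc))) :
    Y.δ (homOfLE hab') (homOfLE hbc') n n' h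
      ((Y.H n).map (homMk₁ (homOfLE hb) (homOfLE hc) rfl) x) =
    (Y.H n').map (homMk₁ (homOfLE ha) (homOfLE hb) rfl) (Y.δ (homOfLE hab) (homOfLE hbc) n n' h x) :=
  ConcreteCategory.congr_hom (Y.δ_naturality (homOfLE hab) (homOfLE hbc) (homOfLE hab')
    (homOfLE hbc') (homMk₁ (homOfLE ha) (homOfLE hb) rfl)
    (homMk₁ (homOfLE hb) (homOfLE hc) rfl) n n' rfl h) x

theorem map_map_apply {a b a' b' a'' b'' : EInt} {h : a ≤ b} {h' : a' ≤ b'} {h'' : a'' ≤ b''}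
    (n : ℤ) (f : mk₁ (homOfLE h) ⟶ mk₁ (homOfLE h')) (g : mk₁ (homOfLE h') ⟶ mk₁ (homOfLE h''))
    (k : mk₁ (homOfLE h) ⟶ mk₁ (homOfLE h'')) (x : (Y.H n).obj (mk₁ (homOfLE h))) :
    (Y.H n).map g ((Y.H n).map f x) = (Y.H n).map k x := by
  have : f ≫ g = k := by
    apply ComposableArrows.hom_ext₁ <;> exact Subsingleton.elim _ _
  rw [← this, Functor.map_comp]
  rfl

theorem eq_zero_of_isZero {G : AddCommGrpCat.{u}} (h : IsZero G) (x : G) : x = 0 :=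
  (AddCommGrpCat.subsingleton_of_isZero h).elim _ _

/-- Write `H^n(i, j)` for the groups of `Y`; they vanish for `j ≤ 0` and for `n < i`. The term
`E_r^{p,q}` is the homology of `H^{n-1}(q+1, q+r-1) → H^n(q, q+1) → H^{n+1}(q-r+2, q)`. For large
`r` the outer bounds may be replaced by `⊤` and `⊥`, so the cycles are the image of `H^n(⊥, q+1)`,
and modulo boundaries one obtains a graded piece of the filtration of `H^n(⊥, ⊤)` by the images of
the `H^n(⊥, i)`. -/
theorem convergesTo_of_isFirstQuadrant [Y.IsFirstQuadrant] (H : ℕ → AddCommGrpCat.{u})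
    (e : ∀ n : ℕ, (H n : Type u) ≃+
      (Y.H n).obj (mk₁ (homOfLE (bot_le : (⊥ : EInt) ≤ ⊤)))) :
    ConvergesTo Y.E₂SpectralSequenceNat H := by
  intro n
  let ι (i : EInt) : (Y.H n).obj (mk₁ (homOfLE (bot_le : ⊥ ≤ i))) →+ (H n : Type u) :=
    (e n).symm.toAddMonoidHom.comp ((Y.H n).map (twoδ₂Toδ₁' ⊥ i ⊤ bot_le le_top)).hom
  have ι_comp {i j : EInt} (hij : i ≤ j) (x : (Y.H n).obj (mk₁ (homOfLE (bot_le : ⊥ ≤ i)))) :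
      ι j ((Y.H n).map (twoδ₂Toδ₁' ⊥ i j bot_le hij) x) = ι i x :=
    congrArg (e n).symm (Y.map_map_apply _ _ _ _ x)
  have ι_zero {i : EInt} (x) (hx : ι i x = 0) :
      (Y.H n).map (twoδ₂Toδ₁' ⊥ i ⊤ bot_le le_top) x = 0 :=
    (e n).symm.map_eq_zero_iff.1 hx
  -- The index `n - p + 1` is `q + 1` for `p + q = n`. For `p = 0` the image is everything since
  -- `H^n(n + 1, ⊤) = 0`; for `p = n + 1` it is zero since `H^n(⊥, 0) = 0`.
  refine ⟨fun p => (ι ((n - p + 1 : ℤ) : EInt)).range, ?_, ?_, ?_, ?_⟩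
  · rw [eq_top_iff]
    intro x _
    obtain ⟨y, hy⟩ := Y.exact_apply₂ bot_le (le_top : (((n - (0 : ℕ) + 1 : ℤ) : EInt)) ≤ ⊤) n (e n x)
      (eq_zero_of_isZero (Y.isZero₂_of_isFirstQuadrant _ _ _ _ (by simp)) _)
    exact ⟨y, ((e n).symm_apply_eq).2 hy⟩
  · rw [eq_bot_iff]
    rintro _ ⟨x, rfl⟩
    rw [eq_zero_of_isZero (Y.isZero₁_of_isFirstQuadrant _ _ _ (by simp) _) x, map_zero]
    exact zero_mem _
  · intro p p' hp
    rintro _ ⟨x, rfl⟩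
    exact ⟨_, ι_comp (by simp; lia) x⟩
  · intro p q hpq r hr hpr hqr
    have hq : (n - p + 1 : ℤ) = q + 1 := by lia
    have hq' : (n - (p + 1 : ℕ) + 1 : ℤ) = q := by lia
    suffices Nonempty (((ι ((q + 1 : ℤ) : EInt)).range ⧸
        (ι ((q : ℤ) : EInt)).range.addSubgroupOf (ι ((q + 1 : ℤ) : EInt)).range) ≃+
        ((Y.E₂SpectralSequenceNat.page r hr).X (p, q) : Type u)) by
      rw [← hq, ← hq'] at this
      exact this
    have h01 : ((q - r + 2 : ℤ) : EInt) ≤ ((q : ℤ) : EInt) := by simp; lia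
    have h12 : ((q : ℤ) : EInt) ≤ ((q + 1 : ℤ) : EInt) := by simp
    have h23 : ((q + 1 : ℤ) : EInt) ≤ ((q + r - 1 : ℤ) : EInt) := by simp; lia
    let e₁ := Y.spectralSequencePageXIso coreE₂CohomologicalNat r hr (p, q)
      ((q - r + 2 : ℤ) : EInt) ((q : ℤ) : EInt) ((q + 1 : ℤ) : EInt) ((q + r - 1 : ℤ) : EInt)
      rfl rfl rfl rfl (n - 1) n (n + 1) (by simp; lia)
    refine (nonempty_quotient_addEquiv_homology
      (Y.shortComplex (homOfLE h01) (homOfLE h12) (homOfLE h23) (n - 1) n (n + 1))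
      ((Y.H n).map (twoδ₁Toδ₀' ⊥ ((q : ℤ) : EInt) ((q + 1 : ℤ) : EInt) bot_le h12)).hom
      (ι ((q + 1 : ℤ) : EInt)) (ι ((q : ℤ) : EInt)).range ?_ ?_).map
        fun e₂ => e₂.trans e₁.symm.addCommGroupIsoToAddEquiv
    · intro x
      constructor
      · intro hx
        obtain ⟨z, hz⟩ := Y.exact_apply₃ h01 h12 n (n + 1) rfl x hx
        -- The inequality `q + 1 < r` gives `q - r + 2 ≤ 0`, so the obstruction to lifting `z` to a
        -- class over `⊥` lies in a zero group.
        have hz0 : Y.δ (homOfLE (bot_le : ⊥ ≤ ((q - r + 2 : ℤ) : EInt))) (homOfLE (h01.trans h12))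
          n (n + 1) rfl z = 0 :=
          eq_zero_of_isZero (Y.isZero₁_of_isFirstQuadrant _ _ _ (by simp; lia) _) _
        obtain ⟨l, hl⟩ := Y.exact_apply₃ _ _ n (n + 1) rfl z hz0
        refine ⟨l, ?_⟩
        rw [← hz, ← hl]
        exact (Y.map_map_apply _ _ _ _ l).symm
      · rintro ⟨l, rfl⟩
        -- Naturality makes the differential of the image of `l` factor through `H^{n+1}(⊥, ⊥) = 0`.
        have := Y.δ_naturality_apply (bot_le : ⊥ ≤ ⊥) (bot_le : ⊥ ≤ ((q + 1 : ℤ) : EInt)) h01 h12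
          bot_le bot_le le_rfl n (n + 1) rfl l
        refine this.trans ?_
        rw [eq_zero_of_isZero (Y.isZero₁_of_isFirstQuadrant _ _ _ bot_le _)
          (Y.δ (homOfLE (bot_le : ⊥ ≤ ⊥)) _ n (n + 1) rfl l)]
        exact map_zero _
    · intro l
      constructor
      · rintro ⟨(y : (Y.H ((n : ℤ) - 1)).obj (mk₁ (homOfLE h23))), hy⟩
        -- The boundary of `y` already lives in `H^n(⊥, q+1)`. It agrees with `l` in `H^n(q, q+1)`,
        -- so `l - y'` comes from `H^n(⊥, q)`; and it dies in `H^n(⊥, ⊤)`, so subtracting it does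
        -- not change `ι l`.
        let y' : (Y.H n).obj (mk₁ (homOfLE (bot_le : ⊥ ≤ ((q + 1 : ℤ) : EInt)))) :=
          Y.δ (homOfLE bot_le) (homOfLE h23) (n - 1) n (by lia) y
        have h1 : (Y.H n).map (twoδ₁Toδ₀' ⊥ ((q : ℤ) : EInt) ((q + 1 : ℤ) : EInt) bot_le h12) y' =
            (Y.H n).map (twoδ₁Toδ₀' ⊥ ((q : ℤ) : EInt) ((q + 1 : ℤ) : EInt) bot_le h12) l := by
          refine Eq.trans ?_ hy
          have := Y.δ_naturality_apply (bot_le : ⊥ ≤ ((q + 1 : ℤ) : EInt)) h23 h12 h23 bot_le le_rfl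
            le_rfl (n - 1) n (by lia) y
          refine this.symm.trans ?_
          refine congrArg (Y.δ (homOfLE h12) (homOfLE h23) (n - 1) n (by lia)) ?_
          refine Eq.trans ?_ (ConcreteCategory.congr_hom ((Y.H (n - 1)).map_id (mk₁ (homOfLE h23))) y)
          refine congrArg (fun t => (Y.H (n - 1)).map t y) ?_
          apply ComposableArrows.hom_ext₁ <;> exact Subsingleton.elim _ _
        obtain ⟨z, hz⟩ := Y.exact_apply₂ bot_le h12 n (l - y') (by rw [map_sub, h1, sub_self])
        refine ⟨z, ?_⟩
        rw [← ι_comp h12, hz, map_sub]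
        have h2 : ι ((q + 1 : ℤ) : EInt) y' = 0 := by
          have := Y.δ_naturality_apply (bot_le : ⊥ ≤ ((q + 1 : ℤ) : EInt)) h23 bot_le le_top
            bot_le le_rfl le_top (n - 1) n (by lia) y
          have h3 : y' = Y.δ (homOfLE bot_le) (homOfLE le_top) (n - 1) n (by lia)
              ((Y.H (n - 1)).map (homMk₁ (homOfLE le_rfl) (homOfLE le_top) rfl :
                mk₁ (homOfLE h23) ⟶ mk₁ (homOfLE le_top)) y) := by
            refine Eq.trans ?_ this.symm
            refine Eq.trans ((ConcreteCategory.congr_hom ((Y.H n).map_id (mk₁ (homOfLE bot_le))) y').symm) ?_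
            refine congrArg (fun t => (Y.H n).map t y') ?_
            apply ComposableArrows.hom_ext₁ <;> exact Subsingleton.elim _ _
          rw [h3]
          refine (congrArg (e n).symm ?_).trans (map_zero (e n).symm)
          exact ConcreteCategory.congr_hom (Y.zero₁ (homOfLE bot_le) (homOfLE le_top) _ rfl (n - 1) n
            (by lia)) _
        rw [h2, sub_zero]
      · rintro ⟨k, hk⟩
        have h1 : ι ((q + 1 : ℤ) : EInt)
            (l - (Y.H n).map (twoδ₂Toδ₁' ⊥ _ _ bot_le h12) k) = 0 := by
          rw [map_sub, ι_comp, hk, sub_self]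
        obtain ⟨y, hy⟩ := Y.exact_apply₁ bot_le le_top (n - 1) n (by lia) _ (ι_zero _ h1)
        -- From `p < r` one gets `n - 1 < q + r - 1`, so `H^{n-1}(q+r-1, ⊤)` vanishes and `y` comes
        -- from the finite interval that occurs on page `r`.
        obtain ⟨y', hy'⟩ := Y.exact_apply₂ h23 le_top (n - 1) y
          (eq_zero_of_isZero (Y.isZero₂_of_isFirstQuadrant _ _ _ _ (by simp; lia)) _)
        refine ⟨y', ?_⟩
        have h2 : (Y.H n).map (twoδ₁Toδ₀' ⊥ ((q : ℤ) : EInt) ((q + 1 : ℤ) : EInt) bot_le h12)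
            ((Y.H n).map (twoδ₂Toδ₁' ⊥ _ _ bot_le h12) k) = 0 :=
          ConcreteCategory.congr_hom (Y.zero₂ (homOfLE bot_le) (homOfLE h12) _ rfl n) k
        rw [map_sub, sub_eq_iff_eq_add] at h1
        have h3 : l = Y.δ (homOfLE bot_le) (homOfLE le_top) (n - 1) n (by lia) y +
            (Y.H n).map (twoδ₂Toδ₁' ⊥ _ _ bot_le h12) k := by
          rw [hy]; abel
        rw [h3]
        refine Eq.trans ?_ (map_add ((Y.H n).map (twoδ₁Toδ₀' ⊥ _ _ bot_le h12)).hom _ _).symm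
        refine Eq.trans ?_ (congrArg (_ + ·) h2).symm
        refine Eq.trans ?_ (add_zero _).symm
        have h4 := Y.δ_naturality_apply (bot_le : ⊥ ≤ ((q + 1 : ℤ) : EInt)) le_top h12 le_top bot_le
          le_rfl le_rfl (n - 1) n (by lia) y
        refine Eq.trans ?_ h4
        have h5 := Y.δ_naturality_apply h12 h23 h12 le_top le_rfl
          le_rfl le_top (n - 1) n (by lia) y'
        have h6 : (Y.H (n - 1)).map (homMk₁ (homOfLE le_rfl) (homOfLE le_rfl) rfl) y = y := by
          refine Eq.trans ?_ (ConcreteCategory.congr_hom ((Y.H (n - 1)).map_id _) y)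
          refine congrArg (fun t => (Y.H (n - 1)).map t y) ?_
          apply ComposableArrows.hom_ext₁ <;> exact Subsingleton.elim _ _
        rw [h6]
        have h7 : (Y.H n).map (homMk₁ (homOfLE (le_refl ((q : ℤ) : EInt)))
            (homOfLE (le_refl ((q + 1 : ℤ) : EInt))) rfl)
            (Y.δ (homOfLE h12) (homOfLE h23) (n - 1) n (by lia) y') =
            Y.δ (homOfLE h12) (homOfLE h23) (n - 1) n (by lia) y' := by
          refine Eq.trans ?_ (ConcreteCategory.congr_hom ((Y.H n).map_id (mk₁ (homOfLE h12))) _)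
          refine congrArg (fun t => (Y.H n).map t _) ?_
          apply ComposableArrows.hom_ext₁ <;> exact Subsingleton.elim _ _
        refine (h7.symm.trans h5.symm).trans ?_
        rw [← hy']
        rfl

end CategoryTheory.Abelian.SpectralObject

end Convergence

/-! ### Truncations in a t-structure and the spectral sequence of `Hom(Z, -)`. -/

section SpectralObjects

open Pretriangulated ComposableArrows

/-- The spectral object in an abelian category obtained by applying a homological functor to
a spectral object in a triangulated category. -/
def CategoryTheory.Triangulated.SpectralObject.mapHomologicalFunctor {C A ι : Type*} [Category C]
    [Category A] [Category ι] [HasZeroObject C] [HasShift C ℤ] [Preadditive C]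
    [∀ n : ℤ, (shiftFunctor C n).Additive] [Pretriangulated C] [Abelian A]
    (X : Triangulated.SpectralObject C ι) (F : C ⥤ A) [F.IsHomological] [F.ShiftSequence ℤ] :
    Abelian.SpectralObject A ι where
  H n := X.ω₁ ⋙ F.shift n
  δ' n₀ n₁ h :=
    { app D := F.homologySequenceδ (X.ω₂.obj D) n₀ n₁ h
      naturality _ _ φ := F.homologySequenceδ_naturality _ _ (X.ω₂.map φ) n₀ n₁ h }
  exact₁' n₀ n₁ h D :=
    (F.homologySequence_exact₁ _ (X.ω₂_obj_distinguished D) n₀ n₁ h).exact_toComposableArrows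
  exact₂' n D :=
    (F.homologySequence_exact₂ _ (X.ω₂_obj_distinguished D) n).exact_toComposableArrows
  exact₃' n₀ n₁ h D :=
    (F.homologySequence_exact₃ _ (X.ω₂_obj_distinguished D) n₀ n₁ h).exact_toComposableArrows

/-- In a locally small preadditive category, the functor sending `X` to the group of
morphisms `Z ⟶ X`. -/
def shrinkHom {C : Type*} [Category C] [Preadditive C] [LocallySmall.{u} C] (Z : C) :
    C ⥤ AddCommGrpCat.{u} where
  obj X := AddCommGrpCat.of (Shrink.{u} (Z ⟶ X))
  map f := AddCommGrpCat.ofHom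
    ((Shrink.addEquiv.symm.toAddMonoidHom.comp (Preadditive.rightComp Z f)).comp
      Shrink.addEquiv.toAddMonoidHom)
  map_id X := by
    refine AddCommGrpCat.hom_ext (AddMonoidHom.ext fun x => ?_)
    change equivShrink _ ((equivShrink _).symm x ≫ 𝟙 X) = x
    rw [Category.comp_id, Equiv.apply_symm_apply]
  map_comp f g := by
    refine AddCommGrpCat.hom_ext (AddMonoidHom.ext fun x => ?_)
    change equivShrink _ ((equivShrink _).symm x ≫ f ≫ g) =
      equivShrink _ ((equivShrink _).symm (equivShrink _ ((equivShrink _).symm x ≫ f)) ≫ g)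
    rw [Equiv.symm_apply_apply, Category.assoc]

theorem shrinkHom_map_apply {C : Type*} [Category C] [Preadditive C] [LocallySmall.{u} C]
    (Z : C) {X Y : C} (f : X ⟶ Y) (x : Z ⟶ X) :
    (shrinkHom Z).map f (equivShrink _ x) = equivShrink _ (x ≫ f) := by
  change equivShrink _ ((equivShrink _).symm (equivShrink _ x) ≫ f) = _
  rw [Equiv.symm_apply_apply]

instance {C : Type*} [Category C] [Preadditive C] [LocallySmall.{u} C] (Z : C) :
    (shrinkHom Z).Additive where
  map_add {X Y f g} := by
    refine AddCommGrpCat.hom_ext (AddMonoidHom.ext fun x => ?_)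
    obtain ⟨x, rfl⟩ := (equivShrink _).surjective x
    refine (shrinkHom_map_apply Z _ x).trans ?_
    refine Eq.trans ?_ (congrArg₂ (· + ·) (shrinkHom_map_apply Z f x)
      (shrinkHom_map_apply Z g x)).symm
    rw [Preadditive.comp_add]
    exact map_add Shrink.addEquiv.symm _ _

variable {C : Type*} [Category C] [HasShift C ℤ] [Preadditive C] [LocallySmall.{u} C] (Z : C)

instance : (shrinkHom Z).ShiftSequence ℤ := Functor.ShiftSequence.tautological _ _

/-- The value of the `n`-th shift of `shrinkHom Z`. -/
def shrinkHomShiftEquiv (X : C) (n : ℤ) :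
    (((shrinkHom Z).shift n).obj X : Type u) ≃+ (Z ⟶ X⟦n⟧) :=
  Shrink.addEquiv

theorem isZero_shrinkHom_shift_obj (X : C) (n : ℤ) (h : ∀ f : Z ⟶ X⟦n⟧, f = 0) :
    IsZero (((shrinkHom Z).shift n).obj X) := by
  have : Subsingleton (((shrinkHom Z).shift n).obj X) :=
    (shrinkHomShiftEquiv Z X n).toEquiv.subsingleton_congr.2 ⟨fun f g => (h f).trans (h g).symm⟩
  exact AddCommGrpCat.isZero_of_subsingleton _

variable [HasZeroObject C] [∀ n : ℤ, (shiftFunctor C n).Additive] [Pretriangulated C]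

instance : (shrinkHom Z).IsHomological where
  map_zero _ _ := Functor.map_zero _ _ _
  exact T hT := by
    rw [ShortComplex.ab_exact_iff]
    intro (x : Shrink.{u} (Z ⟶ T.obj₂)) hx
    obtain ⟨x, rfl⟩ := (equivShrink _).surjective x
    have hx : (shrinkHom Z).map T.mor₂ (equivShrink _ x) = 0 := hx
    rw [shrinkHom_map_apply] at hx
    have hx' : x ≫ T.mor₂ = 0 := (equivShrink _).injective (hx.trans rfl)
    obtain ⟨y, hy⟩ := T.coyoneda_exact₂ hT x hx'
    exact ⟨equivShrink _ y, (shrinkHom_map_apply Z T.mor₁ y).trans (congrArg _ hy.symm)⟩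

variable (t : Triangulated.TStructure C) [IsTriangulated C]

/-- The truncation of `X` below `j ≤ 0` is zero because `X` lies in degrees `≥ 0`. A truncation in
degrees `≥ i > n`, shifted by `n`, lies in degrees `≥ 1`, and there are no nonzero morphisms to it
from `Z`, which lies in degrees `≤ 0`. -/
theorem isFirstQuadrant_spectralObject [t.IsLE Z 0] (X : C) [t.IsGE X 0] :
    ((t.spectralObject X).mapHomologicalFunctor (shrinkHom Z)).IsFirstQuadrant where
  isZero₁ i j hij hj n := by
    refine Functor.map_isZero ((shrinkHom Z).shift n) (X := (t.ω₁.obj (mk₁ (homOfLE hij))).obj X) ?_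
    exact Functor.map_isZero (t.eTruncGE.obj i) (t.isZero_eTruncLT_obj_obj X 0 j hj)
  isZero₂ i j hij n hi := by
    refine isZero_shrinkHom_shift_obj Z _ n fun f => ?_
    have : t.IsGE ((t.ω₁.obj (mk₁ (homOfLE hij))).obj X) (n + 1) :=
      t.isGE_eTruncGE_obj_obj (n + 1) i (by
        induction i using WithBotTop.rec with
        | bot => simp at hi
        | coe i => simp at hi ⊢; lia
        | top => exact le_top) _
    have : t.IsGE (((t.spectralObject X).ω₁.obj (mk₁ (homOfLE hij)))⟦n⟧) 1 := t.isGE_shift ((t.ω₁.obj (mk₁ (homOfLE hij))).obj X) (n + 1) n 1 (by lia)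
    exact t.zero f 0 1 (by lia)

/-- The spectral sequence of the truncations of an object, after applying `Hom(Z, -)`. -/
theorem exists_spectralSequence [t.IsLE Z 0] (X : C) [t.IsGE X 0] :
    ∃ E : E₂CohomologicalSpectralSequenceNat AddCommGrpCat.{u},
      (∀ (hr : (2 : ℤ) ≤ 2) (p q : ℕ), Nonempty ((E.page 2 hr).X (p, q) ≅
        ((shrinkHom Z).shift (p + q : ℤ)).obj
        ((t.truncGE q).obj ((t.truncLT (q + 1)).obj X)))) ∧
      ∀ (H : ℕ → AddCommGrpCat.{u}), (∀ n : ℕ, Nonempty ((H n : Type u) ≃+ (Z ⟶ X⟦(n : ℤ)⟧))) →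
        ConvergesTo E H := by
  have := isFirstQuadrant_spectralObject Z t X
  refine ⟨((t.spectralObject X).mapHomologicalFunctor (shrinkHom Z)).E₂SpectralSequenceNat,
    fun _ p q => ⟨?_⟩, fun H e => ?_⟩
  -- The `(p, q)` entry of the second page is the value in degree `p + q` of the spectral object on
  -- the interval `q ≤ q + 1`, that is, on the `q`-th slice of `X`.
  · exact Abelian.SpectralObject.spectralSequenceFirstPageXIso _ Abelian.SpectralObject.coreE₂CohomologicalNat (p, q)
      ((q : ℤ) : EInt) ((q + 1 : ℤ) : EInt) rfl rfl (p + q) rfl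
  · exact Abelian.SpectralObject.convergesTo_of_isFirstQuadrant _ H fun n =>
      (e n).some.trans (shrinkHomShiftEquiv Z X n).symm

end SpectralObjects

/-- Postcomposition with an isomorphism, as an additive equivalence. -/
def CategoryTheory.Iso.homToAddEquiv {C : Type*} [Category C] [Preadditive C] {X Y : C} (e : X ≅ Y)
    (Z : C) : (Z ⟶ X) ≃+ (Z ⟶ Y) :=
  { e.homToEquiv with map_add' := fun _ _ => Preadditive.add_comp _ _ _ _ _ _ }

/-! ### The bounded below derived category and the hyperext spectral sequence. -/

section BoundedBelow

open DerivedCategory Triangulated Pretriangulated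

namespace DerivedCategory.Plus

section

variable {𝒞 : Type*} [Category 𝒞] [Abelian 𝒞] [HasDerivedCategory 𝒞]

/-- The inclusion of the bounded below derived category is fully faithful. -/
def ιHomAddEquiv (X Y : Plus 𝒞) : (X ⟶ Y) ≃+ (ι.obj X ⟶ ι.obj Y) :=
  { (Functor.FullyFaithful.ofFullyFaithful ι).homEquiv with
    map_add' := fun _ _ => ι.map_add }

/-- In the long exact homology sequence of the truncation triangle, the part in degrees `≥ n`
contributes nothing in degrees `q - 1` and `q`. With its counterpart for `truncGEπ`, this identifies
the homology of a slice with that of `X`. -/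
theorem isIso_homologyFunctor_map_truncLTι (X : Plus 𝒞) (n q : ℤ) (hq : q < n) :
    IsIso ((homologyFunctor 𝒞 q).map ((TStructure.t.truncLTι n).app X)) := by
  have hT := Plus.ι.map_distinguished _ (TStructure.t.triangleLTGE_distinguished n X)
  have h₁ : Mono ((homologyFunctor 𝒞 q).map ((TStructure.t.truncLTι n).app X)) :=
    (HomologySequence.mono_homologyMap_mor₁_iff _ hT (q - 1) q).2
      ((isZero_homology_of_isGE ((TStructure.t.truncGE n).obj X) n (q - 1) (by lia)).eq_of_src _ _)
  have h₂ : Epi ((homologyFunctor 𝒞 q).map ((TStructure.t.truncLTι n).app X)) :=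
    (HomologySequence.epi_homologyMap_mor₁_iff _ hT q).2
      ((isZero_homology_of_isGE ((TStructure.t.truncGE n).obj X) n q hq).eq_of_tgt _ _)
  exact isIso_of_mono_of_epi _

theorem isIso_homologyFunctor_map_truncGEπ (X : Plus 𝒞) (n q : ℤ) (hq : n ≤ q) :
    IsIso ((homologyFunctor 𝒞 q).map ((TStructure.t.truncGEπ n).app X)) := by
  have hT := Plus.ι.map_distinguished _ (TStructure.t.triangleLTGE_distinguished n X)
  have : ((TStructure.t.truncLT n).obj X).IsLE (n - 1) :=
    inferInstanceAs (TStructure.t.IsLE ((TStructure.t.triangleLTGE n).obj X).obj₁ (n - 1))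
  have h₁ : Mono ((homologyFunctor 𝒞 q).map ((TStructure.t.truncGEπ n).app X)) :=
    (HomologySequence.mono_homologyMap_mor₂_iff _ hT q).2
      ((isZero_homology_of_isLE ((TStructure.t.truncLT n).obj X) (n - 1) q
        (by lia)).eq_of_src _ _)
  have h₂ : Epi ((homologyFunctor 𝒞 q).map ((TStructure.t.truncGEπ n).app X)) :=
    (HomologySequence.epi_homologyMap_mor₂_iff _ hT q (q + 1)).2
      ((isZero_homology_of_isLE ((TStructure.t.truncLT n).obj X) (n - 1) (q + 1)
        (by lia)).eq_of_tgt _ _)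
  exact isIso_of_mono_of_epi _

/-- The `q`-th slice of an object of the bounded below derived category is its `q`-th homology
object placed in degree `q`. -/
theorem nonempty_truncGE_truncLT_iso (X : Plus 𝒞) (q : ℤ) :
    Nonempty (ι.obj ((TStructure.t.truncGE q).obj ((TStructure.t.truncLT (q + 1)).obj X)) ≅
      (DerivedCategory.singleFunctor 𝒞 q).obj ((homologyFunctor 𝒞 q).obj X)) := by
  have : ((TStructure.t.truncLT (q + 1)).obj X).IsLE q := by
    have : TStructure.t.IsLE ((TStructure.t.triangleLTGE (q + 1)).obj X).obj₁ (q + 1 - 1) :=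
      inferInstance
    rw [add_sub_cancel_right] at this
    exact this
  have : ((TStructure.t.truncGE q).obj ((TStructure.t.truncLT (q + 1)).obj X)).IsLE q :=
    inferInstance
  have : ((TStructure.t.truncGE q).obj ((TStructure.t.truncLT (q + 1)).obj X)).IsGE q :=
    inferInstance
  -- The slice lies in degrees `≤ q` and `≥ q`, so it is a single object `W`; comparing the homology
  -- in degree `q` along the two truncation maps determines `W`.
  obtain ⟨W, ⟨e⟩⟩ := exists_iso_singleFunctor_obj_of_isGE_of_isLE
    (ι.obj ((TStructure.t.truncGE q).obj ((TStructure.t.truncLT (q + 1)).obj X))) q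
  have := isIso_homologyFunctor_map_truncLTι X (q + 1) q (by lia)
  have := isIso_homologyFunctor_map_truncGEπ ((TStructure.t.truncLT (q + 1)).obj X) q q le_rfl
  let e' : W ≅ (homologyFunctor 𝒞 q).obj X :=
    ((singleFunctorCompHomologyFunctorIso 𝒞 q).app W).symm ≪≫
      (DerivedCategory.homologyFunctor 𝒞 q).mapIso e.symm ≪≫
      (asIso ((homologyFunctor 𝒞 q).map ((TStructure.t.truncGEπ q).app
        ((TStructure.t.truncLT (q + 1)).obj X)))).symm ≪≫
      asIso ((homologyFunctor 𝒞 q).map ((TStructure.t.truncLTι (q + 1)).app X))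
  exact ⟨e ≪≫ (DerivedCategory.singleFunctor 𝒞 q).mapIso e'⟩

end

variable {𝒞 : Type*} [Category.{u} 𝒞] [Abelian 𝒞] [HasDerivedCategory 𝒞]

theorem exists_iso_Qh_obj_isKInjective [EnoughInjectives 𝒞] (X : Plus 𝒞) :
    ∃ (K : HomotopyCategory.Plus 𝒞) (_ : CochainComplex.IsKInjective K.1.as), Nonempty (Qh.obj K ≅ X) := by
  obtain ⟨n, hn⟩ := X.2
  have : X.IsGE n := ⟨hn.1⟩
  obtain ⟨L, _, e⟩ := exists_injective_nonempty_iso X n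
  exact ⟨_, inferInstanceAs (CochainComplex.IsKInjective
      (((InjectiveObject.ι 𝒞).mapHomologicalComplex (.up ℤ)).obj L.obj)), e⟩

/-- Replacing the target by a K-injective complex, morphisms become homotopy classes of maps of
complexes, which form a small type. This lets `shrinkHom` take values in abelian groups in the
universe `u`. -/
instance [EnoughInjectives 𝒞] : LocallySmall.{u} (Plus 𝒞) where
  hom_small X Y := by
    obtain ⟨L, hL, ⟨e⟩⟩ := exists_iso_Qh_obj_isKInjective Y
    let e' := Qh.objObjPreimageIso X
    exact small_of_injective (β := (Qh.objPreimage X ⟶ L))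
      (f := (Equiv.ofBijective _ (Qh_map_bijective_of_isKInjective (Qh.objPreimage X) L hL)).symm ∘
        (e'.homCongr e).symm)
      ((Equiv.injective _).comp (Equiv.injective _))

/-- Morphisms in the bounded below derived category into the shift of an object concentrated
in a single degree are extensions. -/
theorem nonempty_addEquiv_ext [HasExt.{u} 𝒞] (Z W : 𝒞) (Y : Plus 𝒞) (p q : ℕ)
    (e : ι.obj Y ≅ (DerivedCategory.singleFunctor 𝒞 q).obj W) :
    Nonempty (((singleFunctor 𝒞 0).obj Z ⟶ Y⟦(p + q : ℤ)⟧) ≃+ Abelian.Ext.{u} Z W p) := by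
  -- The object `W` placed in degree `q` and shifted by `p + q` is `W` in degree `0` shifted by `p`.
  let e₁ : ι.obj (Y⟦(p + q : ℤ)⟧) ≅ ((DerivedCategory.singleFunctor 𝒞 0).obj W)⟦(p : ℤ)⟧ :=
    (ι.commShiftIso (p + q : ℤ)).app Y ≪≫ (shiftFunctor _ (p + q : ℤ)).mapIso e ≪≫
      (shiftFunctorAdd' _ (q : ℤ) (p : ℤ) (p + q) (add_comm _ _)).app _ ≪≫
      (shiftFunctor _ (p : ℤ)).mapIso
        (((DerivedCategory.singleFunctors 𝒞).shiftIso (q : ℤ) 0 q (by simp)).app W)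
  exact ⟨((ιHomAddEquiv _ _).trans (e₁.homToAddEquiv _)).trans Abelian.Ext.homAddEquiv.symm⟩

end DerivedCategory.Plus

/-- The spectral sequence of the hypercohomology of a bounded below complex. -/
theorem exists_hyperext_spectralSequence {𝒞 : Type*} [Category.{u} 𝒞] [Abelian 𝒞]
    [EnoughInjectives 𝒞] [HasExt.{u} 𝒞] [HasDerivedCategory 𝒞] (Z : 𝒞)
    (K : CochainComplex 𝒞 ℤ) [K.IsStrictlyGE 0] :
    ∃ E : E₂CohomologicalSpectralSequenceNat AddCommGrpCat.{u},
      (∀ (hr : (2 : ℤ) ≤ 2) (p q : ℕ), Nonempty ((E.page 2 hr).X (p, q) ≅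
        AddCommGrpCat.of (Abelian.Ext.{u} Z (K.homology q) p))) ∧
      ∀ (H : ℕ → AddCommGrpCat.{u}), (∀ n : ℕ, Nonempty ((H n : Type u) ≃+
        ((DerivedCategory.singleFunctor 𝒞 0).obj Z ⟶ (DerivedCategory.Q.obj K)⟦(n : ℤ)⟧))) →
        ConvergesTo E H := by
  let X : Plus 𝒞 := Plus.Q.obj ⟨K, 0, inferInstance⟩
  have : X.IsGE 0 := by
    rw [← Plus.isGE_ι_obj_iff]
    exact inferInstanceAs ((DerivedCategory.Q.obj K).IsGE 0)
  obtain ⟨E, h₁, h₂⟩ := exists_spectralSequence ((Plus.singleFunctor 𝒞 0).obj Z)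
    Plus.TStructure.t X
  refine ⟨E, fun hr p q => ?_, fun H e => h₂ H fun n => (e n).map fun e => e.trans ?_⟩
  · obtain ⟨e₁⟩ := h₁ hr p q
    obtain ⟨e₂⟩ := Plus.nonempty_truncGE_truncLT_iso X q
    obtain ⟨e₃⟩ := Plus.nonempty_addEquiv_ext Z (K.homology q) _ p q
      (e₂ ≪≫ (DerivedCategory.singleFunctor 𝒞 q).mapIso ((homologyFunctorFactors 𝒞 q).app K))
    exact ⟨e₁ ≪≫ ((shrinkHomShiftEquiv _ _ _).trans e₃).toAddCommGrpIso⟩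
  · exact ((Plus.ιHomAddEquiv ((Plus.singleFunctor 𝒞 0).obj Z) (X⟦(n : ℤ)⟧)).trans
      (((Plus.ι.commShiftIso (n : ℤ)).app X).homToAddEquiv _)).symm

end BoundedBelow

/-! ### Complexes with `Z`-acyclic terms compute derived morphisms from `Z`. -/

section ExtAcyclic

open Abelian Pretriangulated CochainComplex HomComplex

/-- The short exact sequence of cycles of an acyclic complex. -/
theorem HomologicalComplex.Acyclic.shortExact_cycles {𝒞 : Type*} [Category 𝒞] [Abelian 𝒞]
    {K : CochainComplex 𝒞 ℤ} (hK : K.Acyclic)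
    (n n' : ℤ) (h : n + 1 = n') :
    (ShortComplex.mk (K.iCycles n) (K.toCycles n n') (by
      rw [← cancel_mono (K.iCycles n')]; simp)).ShortExact where
  exact := by
    refine ShortComplex.exact_of_f_is_kernel _
      (KernelFork.IsLimit.ofι _ _ (fun {A} f hf => K.liftCycles f n' (by simp [← h]) ?_) ?_ ?_)
    · rw [← K.toCycles_i, reassoc_of% hf, zero_comp]
    · intro A f hf
      exact K.liftCycles_i _ _ _ _
    · intro A f hf m hm
      rw [← cancel_mono (K.iCycles n), hm, K.liftCycles_i]
  mono_f := inferInstanceAs (Mono (K.iCycles n))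
  epi_g := by
    exact Preadditive.epi_of_isZero_cokernel' _ (K.homologyIsCokernel n n' (by simp [← h]))
      ((K.exactAt_iff_isZero_homology n').1 (hK n'))

variable {𝒞 : Type*} [Category.{u} 𝒞] [Abelian 𝒞] [HasExt.{u} 𝒞]

/-- An object `W` is `Z`-acyclic if all the positive `Ext`-groups from `Z` to `W` vanish. -/
def ExtAcyclic (Z W : 𝒞) : Prop := ∀ (p : ℕ) (e : Ext.{u} Z W (p + 1)), e = 0

namespace ExtAcyclic

variable {Z : 𝒞}

theorem of_isZero {W : 𝒞} (h : IsZero W) : ExtAcyclic Z W := fun p e => by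
  rw [← e.comp_mk₀_id, h.eq_of_src (𝟙 W) 0, Ext.mk₀_zero, Ext.comp_zero]

theorem of_injective {W : 𝒞} [Injective W] : ExtAcyclic Z W := fun _ e =>
  Ext.eq_zero_of_injective e

theorem of_iso {W W' : 𝒞} (h : ExtAcyclic Z W) (i : W ≅ W') : ExtAcyclic Z W' := fun p e => by
  have h1 := h p (e.comp (Ext.mk₀ i.inv) (add_zero _))
  rw [← e.comp_mk₀_id, ← i.inv_hom_id, ← Ext.mk₀_comp_mk₀,
    ← Ext.comp_assoc_of_second_deg_zero, h1, Ext.zero_comp]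

/-- In the long exact sequence, a positive `Ext` group of `S.X₃` lies between those of `S.X₂` and,
one degree higher, of `S.X₁`. -/
theorem of_shortExact {S : ShortComplex 𝒞} (hS : S.ShortExact) (h₁ : ExtAcyclic Z S.X₁)
    (h₂ : ExtAcyclic Z S.X₂) : ExtAcyclic Z S.X₃ := fun p e => by
  obtain ⟨e', rfl⟩ := Ext.covariant_sequence_exact₃ Z hS e rfl (h₁ _ _)
  rw [h₂ p e', Ext.zero_comp]

theorem surjective_of_shortExact {S : ShortComplex 𝒞} (hS : S.ShortExact)
    (h₁ : ExtAcyclic Z S.X₁) (f : Z ⟶ S.X₃) : ∃ g : Z ⟶ S.X₂, g ≫ S.g = f := by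
  obtain ⟨e, he⟩ := Ext.covariant_sequence_exact₃ Z hS (Ext.mk₀ f) rfl (h₁ _ _)
  obtain ⟨g, rfl⟩ := (Ext.mk₀_bijective _ _).2 e
  rw [Ext.mk₀_comp_mk₀] at he
  exact ⟨g, (Ext.mk₀_bijective _ _).1 he⟩

/-- Degreewise the cone is the direct sum of `K.X (n + 1)` and `L.X n`: its identity is the sum of
two maps, one through each summand. -/
theorem mappingCone_X {K L : CochainComplex 𝒞 ℤ} (φ : K ⟶ L) (n : ℤ)
    (h₁ : ExtAcyclic Z (K.X (n + 1))) (h₂ : ExtAcyclic Z (L.X n)) :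
    ExtAcyclic Z ((mappingCone φ).X n) := fun p e => by
  rw [← e.comp_mk₀_id, ← mappingCone.id_X φ n (n + 1) rfl, Ext.mk₀_add, Ext.comp_add,
    ← Ext.mk₀_comp_mk₀, ← Ext.mk₀_comp_mk₀, ← Ext.comp_assoc_of_second_deg_zero,
    ← Ext.comp_assoc_of_second_deg_zero, h₁ p (e.comp _ _), h₂ p (e.comp _ _),
    Ext.zero_comp, Ext.zero_comp, add_zero]

/-- Induction upwards from degree `N - 1`, where the complex and hence its cycles vanish, along the
sequences of cycles `0 ⟶ Z^n ⟶ K^n ⟶ Z^{n+1} ⟶ 0`. -/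
theorem cycles {K : CochainComplex 𝒞 ℤ} (hK : K.Acyclic) (N : ℤ) [K.IsStrictlyGE N]
    (h : ∀ n, ExtAcyclic Z (K.X n)) (n : ℤ) : ExtAcyclic Z (K.cycles n) := by
  have key : ∀ k : ℕ, ExtAcyclic Z (K.cycles (N - 1 + k)) := by
    intro k
    induction k with
    | zero =>
      refine of_isZero ((IsZero.iff_id_eq_zero _).2 ?_)
      rw [← cancel_mono (K.iCycles _)]
      exact (K.isZero_of_isStrictlyGE N _ (by simp)).eq_of_tgt _ _
    | succ k ih =>
      exact of_shortExact (hK.shortExact_cycles (N - 1 + k) _ (by push_cast; ring)) ih (h _)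
  by_cases hn : N - 1 ≤ n
  · obtain ⟨k, rfl⟩ := Int.le.dest hn
    exact key k
  · refine of_isZero ((IsZero.iff_id_eq_zero _).2 ?_)
    rw [← cancel_mono (K.iCycles _)]
    exact (K.isZero_of_isStrictlyGE N _ (by lia)).eq_of_tgt _ _

/-- A cocycle is a map to the cycles, and it lifts along `K^n ⟶ Z^{n+1}` because the kernel `Z^n` is
acyclic. Thus `Hom(Z, -)` keeps such a complex exact. -/
theorem exists_comp_d_eq {K : CochainComplex 𝒞 ℤ} (hK : K.Acyclic) (N : ℤ) [K.IsStrictlyGE N]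
    (h : ∀ n, ExtAcyclic Z (K.X n)) (n n' n'' : ℤ) (hn : n + 1 = n') (hn' : n' + 1 = n'')
    (f : Z ⟶ K.X n') (hf : f ≫ K.d n' n'' = 0) : ∃ g : Z ⟶ K.X n, g ≫ K.d n n' = f := by
  obtain ⟨g, hg⟩ := surjective_of_shortExact (hK.shortExact_cycles n n' hn) (cycles hK N h n)
    (K.liftCycles f n'' (by simp [← hn']) hf)
  refine ⟨g, ?_⟩
  rw [← K.toCycles_i, reassoc_of% hg, K.liftCycles_i]

theorem subsingleton_cohomologyClass {K : CochainComplex 𝒞 ℤ} (hK : K.Acyclic) (N : ℤ)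
    [K.IsStrictlyGE N] (h : ∀ n, ExtAcyclic Z (K.X n)) (n : ℤ) :
    Subsingleton (CohomologyClass ((singleFunctor 𝒞 0).obj Z) K n) := by
  refine subsingleton_of_forall_eq 0 fun x => ?_
  obtain ⟨x, rfl⟩ := x.mk_surjective
  obtain ⟨f, hf, rfl⟩ := Cocycle.fromSingleMk_surjective x n (zero_add n) (n + 1) rfl
  rw [CohomologyClass.mk_eq_zero_iff,
    Cocycle.fromSingleMk_mem_coboundaries_iff _ _ _ _ _ (n - 1) (by simp)]
  exact exists_comp_d_eq hK N h (n - 1) n (n + 1) (by simp) rfl f hf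

end ExtAcyclic

/-- Morphisms in the derived category from `Z` to a bounded below complex with `Z`-acyclic terms
can be computed in the homotopy category. -/
theorem nonempty_homAddEquiv_cohomologyClass [EnoughInjectives 𝒞] [HasDerivedCategory 𝒞] (Z : 𝒞)
    (K : CochainComplex 𝒞 ℤ) [K.IsStrictlyGE 0] (hK : ∀ n, ExtAcyclic Z (K.X n)) (n : ℤ) :
    Nonempty (((DerivedCategory.singleFunctor 𝒞 0).obj Z ⟶ (DerivedCategory.Q.obj K)⟦n⟧) ≃+
      CohomologyClass ((singleFunctor 𝒞 0).obj Z) K n) := by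
  -- The result is clear for a bounded below complex `J` of injectives, which is K-injective. It
  -- passes to `K` because the cone of `K ⟶ J` is acyclic with `Z`-acyclic terms.
  obtain ⟨J, i, hi, hJ, _⟩ :=
    CochainComplex.Plus.modelCategoryQuillen.exists_quasiIso_injective K 0
  have : J.IsKInjective := isKInjective_of_injective J 0
  -- The cone starts in degree `-1` because `K` enters it with a shift.
  have := isStrictlyGE_mappingCone i 0 0 (-1)
  have hT := HomotopyCategory.mappingCone_triangleh_distinguished i
  have hcone : (mappingCone i).Acyclic := by
    rw [← HomotopyCategory.quotient_obj_mem_subcategoryAcyclic_iff_acyclic]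
    refine ((HomotopyCategory.subcategoryAcyclic 𝒞).trW_iff_of_distinguished _ hT).1 ?_
    rw [← HomotopyCategory.quasiIso_eq_trW_subcategoryAcyclic]
    exact (HomotopyCategory.quotient_map_mem_quasiIso_iff i).2 hi
  let F := preadditiveCoyoneda.obj (Opposite.op
    ((HomotopyCategory.quotient 𝒞 (.up ℤ)).obj ((singleFunctor 𝒞 0).obj Z)))
  -- There are no nonzero homotopy classes from `Z` to any shift of the cone, so `i` induces a
  -- bijection on homotopy classes from `Z`.
  have hz : ∀ m : ℤ, IsZero ((F.shift m).obj ((HomotopyCategory.quotient 𝒞 (.up ℤ)).obj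
      (mappingCone i))) := by
    intro m
    have h1 := ExtAcyclic.subsingleton_cohomologyClass (Z := Z) hcone (-1)
      (fun n => ExtAcyclic.mappingCone_X i n (hK _) .of_injective) m
    have h2 := (CohomologyClass.homAddEquiv.trans
      ((((HomotopyCategory.quotient 𝒞 (.up ℤ)).commShiftIso m).app
        (mappingCone i)).homToAddEquiv _)).symm.toEquiv.subsingleton_congr.2 h1
    exact @AddCommGrpCat.isZero_of_subsingleton _ h2
  have h₁ : Mono ((F.shift n).map ((HomotopyCategory.quotient 𝒞 (.up ℤ)).map i)) :=
    (F.homologySequence_mono_shift_map_mor₁_iff _ hT (n - 1) n (by lia)).2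
      ((hz _).eq_of_src _ _)
  have h₂ : Epi ((F.shift n).map ((HomotopyCategory.quotient 𝒞 (.up ℤ)).map i)) :=
    (F.homologySequence_epi_shift_map_mor₁_iff _ hT n).2 ((hz _).eq_of_tgt _ _)
  have := isIso_of_mono_of_epi ((F.shift n).map ((HomotopyCategory.quotient 𝒞 (.up ℤ)).map i))
  let e₁ : (((HomotopyCategory.quotient 𝒞 (.up ℤ)).obj ((singleFunctor 𝒞 0).obj Z)) ⟶
      ((HomotopyCategory.quotient 𝒞 (.up ℤ)).obj K)⟦n⟧) ≃+
      (((HomotopyCategory.quotient 𝒞 (.up ℤ)).obj ((singleFunctor 𝒞 0).obj Z)) ⟶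
        ((HomotopyCategory.quotient 𝒞 (.up ℤ)).obj J)⟦n⟧) :=
    (asIso ((F.shift n).map
      ((HomotopyCategory.quotient 𝒞 (.up ℤ)).map i))).addCommGroupIsoToAddEquiv
  let e₂ := (((HomotopyCategory.quotient 𝒞 (.up ℤ)).commShiftIso n).app K).homToAddEquiv
    ((HomotopyCategory.quotient 𝒞 (.up ℤ)).obj ((singleFunctor 𝒞 0).obj Z))
  let e₃ := (((HomotopyCategory.quotient 𝒞 (.up ℤ)).commShiftIso n).app J).homToAddEquiv
    ((HomotopyCategory.quotient 𝒞 (.up ℤ)).obj ((singleFunctor 𝒞 0).obj Z))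
  let e₄ := AddEquiv.ofBijective (DerivedCategory.Qh.mapAddHom)
    (IsKInjective.Qh_map_bijective ((HomotopyCategory.quotient 𝒞 (.up ℤ)).obj
      ((singleFunctor 𝒞 0).obj Z)) (J⟦n⟧))
  let e₅ : DerivedCategory.Qh.obj ((HomotopyCategory.quotient 𝒞 (.up ℤ)).obj (J⟦n⟧)) ≅
      (DerivedCategory.Q.obj K)⟦n⟧ :=
    (DerivedCategory.Q.commShiftIso n).app J ≪≫
      (CategoryTheory.shiftFunctor _ n).mapIso (asIso (DerivedCategory.Q.map i)).symm
  exact ⟨((CohomologyClass.homAddEquiv.trans e₂).trans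
    ((e₁.trans e₃.symm).trans (e₄.trans (e₅.homToAddEquiv _)))).symm⟩

end ExtAcyclic

/-! ### Passage from complexes indexed by `ℕ` to complexes indexed by `ℤ`. -/

section NatComplexes

open Abelian CochainComplex HomComplex

/-- The group of morphisms from `Z` to the cocycles of a cochain complex. -/
def cocyclesHom {𝒞 : Type*} [Category 𝒞] [Preadditive 𝒞] (Z : 𝒞) (C : CochainComplex 𝒞 ℕ)
    (n : ℕ) : AddSubgroup (Z ⟶ C.X n) :=
  (Preadditive.rightComp Z (C.d n (n + 1))).ker

theorem mem_cocyclesHom {𝒞 : Type*} [Category 𝒞] [Preadditive 𝒞] {Z : 𝒞}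
    {C : CochainComplex 𝒞 ℕ} {n : ℕ} {f : Z ⟶ C.X n} :
    f ∈ cocyclesHom Z C n ↔ f ≫ C.d n (n + 1) = 0 := Iff.rfl

theorem nonempty_addEquiv_of_surjective {G H K : Type*} [AddCommGroup G] [AddCommGroup H]
    [AddCommGroup K] (φ : G →+ H) (ψ : G →+ K) (hφ : Function.Surjective φ)
    (hψ : Function.Surjective ψ) (h : ∀ x, φ x = 0 ↔ ψ x = 0) : Nonempty (H ≃+ K) :=
  ⟨(QuotientAddGroup.quotientKerEquivOfSurjective φ hφ).symm.trans
    ((QuotientAddGroup.quotientAddEquivOfEq (AddSubgroup.ext h)).trans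
      (QuotientAddGroup.quotientKerEquivOfSurjective ψ hψ))⟩

variable {𝒞 : Type*} [Category.{u} 𝒞] [Abelian 𝒞]

/-- For `n = 0` the two predecessors differ: `0 - 1` is `0` in `ℕ`, where the differential from `0`
to `0` is zero, while over `ℤ` the term in degree `-1` is zero. Both conditions then say `f = 0`. -/
theorem extend_exists_comp_d_iff (Z : 𝒞) (C : CochainComplex 𝒞 ℕ) (n : ℕ) (f : Z ⟶ C.X n) :
    (∃ g : Z ⟶ (C.extend ComplexShape.embeddingUpNat).X ((n : ℤ) - 1),
      g ≫ (C.extend ComplexShape.embeddingUpNat).d ((n : ℤ) - 1) n =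
        f ≫ (C.extendXIso ComplexShape.embeddingUpNat (i := n) rfl).inv) ↔
      ∃ g : Z ⟶ C.X (n - 1), g ≫ C.d (n - 1) n = f := by
  obtain _ | n := n
  · have h1 : IsZero ((C.extend ComplexShape.embeddingUpNat).X (((0 : ℕ) : ℤ) - 1)) :=
      CochainComplex.isZero_of_isStrictlyGE _ 0 _ (by simp)
    constructor
    · rintro ⟨g, hg⟩
      refine ⟨0, ?_⟩
      rw [h1.eq_of_tgt g 0, zero_comp] at hg
      rw [zero_comp, ← cancel_mono (C.extendXIso ComplexShape.embeddingUpNat (i := 0) rfl).inv,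
        ← hg, zero_comp]
      rfl
    · rintro ⟨g, hg⟩
      refine ⟨0, ?_⟩
      rw [C.shape _ _ (by simp), comp_zero] at hg
      rw [← hg, zero_comp, zero_comp]
      rfl
  · have h1 := C.extend_d_eq ComplexShape.embeddingUpNat (i' := ((n + 1 : ℕ) : ℤ) - 1)
      (j' := ((n + 1 : ℕ) : ℤ)) (i := n) (j := n + 1) (by simp) rfl
    rw [h1]
    constructor
    · rintro ⟨g, hg⟩
      refine ⟨g ≫ (C.extendXIso ComplexShape.embeddingUpNat (i := n) (by simp)).hom, ?_⟩
      rw [← cancel_mono (C.extendXIso ComplexShape.embeddingUpNat (i := n + 1) rfl).inv, ← hg]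
      simp
      rfl
    · rintro ⟨g, hg⟩
      refine ⟨g ≫ (C.extendXIso ComplexShape.embeddingUpNat (i := n) (by simp)).inv, ?_⟩
      rw [← hg]
      simp
      rfl

/-- A cohomology class from a single complex is represented by a cocycle, which is unique up to
coboundaries. -/
theorem nonempty_addEquiv_cohomologyClass (Z : 𝒞) (C : CochainComplex 𝒞 ℕ) (n : ℕ)
    {H : Type*} [AddCommGroup H] (φ : cocyclesHom Z C n →+ H) (hφ : Function.Surjective φ)
    (hφ' : ∀ f, φ f = 0 ↔ ∃ g : Z ⟶ C.X (n - 1), g ≫ C.d (n - 1) n = f.1) :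
    Nonempty (H ≃+ CohomologyClass ((singleFunctor 𝒞 0).obj Z)
      (C.extend ComplexShape.embeddingUpNat) n) := by
  let i := C.extendXIso ComplexShape.embeddingUpNat (i := n) (i' := (n : ℤ)) rfl
  let j := C.extendXIso ComplexShape.embeddingUpNat (i := n + 1) (i' := (n : ℤ) + 1) rfl
  have hd : (C.extend ComplexShape.embeddingUpNat).d n ((n : ℤ) + 1) =
      i.hom ≫ C.d n (n + 1) ≫ j.inv := C.extend_d_eq _ _ _
  have hf (f : cocyclesHom Z C n) :
      (f.1 ≫ i.inv) ≫ (C.extend ComplexShape.embeddingUpNat).d n ((n : ℤ) + 1) = 0 := by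
    rw [hd, Category.assoc, i.inv_hom_id_assoc, reassoc_of% mem_cocyclesHom.1 f.2, zero_comp]
  let ψ : cocyclesHom Z C n →+ CohomologyClass ((singleFunctor 𝒞 0).obj Z)
      (C.extend ComplexShape.embeddingUpNat) n :=
    AddMonoidHom.mk' (fun f => CohomologyClass.mk
      (Cocycle.fromSingleMk (f.1 ≫ i.inv) (zero_add _) _ rfl (hf f))) (by
        intro f g
        rw [← CohomologyClass.mk_add, ← Cocycle.fromSingleMk_add]
        congr 2
        exact Preadditive.add_comp _ _ _ _ _ _)
  refine nonempty_addEquiv_of_surjective φ ψ hφ ?_ fun f => ?_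
  · intro x
    obtain ⟨x, rfl⟩ := x.mk_surjective
    obtain ⟨f, hf, rfl⟩ := Cocycle.fromSingleMk_surjective x n (zero_add _) (n + 1) rfl
    refine ⟨⟨f ≫ i.hom, ?_⟩, ?_⟩
    · rw [mem_cocyclesHom, ← cancel_mono j.inv, zero_comp, Category.assoc, Category.assoc, ← hd, hf]
    · refine congrArg CohomologyClass.mk ?_
      ext1
      simp
  · rw [hφ', ← extend_exists_comp_d_iff]
    refine Iff.symm ((CohomologyClass.mk_eq_zero_iff _).trans ?_)
    exact Cocycle.fromSingleMk_mem_coboundaries_iff _ _ _ _ _ _ (by simp)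

theorem AddCommGrpCat.exists_surjective_homology (S : ShortComplex AddCommGrpCat.{u}) :
    ∃ π : S.g.hom.ker →+ S.homology, Function.Surjective π ∧
      ∀ x, π x = 0 ↔ ∃ y, S.f y = x.1 := by
  refine ⟨S.abHomologyIso.symm.addCommGroupIsoToAddEquiv.toAddMonoidHom.comp
    (QuotientAddGroup.mk' S.abToCycles.range),
    S.abHomologyIso.symm.addCommGroupIsoToAddEquiv.surjective.comp
      (QuotientAddGroup.mk'_surjective _), fun x => ?_⟩
  rw [AddMonoidHom.comp_apply]
  refine (S.abHomologyIso.symm.addCommGroupIsoToAddEquiv.map_eq_zero_iff).trans ?_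
  refine (QuotientAddGroup.eq_zero_iff (N := S.abToCycles.range) _).trans ?_
  exact ⟨fun ⟨y, hy⟩ => ⟨y, congrArg Subtype.val hy⟩, fun ⟨y, hy⟩ => ⟨y, Subtype.ext hy⟩⟩

/-- The right derived functors of a functor represented by `Z` are the groups `Ext Z -`. -/
theorem nonempty_rightDerived_iso_ext [EnoughInjectives 𝒞] [HasExt.{u} 𝒞] (Z : 𝒞)
    (G : 𝒞 ⥤ AddCommGrpCat.{u}) [G.Additive] (r : ∀ X, (Z ⟶ X) ≃+ G.obj X)
    (hr : ∀ {X Y : 𝒞} (f : X ⟶ Y) (x : Z ⟶ X), r Y (x ≫ f) = G.map f (r X x)) (X : 𝒞) (p : ℕ) :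
    Nonempty ((G.rightDerived p).obj X ≅ AddCommGrpCat.of (Ext.{u} Z X p)) := by
  let R := injectiveResolution X
  let C : CochainComplex AddCommGrpCat.{u} ℕ := (G.mapHomologicalComplex _).obj R.cocomplex
  -- Both sides are the cohomology of `Hom(Z, R)` for the injective resolution `R`; they are
  -- compared as quotients of the group of cocycles. For `p = 0` the truncated `p - 1` is again the
  -- conventional predecessor, with zero differential.
  obtain ⟨π, hπ, hπ'⟩ := AddCommGrpCat.exists_surjective_homology (C.sc' (p - 1) p (p + 1))
  let θ : cocyclesHom Z R.cocomplex p →+ (C.sc' (p - 1) p (p + 1)).g.hom.ker :=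
    ((r _).toAddMonoidHom.comp (cocyclesHom Z R.cocomplex p).subtype).codRestrict _ (by
      intro f
      refine (hr (R.cocomplex.d p (p + 1)) f.1).symm.trans ?_
      rw [mem_cocyclesHom.1 f.2, map_zero]
      rfl)
  have hθ : Function.Surjective θ := by
    intro x
    refine ⟨⟨(r _).symm x.1, ?_⟩, Subtype.ext ((r _).apply_symm_apply _)⟩
    rw [mem_cocyclesHom]
    apply (r _).injective
    rw [hr, map_zero]
    exact (congrArg (G.map (R.cocomplex.d p (p + 1))) ((r _).apply_symm_apply x.1)).trans x.2
  obtain ⟨e⟩ := nonempty_addEquiv_cohomologyClass Z R.cocomplex p (π.comp θ) (hπ.comp hθ) (by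
    intro f
    refine (hπ' _).trans ⟨?_, ?_⟩
    · rintro ⟨y, hy⟩
      refine ⟨(r _).symm y, (r _).injective ?_⟩
      rw [hr]
      exact (congrArg (G.map (R.cocomplex.d (p - 1) p)) ((r _).apply_symm_apply y)).trans hy
    · rintro ⟨g, hg⟩
      exact ⟨r _ g, (hr _ _).symm.trans (congrArg (r _) hg)⟩)
  exact ⟨R.isoRightDerivedObj G p ≪≫ ShortComplex.homologyMapIso (C.isoSc' (p - 1) p (p + 1)
    (by cases p <;> simp) (by simp)) ≪≫ (e.trans
      (R.extAddEquivCohomologyClass (X := Z) (n := p)).symm).toAddCommGrpIso⟩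

/-- The isomorphism of `Ext`-groups induced by an isomorphism of the second arguments. -/
def extCongrRight [HasExt.{u} 𝒞] (Z : 𝒞) {W W' : 𝒞} (i : W ≅ W') (p : ℕ) :
    AddCommGrpCat.of (Ext.{u} Z W p) ≅ AddCommGrpCat.of (Ext.{u} Z W' p) :=
  AddEquiv.toAddCommGrpIso
    { toFun := fun x => x.comp (Ext.mk₀ i.hom) (add_zero _)
      invFun := fun x => x.comp (Ext.mk₀ i.inv) (add_zero _)
      left_inv := fun x => by simp
      right_inv := fun x => by simp
      map_add' := fun x y => by simp }

/-- The spectral sequence of a complex with acyclic terms. -/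
theorem exists_spectralSequence_of_extAcyclic [EnoughInjectives 𝒞] [HasExt.{u} 𝒞] (Z : 𝒞)
    (C : CochainComplex 𝒞 ℕ) (hC : ∀ n, ExtAcyclic Z (C.X n)) (H : ℕ → AddCommGrpCat.{u})
    (φ : ∀ n, cocyclesHom Z C n →+ H n) (hφ : ∀ n, Function.Surjective (φ n))
    (hφ' : ∀ n f, φ n f = 0 ↔ ∃ g : Z ⟶ C.X (n - 1), g ≫ C.d (n - 1) n = f.1) :
    ∃ E : E₂CohomologicalSpectralSequenceNat AddCommGrpCat.{u},
      (∀ (hr : (2 : ℤ) ≤ 2) (p q : ℕ), Nonempty ((E.page 2 hr).X (p, q) ≅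
        AddCommGrpCat.of (Ext.{u} Z (C.homology q) p))) ∧ ConvergesTo E H := by
  let := HasDerivedCategory.standard 𝒞
  let K := C.extend ComplexShape.embeddingUpNat
  obtain ⟨E, h₁, h₂⟩ := exists_hyperext_spectralSequence Z K
  refine ⟨E, fun hr p q => ?_, h₂ H fun n => ?_⟩
  · obtain ⟨e⟩ := h₁ hr p q
    let i : K.homology q ≅ C.homology q :=
      C.extendHomologyIso ComplexShape.embeddingUpNat (j := q) (j' := q) rfl
    exact ⟨e ≪≫ extCongrRight Z i p⟩
  · have hK (n : ℤ) : ExtAcyclic Z (K.X n) := by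
      by_cases hn : 0 ≤ n
      · obtain ⟨k, rfl⟩ := Int.eq_ofNat_of_zero_le hn
        exact (hC k).of_iso (C.extendXIso ComplexShape.embeddingUpNat rfl).symm
      · exact .of_isZero (CochainComplex.isZero_of_isStrictlyGE K 0 n (by lia))
    obtain ⟨e₁⟩ := nonempty_homAddEquiv_cohomologyClass Z K hK n
    obtain ⟨e₂⟩ := nonempty_addEquiv_cohomologyClass Z C n (φ n) (hφ n) (hφ' n)
    exact ⟨e₂.trans e₁.symm⟩

end NatComplexes

/-! ### Derived limits as `Ext` groups, and systems without higher derived limits. -/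

section InverseSystems

open Abelian

/-- Evaluation functors commute with homology, and a functor is zero when all its values are. -/
theorem exact_of_exact_eval {J : Type*} [Category J] {𝒞 : Type*} [Category 𝒞] [Abelian 𝒞]
    {S : ShortComplex (J ⥤ 𝒞)}
    (h : ∀ j, (S.map ((evaluation J 𝒞).obj j)).Exact) : S.Exact := by
  rw [ShortComplex.exact_iff_isZero_homology, Functor.isZero_iff]
  intro j
  exact ((ShortComplex.exact_iff_isZero_homology _).1 (h j)).of_iso
    (S.mapHomologyIso ((evaluation J 𝒞).obj j)).symm

theorem exact_of_exact_app {J : Type*} [Category J] {S : ShortComplex (J ⥤ AddCommGrpCat.{u})}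
    (h : ∀ j (x : S.X₂.obj j), S.g.app j x = 0 → ∃ y, S.f.app j y = x) : S.Exact :=
  exact_of_exact_eval fun j => (ShortComplex.ab_exact_iff _).2 (h j)

theorem natTrans_epi_of_surjective {J : Type*} [Category J] {F G : J ⥤ AddCommGrpCat.{u}}
    (f : F ⟶ G) (h : ∀ j, Function.Surjective (f.app j)) : Epi f :=
  have := fun j => (AddCommGrpCat.epi_iff_surjective (f.app j)).2 (h j)
  NatTrans.epi_of_epi_app f

theorem natTrans_mono_of_injective {J : Type*} [Category J] {F G : J ⥤ AddCommGrpCat.{u}}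
    (f : F ⟶ G) (h : ∀ j, Function.Injective (f.app j)) : Mono f :=
  have := fun j => (AddCommGrpCat.mono_iff_injective (f.app j)).2 (h j)
  NatTrans.mono_of_mono_app f

/-- The embedding of an object into an injective object, with its cokernel. -/
def injectiveEmbedding {𝒞 : Type*} [Category 𝒞] [Abelian 𝒞] [EnoughInjectives 𝒞] (W : 𝒞) :
    ShortComplex 𝒞 :=
  ShortComplex.mk (Injective.ι W) (cokernel.π (Injective.ι W)) (by simp)

theorem injectiveEmbedding_shortExact {𝒞 : Type*} [Category 𝒞] [Abelian 𝒞] [EnoughInjectives 𝒞]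
    (W : 𝒞) : (injectiveEmbedding W).ShortExact where
  exact := ShortComplex.exact_cokernel _
  mono_f := inferInstanceAs (Mono (Injective.ι W))
  epi_g := inferInstanceAs (Epi (cokernel.π (Injective.ι W)))

variable (I : Type u) [Preorder I]

/-- The constant inverse system with value `ℤ`. -/
def constInt : Iᵒᵖ ⥤ AddCommGrpCat.{u} :=
  (Functor.const Iᵒᵖ).obj (AddCommGrpCat.of (ULift.{u} ℤ))

variable {I}

/-- The morphism from the constant system `ℤ` given by a compatible family. -/
def constIntHom (X : Iᵒᵖ ⥤ AddCommGrpCat.{u}) (x : ∀ i, X.obj i)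
    (hx : ∀ (i j : Iᵒᵖ) (h : i ⟶ j), X.map h (x i) = x j) : constInt I ⟶ X where
  app i := AddCommGrpCat.ofHom
    ((zmultiplesHom (X.obj i) (x i)).comp (AddEquiv.ulift (α := ℤ)).toAddMonoidHom)
  naturality i j h := by
    refine AddCommGrpCat.hom_ext (AddMonoidHom.ext fun n => ?_)
    change n.down • x j = X.map h (n.down • x i)
    rw [map_zsmul, hx]

theorem constIntHom_app_one (X : Iᵒᵖ ⥤ AddCommGrpCat.{u}) (x : ∀ i, X.obj i)
    (hx : ∀ (i j : Iᵒᵖ) (h : i ⟶ j), X.map h (x i) = x j) (i : Iᵒᵖ) :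
    (constIntHom X x hx).app i (ULift.up (1 : ℤ) : ULift.{u} ℤ) = x i :=
  one_zsmul (x i)

theorem addCommGrp_hom_ext_one {G : AddCommGrpCat.{u}}
    {f g : AddCommGrpCat.of (ULift.{u} ℤ) ⟶ G}
    (h : f (ULift.up (1 : ℤ) : ULift.{u} ℤ) = g (ULift.up (1 : ℤ) : ULift.{u} ℤ)) : f = g := by
  refine AddCommGrpCat.hom_ext (AddMonoidHom.ext fun n => ?_)
  have hn : n = n.down • (ULift.up (1 : ℤ) : ULift.{u} ℤ) := by
    apply ULift.ext
    simp
  rw [hn, map_zsmul, map_zsmul]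
  exact congrArg (n.down • ·) h

theorem constInt_hom_ext {X : Iᵒᵖ ⥤ AddCommGrpCat.{u}} {f g : constInt I ⟶ X}
    (h : ∀ i, f.app i (ULift.up (1 : ℤ) : ULift.{u} ℤ) =
      g.app i (ULift.up (1 : ℤ) : ULift.{u} ℤ)) : f = g :=
  NatTrans.ext (funext fun i => addCommGrp_hom_ext_one (h i))

theorem constInt_hom_compat {X : Iᵒᵖ ⥤ AddCommGrpCat.{u}} (f : constInt I ⟶ X) {i j : Iᵒᵖ}
    (h : i ⟶ j) : X.map h (f.app i (ULift.up (1 : ℤ) : ULift.{u} ℤ)) =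
      f.app j (ULift.up (1 : ℤ) : ULift.{u} ℤ) :=
  (ConcreteCategory.congr_hom (f.naturality h) (ULift.up (1 : ℤ) : ULift.{u} ℤ)).symm

/-- Morphisms from the constant system `ℤ` are the elements of the inverse limit. -/
def constIntHomEquiv (X : Iᵒᵖ ⥤ AddCommGrpCat.{u}) :
    (constInt I ⟶ X) ≃+ (lim : (Iᵒᵖ ⥤ AddCommGrpCat.{u}) ⥤ _).obj X :=
  AddEquiv.ofBijective
    (AddMonoidHom.mk' (fun f => constLimAdj.homEquiv (AddCommGrpCat.of (ULift.{u} ℤ)) X f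
      (ULift.up (1 : ℤ) : ULift.{u} ℤ)) fun f g => by
        have h : constLimAdj.homEquiv (AddCommGrpCat.of (ULift.{u} ℤ)) X (f + g) =
            constLimAdj.homEquiv (AddCommGrpCat.of (ULift.{u} ℤ)) X f +
              constLimAdj.homEquiv (AddCommGrpCat.of (ULift.{u} ℤ)) X g := by
          rw [Adjunction.homEquiv_unit, Adjunction.homEquiv_unit, Adjunction.homEquiv_unit,
            ← Preadditive.comp_add]
          exact congrArg _ (Functor.map_add _)
        exact ConcreteCategory.congr_hom h _) (by
    constructor
    · intro f g h
      exact (constLimAdj.homEquiv (AddCommGrpCat.of (ULift.{u} ℤ)) X).injective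
        (addCommGrp_hom_ext_one h)
    · intro y
      obtain ⟨f, hf⟩ := (constLimAdj.homEquiv (AddCommGrpCat.of (ULift.{u} ℤ)) X).surjective
        (AddCommGrpCat.ofHom ((zmultiplesHom _ y).comp (AddEquiv.ulift (α := ℤ)).toAddMonoidHom))
      refine ⟨f, ?_⟩
      refine (ConcreteCategory.congr_hom hf (ULift.up (1 : ℤ) : ULift.{u} ℤ)).trans ?_
      exact one_zsmul y)

/-- The limit is represented by the constant system `ℤ`, so its derived functors are `Ext` groups
and the hyperext spectral sequence applies to them. -/
theorem nonempty_derivedLim_iso_ext (F : Iᵒᵖ ⥤ AddCommGrpCat.{u}) (p : ℕ) :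
    Nonempty (derivedLim p F ≅ AddCommGrpCat.of (Ext.{u} (constInt I) F p)) :=
  nonempty_rightDerived_iso_ext (constInt I) lim constIntHomEquiv (fun f x =>
    ConcreteCategory.congr_hom (constLimAdj.homEquiv_naturality_right
      (X := AddCommGrpCat.of (ULift.{u} ℤ)) x f) (ULift.up (1 : ℤ) : ULift.{u} ℤ)) F p

/-- For a family `W` of abelian groups and a map `a` from its index type to `I`, the inverse
system `β ↦ ∏ W x`, where the product is over all `x` with `a x ≤ β`. -/
def belowProduct {X : Type u} (a : X → I) (W : X → AddCommGrpCat.{u}) :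
    Iᵒᵖ ⥤ AddCommGrpCat.{u} where
  obj β := AddCommGrpCat.of (∀ x : {x // a x ≤ β.unop}, W x.1)
  map {β α} h := AddCommGrpCat.ofHom
    { toFun := fun w x => w ⟨x.1, x.2.trans (leOfHom h.unop)⟩
      map_zero' := rfl
      map_add' := fun _ _ => rfl }

namespace belowProduct

variable {X : Type u} (a : X → I)

/-- The functoriality of `belowProduct`. -/
def map {W W' : X → AddCommGrpCat.{u}} (f : ∀ x, W x ⟶ W' x) :
    belowProduct a W ⟶ belowProduct a W' where
  app β := AddCommGrpCat.ofHom
    { toFun := fun w x => f x.1 (w x)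
      map_zero' := funext fun x => map_zero (f x.1).hom
      map_add' := fun w w' => funext fun x => map_add (f x.1).hom (w x) (w' x) }

/-- The projection to a component. -/
def eval (W : X → AddCommGrpCat.{u}) (x : X) :
    (belowProduct a W).obj (.op (a x)) ⟶ W x :=
  AddCommGrpCat.ofHom
    { toFun := fun w => w ⟨x, le_rfl⟩
      map_zero' := rfl
      map_add' := fun _ _ => rfl }

/-- A morphism from `G` to the product system amounts to a family of maps from `G` at the level `a
x` to `J x`. Monomorphisms of systems are levelwise, so each member of the family extends
separately. -/
instance (J : X → AddCommGrpCat.{u}) [∀ x, Injective (J x)] : Injective (belowProduct a J) where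
  factors {G G'} h m hm := by
    have : ∀ j, Mono (m.app j) := fun j => inferInstance
    let e : ∀ x, G'.obj (.op (a x)) ⟶ J x := fun x =>
      Injective.factorThru (h.app (.op (a x)) ≫ eval a J x) (m.app (.op (a x)))
    have he : ∀ x, m.app (.op (a x)) ≫ e x = h.app (.op (a x)) ≫ eval a J x := fun x =>
      Injective.comp_factorThru _ _
    refine ⟨{ app := fun β => AddCommGrpCat.ofHom
                { toFun := fun g x => e x.1 (G'.map (homOfLE x.2).op g)
                  map_zero' := ?_
                  map_add' := ?_ }
              naturality := ?_ }, ?_⟩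
    · funext x
      rw [map_zero, map_zero]; rfl
    · intro g g'
      funext x
      rw [map_add, map_add]; rfl
    · intro β α i
      refine AddCommGrpCat.hom_ext (AddMonoidHom.ext fun g => funext fun x => ?_)
      refine congrArg (e x.1) ?_
      exact (ConcreteCategory.congr_hom (G'.map_comp i (homOfLE x.2).op) g).symm
    · refine NatTrans.ext (funext fun β => ?_)
      refine AddCommGrpCat.hom_ext (AddMonoidHom.ext fun g => funext fun x => ?_)
      change e x.1 (G'.map (homOfLE x.2).op (m.app β g)) = (h.app β g : ∀ x : {x // a x ≤ β.unop}, J x.1) x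
      have h1 := ConcreteCategory.congr_hom (m.naturality (Y := .op (a x.1)) (homOfLE x.2).op) g
      have h2 := ConcreteCategory.congr_hom (he x.1) (G.map (homOfLE x.2).op g)
      have h3 := ConcreteCategory.congr_hom (h.naturality (Y := .op (a x.1)) (homOfLE x.2).op) g
      refine (congrArg (e x.1) h1.symm).trans (h2.trans ?_)
      exact congrFun h3 (⟨x.1, le_rfl⟩ : {y // a y ≤ a x.1})

theorem shortExact {W : X → ShortComplex AddCommGrpCat.{u}} (hW : ∀ x, (W x).ShortExact) :
    (ShortComplex.mk (map a fun x => (W x).f) (map a fun x => (W x).g) (by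
      refine NatTrans.ext (funext fun β => ?_)
      refine AddCommGrpCat.hom_ext (AddMonoidHom.ext fun g => funext fun x => ?_)
      exact ConcreteCategory.congr_hom (W x.1).zero _)).ShortExact where
  exact := exact_of_exact_app fun β (w : ∀ x : {x // a x ≤ β.unop}, (W x.1).X₂) hw => by
    have h : ∀ x : {x // a x ≤ β.unop}, ∃ y, (W x.1).f y = w x := fun x =>
      (ShortComplex.ab_exact_iff _).1 (hW x.1).exact _ (congrFun hw x)
    choose y hy using h
    exact ⟨y, funext hy⟩
  mono_f := natTrans_mono_of_injective _ fun β w w' h => funext fun x => by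
    have := (hW x.1).mono_f
    exact (AddCommGrpCat.mono_iff_injective _).1 this (congrFun h x)
  epi_g := natTrans_epi_of_surjective _ fun β
      (w : ∀ x : {x // a x ≤ β.unop}, (W x.1).X₃) => by
    have h : ∀ x : {x // a x ≤ β.unop}, ∃ y, (W x.1).g y = w x := fun x => by
      have := (hW x.1).epi_g
      exact (AddCommGrpCat.epi_iff_surjective _).1 this _
    choose y hy using h
    exact ⟨y, funext hy⟩

/-- Dimension shifting: embed each `W x` in an injective group. The resulting short exact sequence
of product systems has an injective middle term and a quotient of the same form, so only the first
`Ext` group needs an argument: limits of the product systems are full products, and these preserve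
surjections. -/
theorem extAcyclic (W : X → AddCommGrpCat.{u}) : ExtAcyclic (constInt I) (belowProduct a W) := by
  intro p
  induction p generalizing W with
  | zero =>
    intro e
    let T : X → ShortComplex AddCommGrpCat.{u} := fun x => injectiveEmbedding (W x)
    have hT : ∀ x, (T x).ShortExact := fun x => injectiveEmbedding_shortExact (W x)
    have : ∀ x, Injective (T x).X₂ := fun x => inferInstanceAs (Injective (Injective.under (W x)))
    obtain ⟨e', rfl⟩ := Ext.covariant_sequence_exact₁ (constInt I) (shortExact a hT) e
      (Ext.eq_zero_of_injective (I := belowProduct a fun x => (T x).X₂) _) rfl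
    obtain ⟨f, rfl⟩ := (Ext.mk₀_bijective _ _).2 e'
    have h : ∀ x, ∃ y : (T x).X₂, (T x).g y =
        eval a (fun x => (T x).X₃) x (f.app _ (ULift.up (1 : ℤ) : ULift.{u} ℤ)) := fun x => by
      have := (hT x).epi_g
      exact (AddCommGrpCat.epi_iff_surjective _).1 this _
    -- A compatible family in the quotient system is determined by its `x`-component at the level `a
    -- x`, so one lift `y x` for each `x` serves all levels. Hence `f` lifts and its connecting
    -- class vanishes.
    choose y hy using h
    let g : constInt I ⟶ belowProduct a fun x => (T x).X₂ :=
      constIntHom (belowProduct a fun x => (T x).X₂) (fun β x => y x.1) fun _ _ _ => rfl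
    have hg : f = g ≫ map a fun x => (T x).g := by
      refine constInt_hom_ext fun β => funext fun x => ?_
      have h1 := constInt_hom_compat f (i := β) (j := .op (a x.1)) (homOfLE x.2).op
      have h2 := congrFun h1 (⟨x.1, le_rfl⟩ : {y // a y ≤ a x.1})
      refine h2.trans ((hy x.1).symm.trans ?_)
      have h3 := constIntHom_app_one (belowProduct a fun x => (T x).X₂) (fun β x => y x.1)
        (fun _ _ _ => rfl) β
      exact congrArg (T x.1).g (congrFun h3 x).symm
    rw [hg, ← Ext.mk₀_comp_mk₀]
    rw [Ext.comp_assoc_of_second_deg_zero]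
    rw [(shortExact a hT).comp_extClass, Ext.comp_zero]
    rfl
  | succ p ih =>
    intro e
    let T : X → ShortComplex AddCommGrpCat.{u} := fun x => injectiveEmbedding (W x)
    have hT : ∀ x, (T x).ShortExact := fun x => injectiveEmbedding_shortExact (W x)
    have : ∀ x, Injective (T x).X₂ := fun x => inferInstanceAs (Injective (Injective.under (W x)))
    obtain ⟨e', rfl⟩ := Ext.covariant_sequence_exact₁ (constInt I) (shortExact a hT) e
      (Ext.eq_zero_of_injective (I := belowProduct a fun x => (T x).X₂) _) rfl
    rw [ih (fun x => (T x).X₃) e', Ext.zero_comp]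
    rfl

end belowProduct

end InverseSystems

/-! ### `Ext` groups from iterated syzygies. -/

section Syzygies

open Abelian

/-- A sequence of short exact sequences `0 ⟶ syz (n + 1) ⟶ cover n ⟶ syz n ⟶ 0`. -/
structure SyzygySequence (𝒞 : Type*) [Category 𝒞] [Abelian 𝒞] where
  syz : ℕ → 𝒞
  cover : ℕ → 𝒞
  incl : ∀ n, syz (n + 1) ⟶ cover n
  proj : ∀ n, cover n ⟶ syz n
  incl_proj : ∀ n, incl n ≫ proj n = 0
  shortExact : ∀ n, (ShortComplex.mk (incl n) (proj n) (incl_proj n)).ShortExact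

namespace SyzygySequence

variable {𝒞 : Type*} [Category 𝒞] [Abelian 𝒞] [HasExt.{u} 𝒞] (T : SyzygySequence 𝒞)

/-- The class of the short exact sequence `0 ⟶ syz (n + 1) ⟶ cover n ⟶ syz n ⟶ 0`. -/
def stepClass (n : ℕ) : Ext.{u} (T.syz n) (T.syz (n + 1)) 1 := (T.shortExact n).extClass

/-- The Yoneda product of the classes of the short exact sequences. -/
def yonedaClass : (n : ℕ) → Ext.{u} (T.syz 0) (T.syz n) n
  | 0 => Ext.mk₀ (𝟙 _)
  | n + 1 => (yonedaClass n).comp (T.stepClass n) rfl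

theorem yonedaClass_succ_comp {Y : 𝒞} (n m k l : ℕ) (h : n + 1 + m = k) (hl : 1 + m = l)
    (e : Ext.{u} (T.syz (n + 1)) Y m) : (T.yonedaClass (n + 1)).comp e h =
      (T.yonedaClass n).comp ((T.stepClass n).comp e hl) (by lia) :=
  Ext.comp_assoc (T.yonedaClass n) (T.stepClass n) e rfl hl (by lia)

/-- The homomorphism `Hom(syz n, Y) → Ext^n(syz 0, Y)`. -/
def toExt (n : ℕ) (Y : 𝒞) : (T.syz n ⟶ Y) →+ Ext.{u} (T.syz 0) Y n :=
  AddMonoidHom.mk' (fun f => (T.yonedaClass n).comp (Ext.mk₀ f) (add_zero n)) fun f g => by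
    rw [Ext.mk₀_add, Ext.comp_add]

theorem toExt_apply (n : ℕ) {Y : 𝒞} (f : T.syz n ⟶ Y) :
    T.toExt n Y f = (T.yonedaClass n).comp (Ext.mk₀ f) (add_zero n) := rfl

theorem toExt_zero_injective (Y : 𝒞) : Function.Injective (T.toExt 0 Y) := fun f g h => by
  rw [toExt_apply, toExt_apply] at h
  refine (Ext.mk₀_bijective _ _).1 ?_
  exact (Ext.mk₀_id_comp _).symm.trans (h.trans (Ext.mk₀_id_comp _))

theorem exists_mk₀_incl_comp {Y : 𝒞} (n m k : ℕ) (h : 1 + m = k)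
    (e : Ext.{u} (T.syz (n + 1)) Y m) (he : (T.stepClass n).comp e h = 0) :
    ∃ x : Ext.{u} (T.cover n) Y m, (Ext.mk₀ (T.incl n)).comp x (zero_add m) = e :=
  Ext.contravariant_sequence_exact₁ (T.shortExact n) Y e h he

theorem stepClass_comp_mk₀_incl {Y : 𝒞} (n : ℕ) (g : T.cover n ⟶ Y) :
    (T.stepClass n).comp (Ext.mk₀ (T.incl n ≫ g)) (add_zero 1) = 0 := by
  rw [← Ext.mk₀_comp_mk₀]
  exact (T.shortExact n).extClass_comp_assoc (Ext.mk₀ g)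

variable [∀ n, Projective (T.cover n)]

/-- The kernel of the connecting map comes from an `Ext` group of the projective cover, which is
zero in positive degree. -/
theorem eq_zero_of_stepClass_comp {Y : 𝒞} (n m k : ℕ) (h : 1 + (m + 1) = k)
    (e : Ext.{u} (T.syz (n + 1)) Y (m + 1)) (he : (T.stepClass n).comp e h = 0) : e = 0 := by
  obtain ⟨x, rfl⟩ := T.exists_mk₀_incl_comp n _ k h e he
  rw [Ext.eq_zero_of_projective x, Ext.comp_zero]

theorem exists_stepClass_comp {Y : 𝒞} (n m k : ℕ) (h : 1 + m = k) (e : Ext.{u} (T.syz n) Y k) :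
    ∃ x : Ext.{u} (T.syz (n + 1)) Y m, (T.stepClass n).comp x h = e := by
  obtain rfl : k = m + 1 := by lia
  exact Ext.contravariant_sequence_exact₃ (T.shortExact n) Y e
    (Ext.eq_zero_of_projective (P := T.cover n) _) h

theorem comp_yonedaClass_injective {Y : 𝒞} (n m k : ℕ) (h : n + (m + 1) = k)
    (e : Ext.{u} (T.syz n) Y (m + 1)) (he : (T.yonedaClass n).comp e h = 0) : e = 0 := by
  induction n generalizing m k with
  | zero =>
    obtain rfl : m + 1 = k := by lia
    exact (Ext.mk₀_id_comp e).symm.trans he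
  | succ n ih =>
    rw [T.yonedaClass_succ_comp n _ _ (m + 1 + 1) _ (by lia)] at he
    exact T.eq_zero_of_stepClass_comp n m _ _ e (ih _ _ _ _ he)

/-- Positive degree classes on `syz n` vanish on the projective `cover n`, hence factor through
`stepClass n`; this is iterated `n` times. -/
theorem comp_yonedaClass_surjective {Y : 𝒞} (n m k : ℕ) (h : n + m = k)
    (e : Ext.{u} (T.syz 0) Y k) :
    ∃ e' : Ext.{u} (T.syz n) Y m, (T.yonedaClass n).comp e' h = e := by
  induction n generalizing m k with
  | zero =>
    obtain rfl : m = k := by lia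
    exact ⟨e, Ext.mk₀_id_comp e⟩
  | succ n ih =>
    obtain ⟨x, hx⟩ := ih (m + 1) k (by lia) e
    obtain ⟨y, rfl⟩ := T.exists_stepClass_comp n m (m + 1) (add_comm 1 m) x
    exact ⟨y, (T.yonedaClass_succ_comp n _ _ (m + 1) _ (by lia) y).trans hx⟩

theorem toExt_surjective (n : ℕ) (Y : 𝒞) : Function.Surjective (T.toExt n Y) := fun e => by
  obtain ⟨e', he'⟩ := T.comp_yonedaClass_surjective n 0 n (add_zero n) e
  obtain ⟨f, rfl⟩ := (Ext.mk₀_bijective _ _).2 e'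
  exact ⟨f, he'⟩

/-- Multiplication by `yonedaClass n` is injective on `Ext^1(syz n, Y)`, so only the last connecting
map matters, and it kills exactly the maps that extend to `cover n`. -/
theorem toExt_succ_eq_zero_iff (n : ℕ) {Y : 𝒞} (f : T.syz (n + 1) ⟶ Y) :
    T.toExt (n + 1) Y f = 0 ↔ ∃ g : T.cover n ⟶ Y, T.incl n ≫ g = f := by
  rw [toExt_apply, T.yonedaClass_succ_comp n 0 (n + 1) 1 rfl rfl]
  constructor
  · intro h0
    obtain ⟨x, hx⟩ := T.exists_mk₀_incl_comp n 0 1 rfl (Ext.mk₀ f)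
      (T.comp_yonedaClass_injective n 0 (n + 1) rfl _ h0)
    obtain ⟨g, rfl⟩ := (Ext.mk₀_bijective _ _).2 x
    rw [Ext.mk₀_comp_mk₀] at hx
    exact ⟨g, (Ext.mk₀_bijective _ _).1 hx⟩
  · rintro ⟨g, rfl⟩
    rw [T.stepClass_comp_mk₀_incl, Ext.comp_zero]

end SyzygySequence

/-- Each `stepClass` is natural for exact functors and for morphisms of short exact sequences; the
squares are multiplied together. It is used for restriction of scalars between levels. -/
theorem SyzygySequence.yonedaClass_naturality {𝒞 𝒟 : Type*} [Category 𝒞] [Abelian 𝒞]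
    [HasExt.{u} 𝒞] [Category 𝒟] [Abelian 𝒟] [HasExt.{u} 𝒟] (F : 𝒞 ⥤ 𝒟) [F.Additive]
    [PreservesFiniteLimits F] [PreservesFiniteColimits F] (T : SyzygySequence 𝒞)
    (T' : SyzygySequence 𝒟) (τ : ∀ n, T'.syz n ⟶ F.obj (T.syz n))
    (σ : ∀ n, T'.cover n ⟶ F.obj (T.cover n))
    (hi : ∀ n, T'.incl n ≫ σ n = τ (n + 1) ≫ F.map (T.incl n))
    (hp : ∀ n, T'.proj n ≫ τ n = σ n ≫ F.map (T.proj n)) (n : ℕ) :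
    (T'.yonedaClass n).comp (Ext.mk₀ (τ n)) (add_zero n) =
      (Ext.mk₀ (τ 0)).comp ((T.yonedaClass n).mapExactFunctor F) (zero_add n) := by
  induction n with
  | zero =>
    have h0 : T.yonedaClass 0 = Ext.mk₀ (𝟙 _) := rfl
    have h0' : T'.yonedaClass 0 = Ext.mk₀ (𝟙 _) := rfl
    rw [h0, h0', Ext.mapExactFunctor_mk₀, Ext.mk₀_comp_mk₀, Ext.mk₀_comp_mk₀, CategoryTheory.Functor.map_id,
      Category.id_comp, Category.comp_id]
  | succ n ih =>
    have h : (T'.stepClass n).comp (Ext.mk₀ (τ (n + 1))) (add_zero 1) =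
        (Ext.mk₀ (τ n)).comp ((T.stepClass n).mapExactFunctor F) (zero_add 1) := by
      refine ((T'.shortExact n).extClass_naturality ((T.shortExact n).map_of_exact F)
        { τ₁ := τ (n + 1), τ₂ := σ n, τ₃ := τ n,
          comm₁₂ := (hi n).symm, comm₂₃ := (hp n).symm }).trans ?_
      exact congrArg (fun z => Ext.comp (Ext.mk₀ (τ n)) z (zero_add 1))
        (Ext.mapExactFunctor_extClass F (T.shortExact n)).symm
    have h1 : T.yonedaClass (n + 1) = (T.yonedaClass n).comp (T.stepClass n) rfl := rfl
    rw [T'.yonedaClass_succ_comp n 0 (n + 1) 1 rfl rfl, h, h1, Ext.mapExactFunctor_comp,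
      ← Ext.comp_assoc_of_second_deg_zero, ih,
      Ext.comp_assoc _ _ _ (zero_add n) (rfl : n + 1 = n + 1) (by lia)]

theorem SyzygySequence.toExt_naturality {𝒞 𝒟 : Type*} [Category 𝒞] [Abelian 𝒞]
    [HasExt.{u} 𝒞] [Category 𝒟] [Abelian 𝒟] [HasExt.{u} 𝒟] (F : 𝒞 ⥤ 𝒟) [F.Additive]
    [PreservesFiniteLimits F] [PreservesFiniteColimits F] (T : SyzygySequence 𝒞)
    (T' : SyzygySequence 𝒟) (τ : ∀ n, T'.syz n ⟶ F.obj (T.syz n))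
    (σ : ∀ n, T'.cover n ⟶ F.obj (T.cover n))
    (hi : ∀ n, T'.incl n ≫ σ n = τ (n + 1) ≫ F.map (T.incl n))
    (hp : ∀ n, T'.proj n ≫ τ n = σ n ≫ F.map (T.proj n)) (n : ℕ) {Y : 𝒞} {Y' : 𝒟}
    (f : T.syz n ⟶ Y) (g : F.obj Y ⟶ Y') :
    T'.toExt n Y' (τ n ≫ F.map f ≫ g) = (Ext.mk₀ (τ 0)).comp
      (((T.toExt n Y f).mapExactFunctor F).comp (Ext.mk₀ g) (add_zero n)) (zero_add n) := by
  rw [T'.toExt_apply, T.toExt_apply, Ext.mapExactFunctor_comp, Ext.mapExactFunctor_mk₀,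
    ← Ext.mk₀_comp_mk₀, ← Ext.mk₀_comp_mk₀, ← Ext.comp_assoc_of_third_deg_zero,
    ← Ext.comp_assoc_of_third_deg_zero, yonedaClass_naturality F T T' τ σ hi hp,
    ← Ext.comp_assoc_of_third_deg_zero, ← Ext.comp_assoc_of_third_deg_zero]

end Syzygies

/-! ### Bases of free graded modules, and exactness. -/

namespace GradedModuleCat

section Free

variable {k : Type*} [CommRing k] {R : Type u} [Ring R] [Algebra k R] (𝓡 : ℕ → Submodule k R)
  [GradedAlgebra 𝓡]

/-- The element of the basis of a free graded module. -/
def freeBasis {X : Type u} (d : X → ℤ) (x : X) : (free 𝓡 X d).carrier :=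
  (Finsupp.single x 1 : X →₀ R)

theorem freeBasis_mem {X : Type u} (d : X → ℤ) (x : X) :
    freeBasis 𝓡 d x ∈ (free 𝓡 X d).deg (d x) := by
  classical
  intro y
  change (Finsupp.single x 1 : X →₀ R) y ∈ _
  rw [Finsupp.single_apply]
  split_ifs with h
  · rw [h, sub_self]; exact mem_degZ 𝓡 (i := 0) SetLike.GradedOne.one_mem
  · exact zero_mem _

theorem free_induction {X : Type u} (d : X → ℤ) {p : (free 𝓡 X d).carrier → Prop} (h0 : p 0)
    (hadd : ∀ a b, p a → p b → p (a + b)) (hsmul : ∀ (r : R) x, p (r • freeBasis 𝓡 d x))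
    (a : (free 𝓡 X d).carrier) : p a := by
  refine Finsupp.induction_linear (motive := p) a h0 hadd fun x r => ?_
  have h := hsmul r x
  have : r • freeBasis 𝓡 d x = (Finsupp.single x r : X →₀ R) := by
    change r • (Finsupp.single x 1 : X →₀ R) = _
    simp
  exact this ▸ h

theorem lin_freeLift {X : Type u} {d : X → ℤ} {M : GradedModuleCat 𝓡} (v : X → M.carrier)
    (hv : ∀ x, v x ∈ M.deg (d x)) (x : X) :
    Hom.lin (freeLift 𝓡 X d M v hv) (freeBasis 𝓡 d x) = v x := by
  change Finsupp.linearCombination R v (Finsupp.single x 1) = v x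
  rw [Finsupp.linearCombination_single, one_smul]

theorem free_hom_ext {X : Type u} {d : X → ℤ} {M : GradedModuleCat 𝓡} {f g : free 𝓡 X d ⟶ M}
    (h : ∀ x, Hom.lin f (freeBasis 𝓡 d x) = Hom.lin g (freeBasis 𝓡 d x)) : f = g := by
  apply hom_ext
  apply LinearMap.ext
  intro a
  induction a using free_induction with
  | h0 => rw [map_zero, map_zero]
  | hadd a b ha hb => rw [map_add, map_add, ha, hb]
  | hsmul r x => rw [map_smul, map_smul, h]

/-- The coefficient at a basis element of a free graded module. -/
def freeCoeff {X : Type u} (d : X → ℤ) (x : X) : (free 𝓡 X d).carrier →+ R :=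
  Finsupp.applyAddHom x

theorem freeCoeff_smul {X : Type u} (d : X → ℤ) (x : X) (r : R) (a : (free 𝓡 X d).carrier) :
    freeCoeff 𝓡 d x (r • a) = r * freeCoeff 𝓡 d x a := rfl

theorem freeCoeff_basis {X : Type u} [DecidableEq X] (d : X → ℤ) (x y : X) :
    freeCoeff 𝓡 d x (freeBasis 𝓡 d y) = if y = x then 1 else 0 :=
  Finsupp.single_apply

theorem free_ext {X : Type u} {d : X → ℤ} {a b : (free 𝓡 X d).carrier}
    (h : ∀ x, freeCoeff 𝓡 d x a = freeCoeff 𝓡 d x b) : a = b :=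
  Finsupp.ext h

end Free

section Exactness

variable {k : Type*} [CommRing k] {R : Type u} [Ring R] [Algebra k R] {𝓡 : ℕ → Submodule k R}

theorem shortExact_ker {M N : GradedModuleCat 𝓡} (f : M ⟶ N)
    (hf : Function.Surjective (Hom.lin f)) :
    (ShortComplex.mk (kerι f) f (kerι_comp f)).ShortExact where
  exact := ShortComplex.exact_of_f_is_kernel _ (kerForkIsLimit f)
  mono_f := mono_of_isLimit_fork (kerForkIsLimit f)
  epi_g := epi_of_surjective f hf

theorem exists_comp_eq_of_surjective {M N P : GradedModuleCat 𝓡} (f : M ⟶ N)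
    (hf : Function.Surjective (Hom.lin f)) (g : M ⟶ P) (hg : kerι f ≫ g = 0) :
    ∃ h : N ⟶ P, f ≫ h = g := by
  have := (shortExact_ker f hf).epi_g
  exact ⟨(shortExact_ker f hf).exact.desc g hg, (shortExact_ker f hf).exact.g_desc g hg⟩

end Exactness

end GradedModuleCat

/-! ### Directed unions of modules over the enveloping algebras of the subalgebras. -/

section EnvSystems

open GradedModuleCat

variable {k : Type*} [Field k] {A : Type u} [Ring A] [Algebra k A] {𝒜 : ℕ → Submodule k A}

/-- Over a field all modules are flat, so a tensor product of injective maps is injective. This is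
what embeds the levels of a free system in their union. -/
theorem envMap_injective {B : Type u} [Ring B] [Algebra k B] (f : A →ₐ[k] B)
    (hf : Function.Injective f) : Function.Injective (envMap f) := by
  have h : Function.Injective (AlgHom.op f) := fun x y hxy =>
    MulOpposite.unop_injective (hf (MulOpposite.op_injective hxy))
  exact TensorProduct.map_injective_of_flat_flat f.toLinearMap (AlgHom.op f).toLinearMap hf h

variable [GradedAlgebra 𝒜]

namespace GradedSubalgebra

theorem inclusion_mem {S T : GradedSubalgebra 𝒜} (h : S.toSubalgebra ≤ T.toSubalgebra) (i : ℕ)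
    (a : S.toSubalgebra) (ha : a ∈ S.deg i) : Subalgebra.inclusion h a ∈ T.deg i := ha

/-- Restriction of scalars for graded subalgebras `S ≤ T` of `A`. -/
abbrev resLE {S T : GradedSubalgebra 𝒜} (h : S.toSubalgebra ≤ T.toSubalgebra) :
    GradedModuleCat (envDeg T.deg) ⥤ GradedModuleCat (envDeg S.deg) :=
  restrictEnv (Subalgebra.inclusion h) (inclusion_mem h)

/-- Restriction of scalars from `A` to a graded subalgebra, as a functor. -/
abbrev resFunctor (S : GradedSubalgebra 𝒜) :
    GradedModuleCat (envDeg 𝒜) ⥤ GradedModuleCat (envDeg S.deg) :=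
  restrictEnv S.toSubalgebra.val fun _ _ h => h

/-- Transitivity of restriction of scalars for graded subalgebras `S ≤ T` of `A`. -/
def resLEComp {S T : GradedSubalgebra 𝒜} (h : S.toSubalgebra ≤ T.toSubalgebra)
    (M : GradedModuleCat (envDeg 𝒜)) : (resLE h).obj (T.res M) ⟶ S.res M :=
  (restrictEnvComp (Subalgebra.inclusion h) (fun _ _ ha => ha) T.toSubalgebra.val
    (fun _ _ ha => ha) S.toSubalgebra.val (fun _ _ ha => ha) (fun _ => rfl)).app M

end GradedSubalgebra

open GradedSubalgebra

variable {I : Type u} [Preorder I] (S : I → GradedSubalgebra 𝒜)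
  (hS : ∀ α β, α ≤ β → (S α).toSubalgebra ≤ (S β).toSubalgebra)

/-- A graded `Aᵉ`-module `top` that is the directed union of graded modules `obj β` over the
enveloping algebras of the graded subalgebras `S β`. -/
structure EnvSystem where
  obj : ∀ β, GradedModuleCat (envDeg (S β).deg)
  top : GradedModuleCat (envDeg 𝒜)
  ι : ∀ β, obj β ⟶ (S β).resFunctor.obj top
  ι_injective : ∀ β, Function.Injective (Hom.lin (ι β))
  tr : ∀ {α β} (h : α ≤ β), obj α ⟶ (resLE (hS α β h)).obj (obj β)
  tr_ι : ∀ {α β} (h : α ≤ β),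
    tr h ≫ (resLE (hS α β h)).map (ι β) ≫ resLEComp (hS α β h) top = ι α
  exhaustive : ∀ y : top.carrier, ∃ β x, Hom.lin (ι β) x = y

namespace EnvSystem

variable {S hS}

theorem ι_tr_apply (N : EnvSystem S hS) {α β : I} (h : α ≤ β) (x : (N.obj α).carrier) :
    Hom.lin (N.ι β) (Hom.lin (N.tr h) x) = Hom.lin (N.ι α) x :=
  LinearMap.congr_fun (congrArg Hom.lin (N.tr_ι h)) x

/-- Functoriality of the transition maps is not part of the data: they are determined by the
injective maps to the union. -/
theorem tr_refl_apply (N : EnvSystem S hS) {α : I} (h : α ≤ α) (x : (N.obj α).carrier) :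
    Hom.lin (N.tr h) x = x :=
  N.ι_injective α (N.ι_tr_apply h x)

theorem tr_tr_apply (N : EnvSystem S hS) {α β γ : I} (h : α ≤ β) (h' : β ≤ γ)
    (h'' : α ≤ γ) (x : (N.obj α).carrier) :
    Hom.lin (N.tr h') (Hom.lin (N.tr h) x) = Hom.lin (N.tr h'') x :=
  N.ι_injective γ (((N.ι_tr_apply h' _).trans (N.ι_tr_apply h x)).trans (N.ι_tr_apply h'' x).symm)

/-- A morphism of systems. -/
structure Hom (N N' : EnvSystem S hS) where
  app : ∀ β, N.obj β ⟶ N'.obj β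
  top : N.top ⟶ N'.top
  comm : ∀ β, app β ≫ N'.ι β = N.ι β ≫ (S β).resFunctor.map top

theorem Hom.ι_app_apply {N N' : EnvSystem S hS} (f : Hom N N') (β : I) (x : (N.obj β).carrier) :
    GradedModuleCat.Hom.lin (N'.ι β) (GradedModuleCat.Hom.lin (f.app β) x) =
      GradedModuleCat.Hom.lin f.top (GradedModuleCat.Hom.lin (N.ι β) x) :=
  LinearMap.congr_fun (congrArg GradedModuleCat.Hom.lin (f.comm β)) x

/-- Compatibility with the transition maps is likewise automatic, since it may be tested in the
union. -/
theorem Hom.tr_app_apply {N N' : EnvSystem S hS} (f : Hom N N') {α β : I} (h : α ≤ β)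
    (x : (N.obj α).carrier) :
    GradedModuleCat.Hom.lin (N'.tr h) (GradedModuleCat.Hom.lin (f.app α) x) =
      GradedModuleCat.Hom.lin (f.app β) (GradedModuleCat.Hom.lin (N.tr h) x) := by
  apply N'.ι_injective β
  refine (N'.ι_tr_apply h _).trans ((f.ι_app_apply α x).trans ?_)
  refine Eq.trans ?_ (f.ι_app_apply β _).symm
  exact congrArg (GradedModuleCat.Hom.lin f.top) (N.ι_tr_apply h x).symm

theorem Hom.tr_comm {N N' : EnvSystem S hS} (f : Hom N N') {α β : I} (h : α ≤ β) :
    f.app α ≫ N'.tr h = N.tr h ≫ (resLE (hS α β h)).map (f.app β) :=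
  hom_ext (LinearMap.ext fun x => f.tr_app_apply h x)

/-- The levels of the target embed in its union, so an element of a level lies in the kernel on the
union only if it lies in the kernel at that level. Therefore kernels are again exhausted by their
levels. -/
theorem Hom.ι_mem_ker {N N' : EnvSystem S hS} (f : Hom N N') {β : I} {x : (N.obj β).carrier} :
    GradedModuleCat.Hom.lin f.top (GradedModuleCat.Hom.lin (N.ι β) x) = 0 ↔
      GradedModuleCat.Hom.lin (f.app β) x = 0 := by
  refine Iff.trans ?_ (map_eq_zero_iff _ (N'.ι_injective β))
  rw [f.ι_app_apply β x]
  rfl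

theorem Hom.tr_mem_ker {N N' : EnvSystem S hS} (f : Hom N N') {α β : I} (h : α ≤ β)
    {x : (N.obj α).carrier} (hx : GradedModuleCat.Hom.lin (f.app α) x = 0) :
    GradedModuleCat.Hom.lin (f.app β) (GradedModuleCat.Hom.lin (N.tr h) x) = 0 := by
  refine (f.tr_app_apply h x).symm.trans ?_
  rw [hx, map_zero]
  rfl

/-- The inclusions of the levels of the kernel of a morphism of systems. -/
def kernelι {N N' : EnvSystem S hS} (f : Hom N N') (β : I) :
    GradedModuleCat.ker (f.app β) ⟶ (S β).resFunctor.obj (GradedModuleCat.ker f.top) :=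
  ofLin (M := GradedModuleCat.ker (f.app β))
    (N := (S β).resFunctor.obj (GradedModuleCat.ker f.top))
    { toFun := fun x => ⟨GradedModuleCat.Hom.lin (N.ι β) x.1, f.ι_mem_ker.2 x.2⟩
      map_add' := fun x y => Subtype.ext (map_add (GradedModuleCat.Hom.lin (N.ι β)) x.1 y.1)
      map_smul' := fun r x => Subtype.ext (map_smul (GradedModuleCat.Hom.lin (N.ι β)) r x.1) }
    fun _ _ hm => Hom.lin_mem (N.ι β) hm

/-- The transition maps of the kernel of a morphism of systems. -/
def kernelTr {N N' : EnvSystem S hS} (f : Hom N N') {α β : I} (h : α ≤ β) :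
    GradedModuleCat.ker (f.app α) ⟶ (resLE (hS α β h)).obj (GradedModuleCat.ker (f.app β)) :=
  ofLin (M := GradedModuleCat.ker (f.app α))
    (N := (resLE (hS α β h)).obj (GradedModuleCat.ker (f.app β)))
    { toFun := fun x => ⟨GradedModuleCat.Hom.lin (N.tr h) x.1, f.tr_mem_ker h x.2⟩
      map_add' := fun x y => Subtype.ext (map_add (GradedModuleCat.Hom.lin (N.tr h)) x.1 y.1)
      map_smul' := fun r x => Subtype.ext (map_smul (GradedModuleCat.Hom.lin (N.tr h)) r x.1) }
    fun _ _ hm => Hom.lin_mem (N.tr h) hm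

/-- The kernel of a morphism of systems. -/
def kernel {N N' : EnvSystem S hS} (f : Hom N N') : EnvSystem S hS where
  obj β := GradedModuleCat.ker (f.app β)
  top := GradedModuleCat.ker f.top
  ι := kernelι f
  ι_injective β x y h := Subtype.ext (N.ι_injective β (congrArg Subtype.val h))
  tr := kernelTr f
  tr_ι h := hom_ext (LinearMap.ext fun x => Subtype.ext (N.ι_tr_apply h x.1))
  exhaustive := fun ⟨y, hy⟩ => by
    obtain ⟨β, x, rfl⟩ := N.exhaustive y
    exact ⟨β, ⟨x, f.ι_mem_ker.1 hy⟩, rfl⟩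

/-- The inclusion of the kernel. -/
def kernelIncl {N N' : EnvSystem S hS} (f : Hom N N') : Hom (kernel f) N where
  app β := GradedModuleCat.kerι (f.app β)
  top := GradedModuleCat.kerι f.top
  comm _ := rfl

/-- The enveloping algebras acting on the subalgebras. -/
def self (hA : ∀ a : A, ∃ α, a ∈ (S α).toSubalgebra) : EnvSystem S hS where
  obj β := selfModule (S β).deg
  top := selfModule 𝒜
  ι β := selfMap (S β).toSubalgebra.val fun _ _ h => h
  ι_injective _ := Subtype.val_injective
  tr {α β} h := selfMap (Subalgebra.inclusion (hS α β h)) fun _ _ ha => ha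
  tr_ι _ := rfl
  exhaustive y := by
    obtain ⟨α, h⟩ := hA y
    exact ⟨α, ⟨y, h⟩, rfl⟩

end EnvSystem

end EnvSystems

/-! ### Free systems, whose basis elements appear at prescribed levels. -/

section FreeEnvSystems

open GradedModuleCat GradedSubalgebra

variable {k : Type*} [Field k] {A : Type u} [Ring A] [Algebra k A] {𝒜 : ℕ → Submodule k A}
  [GradedAlgebra 𝒜] {I : Type u} [Preorder I] {S : I → GradedSubalgebra 𝒜}
  {hS : ∀ α β, α ≤ β → (S α).toSubalgebra ≤ (S β).toSubalgebra}

theorem envMap_val_inclusion {S T : GradedSubalgebra 𝒜} (h : S.toSubalgebra ≤ T.toSubalgebra)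
    (r : S.toSubalgebra ⊗[k] S.toSubalgebraᵐᵒᵖ) :
    envMap T.toSubalgebra.val (envMap (Subalgebra.inclusion h) r) =
      envMap S.toSubalgebra.val r := by
  induction r using TensorProduct.induction_on with
  | zero => simp
  | add x y hx hy => simp only [map_add, hx, hy]
  | tmul x y => rfl

/-- A tensor involves finitely many elements of `A`, and by directedness one subalgebra contains
them all. -/
theorem exists_envMap_val_eq (hS : ∀ α β, α ≤ β → (S α).toSubalgebra ≤ (S β).toSubalgebra) [Nonempty I] [IsDirected I (· ≤ ·)]
    (hA : ∀ a : A, ∃ α, a ∈ (S α).toSubalgebra) (r : A ⊗[k] Aᵐᵒᵖ) :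
    ∃ α r', envMap (S α).toSubalgebra.val r' = r := by
  induction r using TensorProduct.induction_on with
  | zero => exact ⟨Classical.arbitrary I, 0, map_zero _⟩
  | add x y hx hy =>
    obtain ⟨α, x, rfl⟩ := hx
    obtain ⟨β, y, rfl⟩ := hy
    obtain ⟨γ, h1, h2⟩ := exists_ge_ge α β
    exact ⟨γ, envMap (Subalgebra.inclusion (hS _ _ h1)) x +
      envMap (Subalgebra.inclusion (hS _ _ h2)) y, by
      rw [map_add, envMap_val_inclusion, envMap_val_inclusion]⟩
  | tmul x y =>
    induction y using MulOpposite.rec' with | _ y => ?_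
    obtain ⟨α, hx⟩ := hA x
    obtain ⟨β, hy⟩ := hA y
    obtain ⟨γ, h1, h2⟩ := exists_ge_ge α β
    exact ⟨γ, ⟨x, hS _ _ h1 hx⟩ ⊗ₜ[k] MulOpposite.op ⟨y, hS _ _ h2 hy⟩, rfl⟩

namespace EnvSystem

variable {X : Type u} (a : X → I) (d : X → ℤ)

variable (S) in
/-- The levels of a free system. -/
def freeObj (β : I) : GradedModuleCat (envDeg (S β).deg) :=
  free (envDeg (S β).deg) {x // a x ≤ β} fun x => d x

variable (S) in
/-- The inclusions of the levels of a free system. -/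
def freeι (β : I) : freeObj S a d β ⟶ (S β).resFunctor.obj (free (envDeg 𝒜) X d) :=
  freeLift _ _ _ ((S β).resFunctor.obj (free (envDeg 𝒜) X d))
    (fun x => freeBasis (envDeg 𝒜) d x.1) fun x => freeBasis_mem (envDeg 𝒜) d x.1

variable (hS) in
/-- The transition maps of a free system. -/
def freeTr {α β : I} (h : α ≤ β) :
    freeObj S a d α ⟶ (resLE (hS α β h)).obj (freeObj S a d β) :=
  freeLift _ _ _ ((resLE (hS α β h)).obj (freeObj S a d β))
    (fun x => freeBasis (envDeg (S β).deg) (fun x : {x // a x ≤ β} => d x) ⟨x.1, x.2.trans h⟩)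
    fun x => freeBasis_mem (envDeg (S β).deg) (fun x : {x // a x ≤ β} => d x) ⟨x.1, x.2.trans h⟩

/-- The element of the basis of a level of a free system. -/
def freeLevelBasis {β : I} {x : X} (h : a x ≤ β) : (freeObj S a d β).carrier :=
  freeBasis (envDeg (S β).deg) (fun x : {x // a x ≤ β} => d x) ⟨x, h⟩

theorem freeι_basis {β : I} {x : X} (h : a x ≤ β) :
    Hom.lin (freeι S a d β) (freeLevelBasis a d h) = freeBasis (envDeg 𝒜) d x :=
  lin_freeLift (envDeg (S β).deg) (M := (S β).resFunctor.obj (free (envDeg 𝒜) X d)) _ _ _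

theorem freeTr_basis {α β : I} (h : α ≤ β) {x : X} (hx : a x ≤ α) :
    Hom.lin (freeTr hS a d h) (freeLevelBasis a d hx) = freeLevelBasis a d (hx.trans h) :=
  lin_freeLift (envDeg (S α).deg) (M := (resLE (hS α β h)).obj (freeObj S a d β)) _ _ _

theorem freeTr_ι {α β : I} (h : α ≤ β) :
    freeTr hS a d h ≫ (resLE (hS α β h)).map (freeι S a d β) ≫
      resLEComp (hS α β h) (free (envDeg 𝒜) X d) = freeι S a d α := by
  refine free_hom_ext _ fun x => ?_
  have h1 := freeTr_basis (hS := hS) a d h x.2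
  have h2 := freeι_basis (S := S) a d (x.2.trans h)
  exact (congrArg (Hom.lin (freeι S a d β)) h1).trans (h2.trans (freeι_basis a d x.2).symm)

/-- On coordinates the inclusion of a level is `envMap`, which reduces its injectivity to that of
`envMap`. -/
theorem freeCoeff_freeι {β : I} (f : (freeObj S a d β).carrier) (x : {x // a x ≤ β}) :
    freeCoeff (envDeg 𝒜) d x.1 (Hom.lin (freeι S a d β) f) =
      envMap (S β).toSubalgebra.val
        (freeCoeff (envDeg (S β).deg) (fun x : {x // a x ≤ β} => d x) x f) := by
  classical
  induction f using free_induction with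
  | h0 =>
    rw [map_zero, map_zero]
    exact (congrArg (freeCoeff (envDeg 𝒜) d x.1) (map_zero (Hom.lin (freeι S a d β)))).trans
      (map_zero _)
  | hadd f g hf hg =>
    rw [map_add, map_add]
    exact (congrArg (freeCoeff (envDeg 𝒜) d x.1) (map_add (Hom.lin (freeι S a d β)) f g)).trans
      ((map_add (freeCoeff (envDeg 𝒜) d x.1) _ _).trans (congrArg₂ (· + ·) hf hg))
  | hsmul r y =>
    have h : Hom.lin (freeι S a d β) (r • freeLevelBasis a d y.2) =
        envMap (S β).toSubalgebra.val r • freeBasis (envDeg 𝒜) d y.1 :=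
      (map_smul (Hom.lin (freeι S a d β)) r _).trans
        (congrArg (fun z : (free (envDeg 𝒜) X d).carrier =>
          envMap (S β).toSubalgebra.val r • z) (freeι_basis (S := S) a d y.2))
    refine (congrArg (freeCoeff (envDeg 𝒜) d x.1) h).trans ?_
    rw [freeCoeff_smul, freeCoeff_smul, freeCoeff_basis, freeCoeff_basis, map_mul]
    by_cases hxy : y = x
    · rw [if_pos hxy, if_pos (congrArg Subtype.val hxy), map_one]
    · rw [if_neg hxy, if_neg fun h => hxy (Subtype.ext h), map_zero]

theorem freeι_injective (β : I) : Function.Injective (Hom.lin (freeι S a d β)) := fun f g h =>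
  free_ext _ fun x => envMap_injective (S β).toSubalgebra.val Subtype.val_injective
    ((freeCoeff_freeι a d f x).symm.trans
      ((congrArg (freeCoeff (envDeg 𝒜) d x.1) h).trans (freeCoeff_freeι a d g x)))

variable (S) in
/-- The inclusions of the levels of a free system, as additive maps. -/
def freeιHom (β : I) : (freeObj S a d β).carrier →+ (free (envDeg 𝒜) X d).carrier :=
  (Hom.lin (freeι S a d β)).toAddMonoidHom

theorem exists_freeιHom_eq (hS : ∀ α β, α ≤ β → (S α).toSubalgebra ≤ (S β).toSubalgebra)
    {α β : I} (h : α ≤ β) (f : (freeObj S a d α).carrier) :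
    ∃ g, freeιHom S a d β g = freeιHom S a d α f :=
  ⟨Hom.lin (freeTr hS a d h) f,
    LinearMap.congr_fun (congrArg Hom.lin (freeTr_ι (hS := hS) a d h)) f⟩

theorem freeιHom_smul {β : I} (r : (S β).toSubalgebra ⊗[k] (S β).toSubalgebraᵐᵒᵖ)
    (f : (freeObj S a d β).carrier) :
    freeιHom S a d β (r • f) = envMap (S β).toSubalgebra.val r • freeιHom S a d β f :=
  map_smul (Hom.lin (freeι S a d β)) r f

theorem freeιHom_basis {β : I} {x : X} (h : a x ≤ β) :
    freeιHom S a d β (freeLevelBasis a d h) = freeBasis (envDeg 𝒜) d x :=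
  freeι_basis a d h

theorem freeιHom_exhaustive [Nonempty I] [IsDirected I (· ≤ ·)]
    (hS : ∀ α β, α ≤ β → (S α).toSubalgebra ≤ (S β).toSubalgebra)
    (hA : ∀ a : A, ∃ α, a ∈ (S α).toSubalgebra) (y : (free (envDeg 𝒜) X d).carrier) :
    ∃ β x, freeιHom S a d β x = y := by
  induction y using free_induction with
  | h0 => exact ⟨Classical.arbitrary I, 0, map_zero _⟩
  | hadd f g hf hg =>
    obtain ⟨α, f, rfl⟩ := hf
    obtain ⟨β, g, rfl⟩ := hg
    obtain ⟨γ, h1, h2⟩ := exists_ge_ge α β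
    obtain ⟨f', hf'⟩ := exists_freeιHom_eq a d hS h1 f
    obtain ⟨g', hg'⟩ := exists_freeιHom_eq a d hS h2 g
    exact ⟨γ, f' + g', by rw [map_add, hf', hg']⟩
  | hsmul r x =>
    obtain ⟨β, r, rfl⟩ := exists_envMap_val_eq hS hA r
    -- The scalar exists from level `β` on and the basis element from level `a x` on, so their
    -- product exists at a common bound.
    obtain ⟨γ, h1, h2⟩ := exists_ge_ge β (a x)
    refine ⟨γ, envMap (Subalgebra.inclusion (hS _ _ h1)) r • freeLevelBasis a d h2, ?_⟩
    rw [freeιHom_smul, freeιHom_basis, envMap_val_inclusion]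

variable [Nonempty I] [IsDirected I (· ≤ ·)] (hA : ∀ a : A, ∃ α, a ∈ (S α).toSubalgebra)

variable (hS) in
/-- The system of free graded modules with basis elements `x` of degree `d x` appearing at the
level `a x`. -/
def freeSystem : EnvSystem S hS where
  obj := freeObj S a d
  top := free (envDeg 𝒜) X d
  ι := freeι S a d
  ι_injective := freeι_injective a d
  tr := freeTr hS a d
  tr_ι := freeTr_ι a d
  exhaustive := freeιHom_exhaustive a d hS hA

instance (β : I) : Projective ((freeSystem hS a d hA).obj β) :=
  inferInstanceAs (Projective (free (envDeg (S β).deg) {x // a x ≤ β} fun x => d x))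

instance : Projective (freeSystem hS a d hA).top :=
  inferInstanceAs (Projective (free (envDeg 𝒜) X d))

end EnvSystem

end FreeEnvSystems

/-! ### The simultaneous free resolution, and the inverse systems of homomorphisms. -/

section SyzygySystems

open Abelian GradedModuleCat GradedSubalgebra

variable {k : Type*} [Field k] {A : Type u} [Ring A] [Algebra k A] {𝒜 : ℕ → Submodule k A}
  [GradedAlgebra 𝒜] {I : Type u} [Preorder I] {S : I → GradedSubalgebra 𝒜}
  {hS : ∀ α β, α ≤ β → (S α).toSubalgebra ≤ (S β).toSubalgebra}

namespace EnvSystem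

section Lift

variable {X : Type u} (a : X → I) (d : X → ℤ) (N : EnvSystem S hS)
  (v : ∀ x, (N.obj (a x)).carrier) (hv : ∀ x, v x ∈ (N.obj (a x)).deg (d x))

/-- The levels of the morphism from a free system determined by the images of the basis. -/
def freeLiftApp (β : I) : freeObj S a d β ⟶ N.obj β :=
  freeLift _ _ _ (N.obj β) (fun x => GradedModuleCat.Hom.lin (N.tr x.2) (v x.1))
    fun x => Hom.lin_mem (N.tr x.2) (hv x.1)

theorem freeLiftApp_basis {β : I} {x : X} (h : a x ≤ β) :
    GradedModuleCat.Hom.lin (freeLiftApp a d N v hv β) (freeLevelBasis a d h) =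
      GradedModuleCat.Hom.lin (N.tr h) (v x) :=
  lin_freeLift (envDeg (S β).deg) (M := N.obj β) _ _ _

/-- The morphism from a free module determined by the images of the basis, which belong to the
levels of a system. -/
def freeLiftTop : free (envDeg 𝒜) X d ⟶ N.top :=
  freeLift _ _ _ N.top (fun x => GradedModuleCat.Hom.lin (N.ι (a x)) (v x))
    fun x => Hom.lin_mem (N.ι (a x)) (hv x)

theorem freeLiftTop_basis (x : X) :
    GradedModuleCat.Hom.lin (freeLiftTop a d N v hv) (freeBasis (envDeg 𝒜) d x) =
      GradedModuleCat.Hom.lin (N.ι (a x)) (v x) :=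
  lin_freeLift (envDeg 𝒜) (M := N.top) _ _ _

variable [Nonempty I] [IsDirected I (· ≤ ·)] (hA : ∀ a : A, ∃ α, a ∈ (S α).toSubalgebra)

/-- The morphism from a free system determined by the images of the basis. -/
def freeSystemLift : EnvSystem.Hom (freeSystem hS a d hA) N where
  app := freeLiftApp a d N v hv
  top := freeLiftTop a d N v hv
  comm β := by
    refine free_hom_ext (envDeg (S β).deg) fun x => ?_
    refine (congrArg (GradedModuleCat.Hom.lin (N.ι β)) (freeLiftApp_basis a d N v hv x.2)).trans ?_
    refine (N.ι_tr_apply x.2 (v x.1)).trans ?_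
    refine (freeLiftTop_basis a d N v hv x.1).symm.trans ?_
    exact congrArg (GradedModuleCat.Hom.lin (freeLiftTop a d N v hv)) (freeι_basis a d x.2).symm

end Lift

variable [Nonempty I] [IsDirected I (· ≤ ·)] (hA : ∀ a : A, ∃ α, a ∈ (S α).toSubalgebra)

/-- The basis of the free cover of a system. -/
abbrev CoverIndex (N : EnvSystem S hS) : Type u := Σ β, Σ j : ℤ, (N.obj β).deg j

/-- The free cover of a system. -/
def cover (N : EnvSystem S hS) : EnvSystem S hS :=
  freeSystem hS (fun x : N.CoverIndex => x.1) (fun x => x.2.1) hA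

/-- The projection from the free cover of a system. -/
def coverProj (N : EnvSystem S hS) : Hom (cover hA N) N :=
  freeSystemLift (fun x : N.CoverIndex => x.1) (fun x => x.2.1) N (fun x => x.2.2.1)
    (fun x => x.2.2.2) hA

theorem coverProj_app_surjective (N : EnvSystem S hS) (β : I) :
    Function.Surjective (GradedModuleCat.Hom.lin ((coverProj hA N).app β)) := by
  intro y
  obtain ⟨t, ht⟩ := (N.obj β).exists_sum y
  rw [← LinearMap.mem_range, ht]
  refine Submodule.sum_mem _ fun n _ => ?_
  -- A homogeneous element of the level `β` is itself an index of the basis, appearing exactly at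
  -- `β`; its basis element maps to it.
  refine ⟨freeLevelBasis (fun x : N.CoverIndex => x.1) (fun x => x.2.1)
    (x := ⟨β, n, _, (N.obj β).proj_mem n y⟩) le_rfl, ?_⟩
  exact (freeLiftApp_basis (fun x : N.CoverIndex => x.1) (fun x => x.2.1) N (fun x => x.2.2.1)
    (fun x => x.2.2.2) _).trans (N.tr_refl_apply le_rfl _)

theorem coverProj_top_surjective (N : EnvSystem S hS) :
    Function.Surjective (GradedModuleCat.Hom.lin (coverProj hA N).top) := by
  intro y
  obtain ⟨β, x, rfl⟩ := N.exhaustive y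
  obtain ⟨z, rfl⟩ := coverProj_app_surjective hA N β x
  exact ⟨_, ((coverProj hA N).ι_app_apply β z).symm⟩

variable (hS) in
/-- The iterated syzygies of the system of enveloping algebras. -/
def syzSystem : ℕ → EnvSystem S hS
  | 0 => self hA
  | n + 1 => kernel (coverProj hA (syzSystem n))

variable (hS) in
/-- The syzygies at the level `β`. -/
def levelSyzygies (β : I) : SyzygySequence (GradedModuleCat (envDeg (S β).deg)) where
  syz n := (syzSystem hS hA n).obj β
  cover n := (cover hA (syzSystem hS hA n)).obj β
  incl n := (kernelIncl (coverProj hA (syzSystem hS hA n))).app β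
  proj n := (coverProj hA (syzSystem hS hA n)).app β
  incl_proj _ := kerι_comp _
  shortExact _ := shortExact_ker _ (coverProj_app_surjective hA _ β)

variable (hS) in
/-- The syzygies over the whole algebra. -/
def topSyzygies : SyzygySequence (GradedModuleCat (envDeg 𝒜)) where
  syz n := (syzSystem hS hA n).top
  cover n := (cover hA (syzSystem hS hA n)).top
  incl n := (kernelIncl (coverProj hA (syzSystem hS hA n))).top
  proj n := (coverProj hA (syzSystem hS hA n)).top
  incl_proj _ := kerι_comp _
  shortExact _ := shortExact_ker _ (coverProj_top_surjective hA _)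

instance (β : I) (n : ℕ) : Projective ((levelSyzygies hS hA β).cover n) :=
  inferInstanceAs (Projective ((freeSystem hS (fun x : (syzSystem hS hA n).CoverIndex => x.1)
    (fun x => x.2.1) hA).obj β))

instance (n : ℕ) : Projective ((topSyzygies hS hA).cover n) :=
  inferInstanceAs (Projective (freeSystem hS (fun x : (syzSystem hS hA n).CoverIndex => x.1)
    (fun x => x.2.1) hA).top)

section HomSystem

variable (M : GradedModuleCat (envDeg 𝒜)) (s : ℤ)

/-- The coefficients `M[s]` over the level `β`. -/
abbrev levelCoeff (S : GradedSubalgebra 𝒜) : GradedModuleCat (envDeg S.deg) := (S.res M).shift s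

/-- The comparison of the coefficients at two levels. -/
abbrev levelCoeffMap {S T : GradedSubalgebra 𝒜} (h : S.toSubalgebra ≤ T.toSubalgebra) :
    (resLE h).obj (levelCoeff M s T) ⟶ levelCoeff M s S :=
  shiftMap (Subalgebra.inclusion h) (inclusion_mem h) (resLEComp h M) s

/-- The restriction of a homomorphism to a smaller level. -/
def homRestrict (N : EnvSystem S hS) {α β : I} (h : α ≤ β) :
    (N.obj β ⟶ levelCoeff M s (S β)) →+ (N.obj α ⟶ levelCoeff M s (S α)) :=
  AddMonoidHom.mk' (fun f => N.tr h ≫ (resLE (hS α β h)).map f ≫ levelCoeffMap M s (hS α β h))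
    fun f g => by rw [Functor.map_add, Preadditive.add_comp, Preadditive.comp_add]

/-- The inverse system `β ↦ Hom(N β, M[s])`. -/
def homSystem (N : EnvSystem S hS) : Iᵒᵖ ⥤ AddCommGrpCat.{u} where
  obj β := AddCommGrpCat.of (N.obj β.unop ⟶ levelCoeff M s (S β.unop))
  map h := AddCommGrpCat.ofHom (homRestrict M s N (leOfHom h.unop))
  map_id _ := AddCommGrpCat.hom_ext (AddMonoidHom.ext fun f => hom_ext (LinearMap.ext fun x =>
    congrArg (GradedModuleCat.Hom.lin f) (N.tr_refl_apply le_rfl x)))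
  map_comp h h' := AddCommGrpCat.hom_ext (AddMonoidHom.ext fun f =>
    hom_ext (LinearMap.ext fun x => congrArg (GradedModuleCat.Hom.lin f)
      (N.tr_tr_apply (leOfHom h'.unop) (leOfHom h.unop) (leOfHom (h ≫ h').unop) x).symm))

/-- The contravariant functoriality of `homSystem`. -/
def homSystemMap {N N' : EnvSystem S hS} (f : Hom N N') :
    homSystem M s N' ⟶ homSystem M s N where
  app β := AddCommGrpCat.ofHom (Preadditive.leftComp (levelCoeff M s (S β.unop)) (f.app β.unop))
  naturality _ _ h := AddCommGrpCat.hom_ext (AddMonoidHom.ext fun g =>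
    hom_ext (LinearMap.ext fun x => congrArg (GradedModuleCat.Hom.lin g)
      (f.tr_app_apply (leOfHom h.unop) x)))

/-- The transition maps form a morphism between the syzygy sequences at the two levels, so
naturality of the Yoneda products identifies restriction of homomorphisms with restriction in
Hochschild cohomology. -/
theorem toExt_homRestrict {α β : I} (h : α ≤ β) (q : ℕ)
    (f : (syzSystem hS hA q).obj β ⟶ levelCoeff M s (S β)) :
    (levelSyzygies hS hA α).toExt q (levelCoeff M s (S α))
        (homRestrict M s (syzSystem hS hA q) h f) =
      trans (hS α β h) M q s ((levelSyzygies hS hA β).toExt q (levelCoeff M s (S β)) f) :=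
  SyzygySequence.toExt_naturality (resLE (hS α β h)) (levelSyzygies hS hA β)
    (levelSyzygies hS hA α) (fun n => (syzSystem hS hA n).tr h)
    (fun n => (cover hA (syzSystem hS hA n)).tr h)
    (fun n => (kernelIncl (coverProj hA (syzSystem hS hA n))).tr_comm h)
    (fun n => (coverProj hA (syzSystem hS hA n)).tr_comm h) q f
    (levelCoeffMap M s (hS α β h))

/-- The homomorphism from the homomorphisms out of the `q`-th syzygies to the Hochschild
cohomology. -/
def toHHSystem (q : ℕ) : homSystem M s (syzSystem hS hA q) ⟶ hhSystem S hS M q s where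
  app β := AddCommGrpCat.ofHom ((levelSyzygies hS hA β.unop).toExt q _)
  naturality _ _ h := AddCommGrpCat.hom_ext (AddMonoidHom.ext fun f =>
    toExt_homRestrict hA M s (leOfHom h.unop) q f)

end HomSystem

end EnvSystem

end SyzygySystems

/-- The exactness assumptions make `i` a kernel of `T.g` and `π` a cokernel of the map `l` induced
by `T.f`, which is a left homology datum. -/
theorem CategoryTheory.ShortComplex.nonempty_homology_iso {𝒞 : Type*} [Category 𝒞] [Abelian 𝒞]
    (T : ShortComplex 𝒞) {K H : 𝒞} (i : K ⟶ T.X₂) [Mono i] (π : K ⟶ H) [Epi π]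
    (wi : i ≫ T.g = 0) (hi : (ShortComplex.mk i T.g wi).Exact)
    (l : T.X₁ ⟶ K) (hl : l ≫ i = T.f) (wπ : l ≫ π = 0)
    (hπ : (ShortComplex.mk l π wπ).Exact) : Nonempty (T.homology ≅ H) := by
  have : Mono (ShortComplex.mk i T.g wi).f := inferInstanceAs (Mono i)
  have : Epi (ShortComplex.mk l π wπ).g := inferInstanceAs (Epi π)
  let hker : IsLimit (KernelFork.ofι i wi) := hi.fIsKernel
  have hf : hker.lift (KernelFork.ofι T.f T.zero) = l :=
    Fork.IsLimit.hom_ext hker ((hker.fac _ WalkingParallelPair.zero).trans hl.symm)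
  let h : T.LeftHomologyData :=
    { K := K
      H := H
      i := i
      π := π
      wi := wi
      hi := hker
      wπ := by rw [hf]; exact wπ
      hπ := CokernelCofork.IsColimit.ofπ _ _
        (fun k hk => hπ.desc k (by rw [hf] at hk; exact hk))
        (fun k hk => hπ.g_desc k _)
        (fun k hk m hm => by
          rw [← cancel_epi π, hm]
          exact (hπ.g_desc k _).symm) }
  exact ⟨h.homologyIso⟩

theorem CochainComplex.nonempty_homology_iso {𝒞 : Type*} [Category 𝒞] [Abelian 𝒞]
    (C : CochainComplex 𝒞 ℕ) (q : ℕ) {K H : 𝒞} (i : K ⟶ C.X q) [Mono i] (π : K ⟶ H) [Epi π]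
    (wi : i ≫ C.d q (q + 1) = 0) (hi : (ShortComplex.mk i (C.d q (q + 1)) wi).Exact)
    (l : C.X (q - 1) ⟶ K) (hl : l ≫ i = C.d (q - 1) q) (wπ : l ≫ π = 0)
    (hπ : (ShortComplex.mk l π wπ).Exact) : Nonempty (C.homology q ≅ H) := by
  have hprev : (ComplexShape.up ℕ).prev q = q - 1 := by
    obtain _ | q := q
    · exact CochainComplex.prev_nat_zero
    · exact CochainComplex.prev_nat_succ q
  have : Mono (Y := (C.sc' (q - 1) q (q + 1)).X₂) i := inferInstanceAs (Mono i)
  exact ((C.sc' (q - 1) q (q + 1)).nonempty_homology_iso i π wi hi l hl wπ hπ).map fun e =>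
    C.homologyIsoSc' (q - 1) q (q + 1) hprev (CochainComplex.next ℕ q) ≪≫ e

namespace GradedModuleCat

/-- Homomorphisms out of a free graded module are determined by the images of the basis. -/
def freeHomEquiv {k : Type*} [CommRing k] {R : Type u} [Ring R] [Algebra k R]
    (𝓡 : ℕ → Submodule k R) [GradedAlgebra 𝓡] {X : Type u} (d : X → ℤ) (M : GradedModuleCat 𝓡) :
    (free 𝓡 X d ⟶ M) ≃+ ∀ x, M.deg (d x) where
  toFun f x := ⟨Hom.lin f (freeBasis 𝓡 d x), Hom.lin_mem f (freeBasis_mem 𝓡 d x)⟩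
  invFun v := freeLift 𝓡 X d M (fun x => (v x).1) fun x => (v x).2
  left_inv _ := free_hom_ext 𝓡 fun x => lin_freeLift 𝓡 _ _ x
  right_inv _ := funext fun x => Subtype.ext (lin_freeLift 𝓡 _ _ x)
  map_add' _ _ := rfl

end GradedModuleCat

/-! ### Compatible families of homomorphisms, and free systems. -/

section HochschildComplex

open Abelian GradedModuleCat GradedSubalgebra

variable {k : Type*} [Field k] {A : Type u} [Ring A] [Algebra k A] {𝒜 : ℕ → Submodule k A}
  [GradedAlgebra 𝒜] {I : Type u} [Preorder I] {S : I → GradedSubalgebra 𝒜}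
  {hS : ∀ α β, α ≤ β → (S α).toSubalgebra ≤ (S β).toSubalgebra}

namespace EnvSystem

variable (M : GradedModuleCat (envDeg 𝒜)) (s : ℤ)

/-- The coefficients over the whole algebra, restricted to the level `β`. -/
abbrev topCoeffMap (S : GradedSubalgebra 𝒜) :
    S.resFunctor.obj (M.shift s) ⟶ levelCoeff M s S :=
  shiftMap S.toSubalgebra.val (fun _ _ h => h) (𝟙 (S.res M)) s

/-- The restriction to the level `β` of a homomorphism out of the top of a system. -/
def topRestrictApp (N : EnvSystem S hS) (β : I) :
    (N.top ⟶ M.shift s) →+ (N.obj β ⟶ levelCoeff M s (S β)) :=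
  AddMonoidHom.mk' (fun g => N.ι β ≫ (S β).resFunctor.map g ≫ topCoeffMap M s (S β))
    fun _ _ => hom_ext (LinearMap.ext fun _ => rfl)

theorem lin_topRestrictApp (N : EnvSystem S hS) (g : N.top ⟶ M.shift s) (β : I)
    (x : (N.obj β).carrier) : GradedModuleCat.Hom.lin (topRestrictApp M s N β g) x =
      GradedModuleCat.Hom.lin g (GradedModuleCat.Hom.lin (N.ι β) x) := rfl

theorem homRestrict_topRestrictApp (N : EnvSystem S hS) (g : N.top ⟶ M.shift s) {α β : I}
    (h : α ≤ β) : homRestrict M s N h (topRestrictApp M s N β g) = topRestrictApp M s N α g :=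
  hom_ext (LinearMap.ext fun x => congrArg (GradedModuleCat.Hom.lin g) (N.ι_tr_apply h x))

/-- A compatible family of homomorphisms out of the levels of a system. -/
def homSystemFamily (N : EnvSystem S hS) (f : ∀ β, N.obj β ⟶ levelCoeff M s (S β))
    (hf : ∀ {α β} (h : α ≤ β), homRestrict M s N h (f β) = f α) :
    constInt I ⟶ homSystem M s N :=
  constIntHom (homSystem M s N) (fun β => f β.unop) fun _ _ h => hf (leOfHom h.unop)

/-- The level `β` of a compatible family of homomorphisms out of the levels of a system. -/
def familyApp (N : EnvSystem S hS) (β : I) :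
    (constInt I ⟶ homSystem M s N) →+ (N.obj β ⟶ levelCoeff M s (S β)) :=
  AddMonoidHom.mk' (fun F => F.app (.op β) (ULift.up (1 : ℤ) : ULift.{u} ℤ)) fun _ _ => rfl

theorem familyApp_ext {N : EnvSystem S hS} {F G : constInt I ⟶ homSystem M s N}
    (h : ∀ β, familyApp M s N β F = familyApp M s N β G) : F = G :=
  constInt_hom_ext fun β => h β.unop

theorem familyApp_homSystemFamily (N : EnvSystem S hS)
    (f : ∀ β, N.obj β ⟶ levelCoeff M s (S β))
    (hf : ∀ {α β} (h : α ≤ β), homRestrict M s N h (f β) = f α) (β : I) :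
    familyApp M s N β (homSystemFamily M s N f hf) = f β :=
  constIntHom_app_one (homSystem M s N) (fun β => f β.unop)
    (fun _ _ h => hf (leOfHom h.unop)) (.op β)

theorem homRestrict_familyApp (N : EnvSystem S hS) (F : constInt I ⟶ homSystem M s N) {α β : I}
    (h : α ≤ β) : homRestrict M s N h (familyApp M s N β F) = familyApp M s N α F :=
  constInt_hom_compat F (i := .op β) (j := .op α) (homOfLE h).op

theorem lin_familyApp_tr (N : EnvSystem S hS) (F : constInt I ⟶ homSystem M s N) {α β : I}
    (h : α ≤ β) (x : (N.obj α).carrier) :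
    GradedModuleCat.Hom.lin (familyApp M s N β F) (GradedModuleCat.Hom.lin (N.tr h) x) =
      GradedModuleCat.Hom.lin (familyApp M s N α F) x := by
  rw [← homRestrict_familyApp M s N F h]
  rfl

theorem familyApp_comp {N N' : EnvSystem S hS} (f : EnvSystem.Hom N N')
    (F : constInt I ⟶ homSystem M s N') (β : I) :
    familyApp M s N β (F ≫ homSystemMap M s f) = f.app β ≫ familyApp M s N' β F := rfl

/-- The family of restrictions to the levels of a homomorphism out of the top of a system. -/
def topRestrict (N : EnvSystem S hS) :
    (N.top ⟶ M.shift s) →+ (constInt I ⟶ homSystem M s N) :=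
  AddMonoidHom.mk' (fun g => homSystemFamily M s N (fun β => topRestrictApp M s N β g)
      fun h => homRestrict_topRestrictApp M s N g h)
    fun g g' => familyApp_ext M s fun β => by
      rw [map_add, familyApp_homSystemFamily, familyApp_homSystemFamily,
        familyApp_homSystemFamily, map_add]

theorem familyApp_topRestrict (N : EnvSystem S hS) (g : N.top ⟶ M.shift s) (β : I) :
    familyApp M s N β (topRestrict M s N g) = topRestrictApp M s N β g :=
  familyApp_homSystemFamily M s N (fun β => topRestrictApp M s N β g)
    (fun h => homRestrict_topRestrictApp M s N g h) β

/-- Every element of the union comes from some level, so the restrictions determine the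
homomorphism. -/
theorem topRestrict_injective (N : EnvSystem S hS) :
    Function.Injective (topRestrict M s N) := fun g g' h => by
  apply hom_ext
  apply LinearMap.ext
  intro y
  obtain ⟨β, x, rfl⟩ := N.exhaustive y
  have h1 : topRestrictApp M s N β g = topRestrictApp M s N β g' := by
    rw [← familyApp_topRestrict, ← familyApp_topRestrict, h]
  exact LinearMap.congr_fun (congrArg GradedModuleCat.Hom.lin h1) x

theorem topRestrict_comp {N N' : EnvSystem S hS} (f : EnvSystem.Hom N N')
    (g : N'.top ⟶ M.shift s) :
    topRestrict M s N (f.top ≫ g) = topRestrict M s N' g ≫ homSystemMap M s f := by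
  refine familyApp_ext M s fun β => ?_
  rw [familyApp_comp, familyApp_topRestrict, familyApp_topRestrict]
  exact hom_ext (LinearMap.ext fun x =>
    congrArg (GradedModuleCat.Hom.lin g) (f.ι_app_apply β x).symm)

variable [Nonempty I] [IsDirected I (· ≤ ·)] (hA : ∀ a : A, ∃ α, a ∈ (S α).toSubalgebra)

section Free

variable {X : Type u} (a : X → I) (d : X → ℤ)

theorem lin_freeLevelBasis_mem (F : constInt I ⟶ homSystem M s (freeSystem hS a d hA)) {β : I}
    {x : X} (h : a x ≤ β) : GradedModuleCat.Hom.lin (familyApp M s (freeSystem hS a d hA) β F)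
      (freeLevelBasis (S := S) a d h) ∈ M.deg (d x + s) := by
  have h1 : freeLevelBasis (S := S) a d h ∈ ((freeSystem hS a d hA).obj β).deg (d x) :=
    freeBasis_mem (envDeg (S β).deg) (fun x : {x // a x ≤ β} => d x) ⟨x, h⟩
  exact Hom.lin_mem (familyApp M s (freeSystem hS a d hA) β F) h1

theorem familyApp_freeLevelBasis (F : constInt I ⟶ homSystem M s (freeSystem hS a d hA)) {β : I}
    {x : X} (h : a x ≤ β) :
    GradedModuleCat.Hom.lin (familyApp M s (freeSystem hS a d hA) β F) (freeLevelBasis (S := S) a d h) =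
      GradedModuleCat.Hom.lin (familyApp M s (freeSystem hS a d hA) (a x) F) (freeLevelBasis (S := S) a d le_rfl) := by
  have h1 := lin_familyApp_tr M s (freeSystem hS a d hA) F h (freeLevelBasis (S := S) a d le_rfl)
  have h2 : GradedModuleCat.Hom.lin ((freeSystem hS a d hA).tr h) (freeLevelBasis (S := S) a d le_rfl) =
    freeLevelBasis (S := S) a d h := freeTr_basis (hS := hS) a d h le_rfl
  exact (congrArg (GradedModuleCat.Hom.lin (familyApp M s (freeSystem hS a d hA) β F))
    h2).symm.trans h1

theorem topRestrictApp_freeLift (v : X → M.carrier) (hv : ∀ x, v x ∈ M.deg (d x + s)) {β : I}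
    {x : X} (h : a x ≤ β) :
    GradedModuleCat.Hom.lin (topRestrictApp M s (freeSystem hS a d hA) β
      (freeLift (envDeg 𝒜) X d (M.shift s) v hv)) (freeLevelBasis (S := S) a d h) = v x :=
  (lin_topRestrictApp M s (freeSystem hS a d hA) (freeLift (envDeg 𝒜) X d (M.shift s) v hv) β
    (freeLevelBasis (S := S) a d h)).trans <|
  (congrArg (GradedModuleCat.Hom.lin (freeLift (envDeg 𝒜) X d (M.shift s) v hv))
    (freeι_basis (S := S) a d h)).trans (lin_freeLift (envDeg 𝒜) (M := M.shift s) v hv x)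

/-- Compatibility makes the value of a family on the basis element `x` independent of the level. The
value at the level `a x` defines a homomorphism on the union. -/
theorem topRestrict_freeSystem_surjective :
    Function.Surjective (topRestrict M s (freeSystem hS a d hA)) := fun F => by
  refine ⟨freeLift (envDeg 𝒜) X d (M.shift s)
    (fun x => GradedModuleCat.Hom.lin (familyApp M s (freeSystem hS a d hA) (a x) F) (freeLevelBasis (S := S) a d le_rfl))
    (fun x => lin_freeLevelBasis_mem M s hA a d F le_rfl), ?_⟩
  refine familyApp_ext M s fun β => ?_
  refine (familyApp_topRestrict M s (freeSystem hS a d hA) _ β).trans ?_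
  exact free_hom_ext (envDeg (S β).deg) fun x =>
    (topRestrictApp_freeLift M s hA a d _ _ x.2).trans
      (familyApp_freeLevelBasis M s hA a d F x.2).symm

/-- The system of homomorphisms out of a free system is a product of coefficient groups. -/
def homSystemFreeIso : homSystem M s (freeSystem hS a d hA) ≅
    belowProduct a fun x => AddCommGrpCat.of (M.deg (d x + s)) :=
  NatIso.ofComponents
    (fun β => AddEquiv.toAddCommGrpIso (freeHomEquiv (envDeg (S β.unop).deg)
      (fun x : {x // a x ≤ β.unop} => d x) (levelCoeff M s (S β.unop))))
    (fun h => AddCommGrpCat.hom_ext (AddMonoidHom.ext fun f => funext fun x => Subtype.ext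
      (congrArg (GradedModuleCat.Hom.lin f) (freeTr_basis a d (leOfHom h.unop) x.2))))

theorem extAcyclic_homSystem_freeSystem :
    ExtAcyclic (constInt I) (homSystem M s (freeSystem hS a d hA)) :=
  (belowProduct.extAcyclic a _).of_iso (homSystemFreeIso M s hA a d).symm

end Free

end EnvSystem

end HochschildComplex

/-! ### Splicing left exact sequences into a complex with acyclic terms. -/

section Splice

open Abelian

variable {𝒞 : Type*} [Category.{u} 𝒞] [Abelian 𝒞] {K P : ℕ → 𝒞} (i : ∀ n, K n ⟶ P n)
  (p : ∀ n, P n ⟶ K (n + 1)) (w : ∀ n, i n ≫ p n = 0)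

/-- The complex spliced from a sequence of complexes `K n ⟶ P n ⟶ K (n + 1)`. -/
def spliceComplex : CochainComplex 𝒞 ℕ :=
  CochainComplex.of P (fun n => p n ≫ i (n + 1)) fun n => by
    rw [Category.assoc, reassoc_of% (w (n + 1)), zero_comp, comp_zero]

theorem spliceComplex_d (n : ℕ) : (spliceComplex i p w).d n (n + 1) = p n ≫ i (n + 1) :=
  CochainComplex.of_d P (fun n => p n ≫ i (n + 1)) n

theorem comp_spliceComplex_d (n : ℕ) : i n ≫ (spliceComplex i p w).d n (n + 1) = 0 := by
  rw [spliceComplex_d]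
  exact (reassoc_of% (w n)) (i (n + 1)) |>.trans zero_comp

variable [∀ n, Mono (i n)]

/-- As `i (n + 1)` is a monomorphism, the differential has the same kernel as `p n`. -/
theorem exact_comp_spliceComplex_d (hw : ∀ n, (ShortComplex.mk _ _ (w n)).Exact) (n : ℕ) : (ShortComplex.mk (X₂ := (spliceComplex i p w).X n)
    (i n) _ (comp_spliceComplex_d i p w n)).Exact := by
  let φ : ShortComplex.mk _ _ (w n) ⟶ ShortComplex.mk (X₂ := (spliceComplex i p w).X n)
      (i n) _ (comp_spliceComplex_d i p w n) :=
    { τ₁ := 𝟙 _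
      τ₂ := 𝟙 _
      τ₃ := i (n + 1)
      comm₁₂ := (Category.id_comp _).trans (Category.comp_id _).symm
      comm₂₃ := (Category.id_comp _).trans (spliceComplex_d i p w n) }
  have : Epi φ.τ₁ := inferInstanceAs (Epi (𝟙 (K n)))
  have : IsIso φ.τ₂ := inferInstanceAs (IsIso (𝟙 (P n)))
  have : Mono φ.τ₃ := inferInstanceAs (Mono (i (n + 1)))
  exact (ShortComplex.exact_iff_of_epi_of_isIso_of_mono φ).1 (hw n)

/-- The cycles in degree `q` are `K q`, and the boundaries are the image of the preceding `p`, which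
is the kernel of `π q`. -/
theorem nonempty_spliceComplex_homology_iso (hw : ∀ n, (ShortComplex.mk _ _ (w n)).Exact) {L : ℕ → 𝒞} (π : ∀ n, K n ⟶ L n) [∀ n, Epi (π n)]
    [Mono (π 0)] (wπ : ∀ n, p n ≫ π (n + 1) = 0)
    (hπ : ∀ n, (ShortComplex.mk _ _ (wπ n)).Exact) (q : ℕ) :
    Nonempty ((spliceComplex i p w).homology q ≅ L q) := by
  have : Mono (Y := (spliceComplex i p w).X q) (i q) := inferInstanceAs (Mono (i q))
  have hi := exact_comp_spliceComplex_d i p w hw q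
  obtain _ | n := q
  -- In degree `0` there are no boundaries, and `π 0`, being mono and epi, is an isomorphism.
  · refine CochainComplex.nonempty_homology_iso (spliceComplex i p w) 0 (i 0) (π 0) _ hi 0
      ?_ zero_comp ?_
    · exact zero_comp.trans ((spliceComplex i p w).shape _ _ (by simp)).symm
    · exact (ShortComplex.exact_iff_mono _ rfl).2 (inferInstanceAs (Mono (π 0)))
  · exact CochainComplex.nonempty_homology_iso (spliceComplex i p w) (n + 1) (i (n + 1))
      (π (n + 1)) _ hi (p n) (spliceComplex_d i p w n).symm (wπ n) (hπ n)

/-- The homomorphisms to `K n` as homomorphisms to the cocycles of the spliced complex. -/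
def toCocyclesHom (Z : 𝒞) (n : ℕ) :
    (Z ⟶ K n) →+ cocyclesHom Z (spliceComplex i p w) n :=
  AddMonoidHom.codRestrict (Preadditive.rightComp Z (i n)) (cocyclesHom Z (spliceComplex i p w) n)
    fun f => by
      refine (Category.assoc f (i n) _).trans ?_
      exact (congrArg (f ≫ ·) (comp_spliceComplex_d i p w n)).trans comp_zero

theorem toCocyclesHom_bijective (hw : ∀ n, (ShortComplex.mk _ _ (w n)).Exact) (Z : 𝒞) (n : ℕ) :
    Function.Bijective (toCocyclesHom i p w Z n) := by
  constructor
  · intro f g h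
    exact (cancel_mono (i n)).1 (congrArg Subtype.val h)
  · intro f
    have : Mono (ShortComplex.mk _ _ (w n)).f := inferInstanceAs (Mono (i n))
    have h : f.1 ≫ p n = 0 := by
      refine (cancel_mono (i (n + 1))).1 (Eq.trans ?_ zero_comp.symm)
      refine (Category.assoc _ _ _).trans ((congrArg (f.1 ≫ ·) ?_).trans f.2)
      exact (spliceComplex_d i p w n).symm
    exact ⟨(hw n).lift f.1 h, Subtype.ext ((hw n).lift_f f.1 h)⟩

/-- By left exactness, morphisms from `Z` to `K n` are the cocycles of `Hom(Z, P)`. Thus `ψ`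
presents `H n` as the cohomology of that complex, and the spectral sequence for complexes with
acyclic terms applies. -/
theorem exists_spectralSequence_of_splice [EnoughInjectives 𝒞] [HasExt.{u} 𝒞]
    (hw : ∀ n, (ShortComplex.mk _ _ (w n)).Exact) (Z : 𝒞)
    (hP : ∀ n, ExtAcyclic Z (P n)) {L : ℕ → 𝒞} (π : ∀ n, K n ⟶ L n) [∀ n, Epi (π n)]
    [Mono (π 0)] (wπ : ∀ n, p n ≫ π (n + 1) = 0)
    (hπ : ∀ n, (ShortComplex.mk _ _ (wπ n)).Exact) (H : ℕ → AddCommGrpCat.{u})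
    (ψ : ∀ n, (Z ⟶ K n) →+ H n) (hψ : ∀ n, Function.Surjective (ψ n))
    (hψ₀ : Function.Injective (ψ 0))
    (hψ' : ∀ n f, ψ (n + 1) f = 0 ↔ ∃ g : Z ⟶ P n, g ≫ p n = f) :
    ∃ E : E₂CohomologicalSpectralSequenceNat AddCommGrpCat.{u},
      (∀ (hr : (2 : ℤ) ≤ 2) (p q : ℕ), Nonempty ((E.page 2 hr).X (p, q) ≅
        AddCommGrpCat.of (Ext.{u} Z (L q) p))) ∧
      ConvergesTo E H := by
  let e := fun n => AddEquiv.ofBijective _ (toCocyclesHom_bijective i p w hw Z n)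
  obtain ⟨E, hE, hE'⟩ := exists_spectralSequence_of_extAcyclic Z (spliceComplex i p w) hP H
    (fun n => (ψ n).comp (e n).symm.toAddMonoidHom)
    (fun n => (hψ n).comp (e n).symm.surjective) (fun n f => by
      obtain ⟨f, rfl⟩ := (e n).surjective f
      have h1 : (ψ n).comp (e n).symm.toAddMonoidHom (e n f) = ψ n f :=
        congrArg (ψ n) ((e n).symm_apply_apply f)
      rw [h1]
      -- For `n = 0` the incoming differential is zero by convention, so the required condition is
      -- injectivity of `ψ 0`.
      obtain _ | n := n
      · have hd : (spliceComplex i p w).d (0 - 1) 0 = 0 :=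
          (spliceComplex i p w).shape _ _ (by simp)
        rw [map_eq_zero_iff _ hψ₀, ← map_eq_zero_iff _ (e 0).injective]
        constructor
        · intro h
          exact ⟨0, zero_comp.trans (congrArg Subtype.val h).symm⟩
        · rintro ⟨g, hg⟩
          rw [hd, comp_zero] at hg
          exact Subtype.ext hg.symm
      · refine (hψ' n f).trans ?_
        constructor
        · rintro ⟨g, rfl⟩
          refine ⟨g, ?_⟩
          refine (congrArg (g ≫ ·) (spliceComplex_d i p w n)).trans ?_
          exact (Category.assoc _ _ _).symm
        · rintro ⟨g, hg⟩
          refine ⟨g, (cancel_mono (i (n + 1))).1 ?_⟩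
          refine Eq.trans ?_ hg
          refine (Category.assoc _ _ _).trans ?_
          exact (congrArg (g ≫ ·) (spliceComplex_d i p w n)).symm)
  refine ⟨E, fun hr a b => ?_, hE'⟩
  obtain ⟨x⟩ := hE hr a b
  obtain ⟨y⟩ := nonempty_spliceComplex_homology_iso i p w hw π wπ hπ b
  exact ⟨x ≪≫ extCongrRight Z y a⟩

end Splice

/-! ### Assembly of the spectral sequence. -/

section HochschildSpectralSequence

open Abelian GradedModuleCat GradedSubalgebra

variable {k : Type*} [Field k] {A : Type u} [Ring A] [Algebra k A] {𝒜 : ℕ → Submodule k A}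
  [GradedAlgebra 𝒜] {I : Type u} [Preorder I] {S : I → GradedSubalgebra 𝒜}
  {hS : ∀ α β, α ≤ β → (S α).toSubalgebra ≤ (S β).toSubalgebra}
  (M : GradedModuleCat (envDeg 𝒜)) (s : ℤ)

namespace EnvSystem

section Cover

variable [Nonempty I] [IsDirected I (· ≤ ·)] (hA : ∀ a : A, ∃ α, a ∈ (S α).toSubalgebra)
  (N : EnvSystem S hS)

theorem extAcyclic_homSystem_cover : ExtAcyclic (constInt I) (homSystem M s (cover hA N)) :=
  extAcyclic_homSystem_freeSystem M s hA _ _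

theorem topRestrict_cover_surjective : Function.Surjective (topRestrict M s (cover hA N)) :=
  topRestrict_freeSystem_surjective M s hA _ _

/-- The inclusion of the homomorphisms out of a system into those out of its free cover. -/
def coverHom : homSystem M s N ⟶ homSystem M s (cover hA N) :=
  homSystemMap M s (coverProj hA N)

/-- The restriction of the homomorphisms out of the free cover of a system to the first syzygies. -/
def kernelHom : homSystem M s (cover hA N) ⟶ homSystem M s (kernel (coverProj hA N)) :=
  homSystemMap M s (kernelIncl (coverProj hA N))

theorem coverHom_injective (β : Iᵒᵖ) : Function.Injective ((coverHom M s hA N).app β) := by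
  intro (f : N.obj β.unop ⟶ _) (g : N.obj β.unop ⟶ _) h
  have := epi_of_surjective _ (coverProj_app_surjective hA N β.unop)
  exact (cancel_epi ((coverProj hA N).app β.unop)).1 h

instance : Mono (coverHom M s hA N) := natTrans_mono_of_injective _ (coverHom_injective M s hA N)

theorem coverHom_kernelHom : coverHom M s hA N ≫ kernelHom M s hA N = 0 :=
  NatTrans.ext (funext fun β => AddCommGrpCat.hom_ext (AddMonoidHom.ext
    fun (f : N.obj β.unop ⟶ levelCoeff M s (S β.unop)) => by
      change (kernelIncl (coverProj hA N)).app β.unop ≫ (coverProj hA N).app β.unop ≫ f = 0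
      rw [← Category.assoc]
      refine (congrArg (· ≫ f) (GradedModuleCat.kerι_comp ((coverProj hA N).app β.unop))).trans ?_
      exact zero_comp))

/-- This is left exactness of `Hom(-, M[s])` at each level: a homomorphism on the cover that kills
the syzygies descends. -/
theorem exact_coverHom_kernelHom :
    (ShortComplex.mk _ _ (coverHom_kernelHom M s hA N)).Exact :=
  exact_of_exact_app fun β (f : (cover hA N).obj β.unop ⟶ levelCoeff M s (S β.unop)) hf =>
    exists_comp_eq_of_surjective _ (coverProj_app_surjective hA N β.unop) f hf

end Cover

variable [Nonempty I] [IsDirected I (· ≤ ·)] (hA : ∀ a : A, ∃ α, a ∈ (S α).toSubalgebra)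

/-- A diagram chase on the left exact sequences of homomorphisms out of `N`, its free cover and the
kernel: surjectivity for the free cover and injectivity for the kernel give surjectivity for `N`.
Hence the limit of the system of homomorphisms is the group of homomorphisms on the union. -/
theorem topRestrict_bijective (hA : ∀ a : A, ∃ α, a ∈ (S α).toSubalgebra) (N : EnvSystem S hS) :
    Function.Bijective (topRestrict M s N) := by
  refine ⟨topRestrict_injective M s N, fun F => ?_⟩
  obtain ⟨G, hG⟩ := topRestrict_cover_surjective M s hA N (F ≫ coverHom M s hA N)
  have h : GradedModuleCat.kerι (coverProj hA N).top ≫ G = 0 := by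
    apply topRestrict_injective M s (kernel (coverProj hA N))
    refine (topRestrict_comp M s (kernelIncl (coverProj hA N)) G).trans ?_
    refine Eq.trans ?_ (map_zero (topRestrict M s (kernel (coverProj hA N)))).symm
    rw [hG]
    refine (Category.assoc F _ _).trans ?_
    exact (congrArg (F ≫ ·) (coverHom_kernelHom M s hA N)).trans comp_zero
  obtain ⟨g, rfl⟩ := exists_comp_eq_of_surjective _ (coverProj_top_surjective hA N) G h
  refine ⟨g, (cancel_mono (coverHom M s hA N)).1 ?_⟩
  exact (topRestrict_comp M s (coverProj hA N) g).symm.trans hG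

theorem toHHSystem_surjective (q : ℕ) (β : Iᵒᵖ) :
    Function.Surjective ((toHHSystem (hS := hS) hA M s q).app β) :=
  (levelSyzygies hS hA β.unop).toExt_surjective q _

instance (q : ℕ) : Epi (toHHSystem (hS := hS) hA M s q) :=
  natTrans_epi_of_surjective _ (toHHSystem_surjective M s hA q)

instance : Mono (toHHSystem (hS := hS) hA M s 0) :=
  natTrans_mono_of_injective _ fun β => (levelSyzygies hS hA β.unop).toExt_zero_injective _

theorem kernelHom_toHHSystem (n : ℕ) :
    kernelHom M s hA (syzSystem hS hA n) ≫ toHHSystem hA M s (n + 1) = 0 :=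
  NatTrans.ext (funext fun β => AddCommGrpCat.hom_ext (AddMonoidHom.ext fun f =>
    ((levelSyzygies hS hA β.unop).toExt_succ_eq_zero_iff n _).2 ⟨f, rfl⟩))

/-- Exactness is levelwise, where it says that the `Ext` group is the group of homomorphisms on the
syzygies modulo those extending to the cover. -/
theorem exact_kernelHom_toHHSystem (n : ℕ) :
    (ShortComplex.mk _ _ (kernelHom_toHHSystem (hS := hS) M s hA n)).Exact :=
  exact_of_exact_app fun β f hf =>
    ((levelSyzygies hS hA β.unop).toExt_succ_eq_zero_iff n f).1 hf

variable (hS) in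
/-- The homomorphism from the compatible families of homomorphisms out of the levels of the `n`-th
syzygies to the Hochschild cohomology of the whole algebra. -/
def familyToHH (n : ℕ) : (constInt I ⟶ homSystem M s (syzSystem hS hA n)) →+ HH 𝒜 M n s :=
  AddMonoidHom.comp ((topSyzygies hS hA).toExt n (M.shift s))
    (AddEquiv.ofBijective _ (topRestrict_bijective M s hA (syzSystem hS hA n))).symm.toAddMonoidHom

theorem familyToHH_topRestrict (n : ℕ) (g : (syzSystem hS hA n).top ⟶ M.shift s) :
    familyToHH hS M s hA n (topRestrict M s (syzSystem hS hA n) g) =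
      (topSyzygies hS hA).toExt n (M.shift s) g :=
  congrArg ((topSyzygies hS hA).toExt n (M.shift s))
    ((AddEquiv.ofBijective _ (topRestrict_bijective M s hA (syzSystem hS hA n))).symm_apply_apply g)

theorem familyToHH_surjective (n : ℕ) : Function.Surjective (familyToHH hS M s hA n) := fun e => by
  obtain ⟨g, rfl⟩ := (topSyzygies hS hA).toExt_surjective n (M.shift s) e
  exact ⟨_, familyToHH_topRestrict M s hA n g⟩

theorem familyToHH_zero_injective : Function.Injective (familyToHH hS M s hA 0) :=
  ((topSyzygies hS hA).toExt_zero_injective (M.shift s)).comp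
    (AddEquiv.ofBijective _ (topRestrict_bijective M s hA (syzSystem hS hA 0))).symm.injective

/-- The criterion `toExt_succ_eq_zero_iff` for the resolution of `A`, carried to compatible families
along `topRestrict` for the syzygies and for the free cover. -/
theorem familyToHH_succ_eq_zero_iff (n : ℕ)
    (F : constInt I ⟶ homSystem M s (syzSystem hS hA (n + 1))) :
    familyToHH hS M s hA (n + 1) F = 0 ↔
      ∃ G : constInt I ⟶ homSystem M s (cover hA (syzSystem hS hA n)),
        G ≫ kernelHom M s hA (syzSystem hS hA n) = F := by
  obtain ⟨g, rfl⟩ := (topRestrict_bijective M s hA (syzSystem hS hA (n + 1))).2 F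
  rw [familyToHH_topRestrict]
  refine ((topSyzygies hS hA).toExt_succ_eq_zero_iff n g).trans ?_
  have h (G : (cover hA (syzSystem hS hA n)).top ⟶ M.shift s) :
      topRestrict M s (kernel (coverProj hA (syzSystem hS hA n)))
        ((kernelIncl (coverProj hA (syzSystem hS hA n))).top ≫ G) =
      topRestrict M s _ G ≫ kernelHom M s hA (syzSystem hS hA n) :=
    topRestrict_comp M s (kernelIncl (coverProj hA (syzSystem hS hA n))) G
  constructor
  · rintro ⟨G, rfl⟩
    exact ⟨topRestrict M s _ G, (h G).symm⟩
  · rintro ⟨G, hG⟩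
    obtain ⟨G, rfl⟩ := topRestrict_cover_surjective M s hA (syzSystem hS hA n) G
    exact ⟨G, topRestrict_injective M s (kernel (coverProj hA (syzSystem hS hA n)))
      ((h G).trans hG)⟩

/-- The spliced complex has terms `homSystem` of the free covers, cycles `homSystem` of the syzygies
and cohomology `hhSystem`; its limit computes `HH 𝒜 M n s` through `familyToHH`. -/
theorem exists_hochschildSpectralSequence
    (hA : ∀ a : A, ∃ α, a ∈ (S α).toSubalgebra) :
    ∃ E : E₂CohomologicalSpectralSequenceNat AddCommGrpCat.{u},
      (∀ (hr : (2 : ℤ) ≤ 2) (p q : ℕ), Nonempty ((E.page 2 hr).X (p, q) ≅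
        derivedLim p (hhSystem S hS M q s))) ∧
      ConvergesTo E (fun n => HH 𝒜 M n s) := by
  obtain ⟨E, hE, hE'⟩ := exists_spectralSequence_of_splice
    (fun n => coverHom M s hA (syzSystem hS hA n)) (fun n => kernelHom M s hA (syzSystem hS hA n))
    (fun n => coverHom_kernelHom M s hA (syzSystem hS hA n))
    (fun n => exact_coverHom_kernelHom M s hA (syzSystem hS hA n)) (constInt I)
    (fun n => extAcyclic_homSystem_cover M s hA (syzSystem hS hA n))
    (fun n => toHHSystem hA M s n) (kernelHom_toHHSystem M s hA)
    (exact_kernelHom_toHHSystem M s hA) (fun n => HH 𝒜 M n s) (familyToHH hS M s hA)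
    (familyToHH_surjective M s hA) (familyToHH_zero_injective M s hA)
    (familyToHH_succ_eq_zero_iff M s hA)
  refine ⟨E, fun hr p q => ?_, hE'⟩
  obtain ⟨x⟩ := hE hr p q
  obtain ⟨y⟩ := nonempty_derivedLim_iso_ext (hhSystem S hS M q s) p
  exact ⟨x ≪≫ y.symm⟩

end EnvSystem

end HochschildSpectralSequence

end

theorem proposition5p8 {A : Type u} [Ring A] [Algebra (ZMod 2) A]
    (𝒜 : ℕ → Submodule (ZMod 2) A) [GradedAlgebra 𝒜]
    {I : Type u} [Preorder I] [Nonempty I] [IsDirected I (· ≤ ·)]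
    (S : I → GradedSubalgebra 𝒜)
    (hS : ∀ α β, α ≤ β → (S α).toSubalgebra ≤ (S β).toSubalgebra)
    (hA : ∀ a : A, ∃ α, a ∈ (S α).toSubalgebra)
    (M : GradedModuleCat (envDeg 𝒜)) (s : ℤ) :
    ∃ E : E₂CohomologicalSpectralSequenceNat AddCommGrpCat.{u},
      (∀ p q : ℕ, Nonempty
        ((E.page 2).X (p, q) ≅ derivedLim p (GradedSubalgebra.hhSystem S hS M q s))) ∧
      ConvergesTo E (fun n => HH 𝒜 M n s) :=
  let ⟨E, hE, hE'⟩ := EnvSystem.exists_hochschildSpectralSequence M s hA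
  ⟨E, fun p q => hE _ p q, hE'⟩
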